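/- **Setting.** Let $M$ be a compact boundaryless smooth Riemannian manifold with induced distance $d$, and let $\mathcal X^1(M)$ be the space of $C^1$ vector fields on $M$ with the $C^1$ topology. The flow of $X\in\mathcal X^1(M)$ is denoted $X_t$. A singularity of $X$ is a point $\sigma$ with $X(\sigma)=0$; a periodic orbit is the orbit of a point $p$ with $X(p)\ne 0$ and $X_T(p)=p$ for some $T>0$. A set $\Lambda\subset M$ is *shadowable* for $X_t$ if for every $\varepsilon>0$ there is $\delta>0$ such that for all sequences $x_i\in\Lambda$, $t_i\ge 1$ $(i\in\mathbb Z)$ with $d(X_{t_i}(x_i),x_{i+1})<\delta$ for all $i$, there are a point $y\in M$ and an increasing homeomorphism $h:\mathbb R\to\mathbb R$ with $h(0)=0$ such that $d(X_{h(t)}(y),X_{t-S_i}(x_i))<\varepsilon$ for all $i\in\mathbb Z$ and $t\in[S_i,S_{i+1}]$, where $S_0=0$ and $S_{i+1}-S_i=t_i$. For $U\subset M$ and $Y\in\mathcal X^1(M)$ put $\Lambda_Y=\bigcap_{t\in\mathbb R}Y_t(U)$. A compact $X_t$-invariant set $\Lambda$ is *robustly shadowable*, with isolating block $U$, if $U$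 is an open or compact neighbourhood of $\Lambda$ with $\Lambda=\bigcap_{t\in\mathbb R}X_t(U)$, and there is a $C^1$-neighbourhood of $X$ such that for every $Y$ in it the continuation $\Lambda_Y$ is shadowable for $Y_t$. A compact $X_t$-invariant set $K$ is *hyperbolic* for $X_t$ if there are a continuous $DX_t$-invariant splitting $T_KM=E^s\oplus\langle X\rangle\oplus E^u$ and constants $C,\lambda>0$ with $\|DX_t|_{E^s(x)}\|\le Ce^{-\lambda t}$ and $\|DX_{-t}|_{E^u(x)}\|\le Ce^{-\lambda t}$ for all $x\in K$, $t>0$ (here $\langle X\rangle$ is the span of $X$, which is $0$ at singularities). **Proposition 3.2.** Let $X\in\mathcal X^1(M)$, and let $\Lambda$ be a robustly shadowable set of $X_t$ with isolating block $U$. Then there is a $C^1$-neighbourhood $\mathcal U$ of $X$ such that for every $Y\in\mathcal U$, every singularity and every periodic orbit of $Y_t$ contained in $\Lambda_Y=\bigcap_{t\in\mathbb R}Y_t(U)$ is hyperbolic for $Y_t$. -/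

import Mathlib

open Set Filter Manifold Bundle
open scoped Topology ContDiff

namespace RobustShadowing

section Smooth

variable {n : ℕ} {M : Type*} [TopologicalSpace M] [ChartedSpace (EuclideanSpace ℝ (Fin n)) M]
  [IsManifold (𝓡 n) ∞ M]

variable (n M) in
/-- `C¹` vector fields on the `n`-dimensional smooth manifold `M`: the `C¹` sections of its
tangent bundle. -/
abbrev C1VectorField : Type _ :=
  ContMDiffSection (𝓡 n) (EuclideanSpace ℝ (Fin n)) 1 (TangentSpace (𝓡 n) : M → Type _)

/-- The expression of the vector field `X` in the preferred chart at `c`: at a point `z` of the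
target of the chart, it is the image of the vector `X p`, where `p` is the point with coordinates
`z`, under the derivative of the chart. (Only points `z` of the target are relevant.) -/
noncomputable def localRep (X : C1VectorField n M) (c : M) (z : EuclideanSpace ℝ (Fin n)) :
    EuclideanSpace ℝ (Fin n) :=
  mfderiv (𝓡 n) 𝓘(ℝ, EuclideanSpace ℝ (Fin n)) (extChartAt (𝓡 n) c)
    ((extChartAt (𝓡 n) c).symm z) (X ((extChartAt (𝓡 n) c).symm z))

/-- The (weak) `C¹` topology on the space of `C¹` vector fields: the coarsest topology for which,
in each chart, the local expression of a vector field and the first derivative of that expression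
depend continuously on the field with respect to uniform convergence on the compact subsets of the
target of the chart. On a compact manifold this is the usual `C¹` topology. -/
noncomputable instance c1Topology : TopologicalSpace (C1VectorField n M) :=
  ⨅ c : M, TopologicalSpace.induced
    (fun X => UniformOnFun.ofFun {K | IsCompact K ∧ K ⊆ (extChartAt (𝓡 n) c).target}
      (fun z => (localRep X c z, fderiv ℝ (localRep X c) z)))
    inferInstance

open Classical in
/-- The flow `X_t` of a vector field: `t ↦ flow X t x` is the integral curve of `X` through `x`,
defined for all times. On a compact boundaryless manifold it exists, and it is unique. (Where no
such curve exists, the value is `x`; that does not occur on the compact manifolds considered.) -/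
noncomputable def flow (X : C1VectorField n M) (t : ℝ) (x : M) : M :=
  if h : ∃ γ : ℝ → M, γ 0 = x ∧ IsMIntegralCurve (I := 𝓡 n) γ (fun p => X p) then
    h.choose t else x

/-- `Λ` is invariant under the flow of `X`. -/
def IsInvariant (X : C1VectorField n M) (Λ : Set M) : Prop :=
  ∀ t : ℝ, flow X t '' Λ = Λ

/-- The maximal invariant set `⋂ t, X_t(U)` of `X` in `U`. For an isolating block `U` of an
invariant set `Λ` of a nearby vector field, it is the continuation of `Λ` for `X` and `U`. -/
def continuation (X : C1VectorField n M) (U : Set M) : Set M :=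
  ⋂ t : ℝ, flow X t '' U

/-- `U` is an isolating block of the locally maximal set `Λ` of `X`: a neighbourhood of `Λ`,
open or compact, in which `Λ` is the maximal invariant set. -/
def IsIsolatingBlock (X : C1VectorField n M) (Λ U : Set M) : Prop :=
  U ∈ 𝓝ˢ Λ ∧ (IsOpen U ∨ IsCompact U) ∧ Λ = continuation X U

/-- The orbit of `x`. -/
def orbit (X : C1VectorField n M) (x : M) : Set M :=
  range fun t : ℝ => flow X t x

/-- `σ` is a singularity of `X`. -/
def IsSingularity (X : C1VectorField n M) (σ : M) : Prop :=
  X σ = 0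

/-- `γ` is a periodic (closed) orbit of `X`: the orbit of a nonsingular point to which the flow
returns after some positive time. -/
def IsPeriodicOrbit (X : C1VectorField n M) (γ : Set M) : Prop :=
  ∃ p : M, γ = orbit X p ∧ ¬ IsSingularity X p ∧ ∃ T : ℝ, 0 < T ∧ flow X T p = p

/-- The family of subspaces `F x ⊆ T_x M`, `x ∈ Λ`, is continuous: near each point of `Λ` it has
a continuous frame. -/
def IsContinuousSubbundleOn (Λ : Set M) (F : (x : M) → Submodule ℝ (TangentSpace (𝓡 n) x)) :
    Prop :=
  ∀ x₀ ∈ Λ, ∃ (k : ℕ) (v : Fin k → (x : M) → TangentSpace (𝓡 n) x), ∀ᶠ x in 𝓝[Λ] x₀,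
    (∀ i, ContinuousWithinAt (fun y => (⟨y, v i y⟩ : TangentBundle (𝓡 n) M)) Λ x) ∧
    LinearIndependent ℝ (fun i => v i x) ∧
    Submodule.span ℝ (range fun i => v i x) = F x

/-- The family of subspaces `F x ⊆ T_x M`, `x ∈ Λ`, is invariant under the tangent flow. -/
def IsTangentFlowInvariantOn (X : C1VectorField n M) (Λ : Set M)
    (F : (x : M) → Submodule ℝ (TangentSpace (𝓡 n) x)) : Prop :=
  ∀ x ∈ Λ, ∀ t : ℝ,
    (F x).map (mfderiv (𝓡 n) (𝓡 n) (flow X t) x).toLinearMap = F (flow X t x)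

/-- The compact invariant set `Λ` of `X` is hyperbolic: there is a continuous splitting
`T_Λ M = Es ⊕ ⟨X⟩ ⊕ Eu`, invariant under the tangent flow `D X_t`, which contracts `Es` uniformly
exponentially in forward time and `Eu` in backward time. At a singularity `⟨X⟩ = 0`. -/
def IsHyperbolic [RiemannianBundle (fun x : M => TangentSpace (𝓡 n) x)]
    (X : C1VectorField n M) (Λ : Set M) : Prop :=
  IsCompact Λ ∧ IsInvariant X Λ ∧
  ∃ Es Eu : (x : M) → Submodule ℝ (TangentSpace (𝓡 n) x),
    IsContinuousSubbundleOn Λ Es ∧ IsContinuousSubbundleOn Λ Eu ∧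
    IsTangentFlowInvariantOn X Λ Es ∧ IsTangentFlowInvariantOn X Λ Eu ∧
    (∀ x ∈ Λ, DirectSum.IsInternal ![Es x, Submodule.span ℝ {X x}, Eu x]) ∧
    ∃ C : ℝ, 0 < C ∧ ∃ lam : ℝ, 0 < lam ∧ ∀ x ∈ Λ, ∀ t : ℝ, 0 < t →
      (∀ v ∈ Es x, ‖mfderiv (𝓡 n) (𝓡 n) (flow X t) x v‖ ≤ C * Real.exp (-lam * t) * ‖v‖) ∧
      (∀ v ∈ Eu x, ‖mfderiv (𝓡 n) (𝓡 n) (flow X (-t)) x v‖ ≤ C * Real.exp (-lam * t) * ‖v‖)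

end Smooth

/-- The starting time `S_i` of the `i`-th piece of a chain with durations `t_j`: it is
`t_0 + ⋯ + t_{i-1}` for `i > 0`, `0` for `i = 0`, and `-(t_i + ⋯ + t_{-1})` for `i < 0`. -/
noncomputable def chainTime (t : ℤ → ℝ) (i : ℤ) : ℝ :=
  ∑ j ∈ Finset.Ico 0 i, t j - ∑ j ∈ Finset.Ico i 0, t j

section Metric

variable {n : ℕ} {M : Type*} [EMetricSpace M] [ChartedSpace (EuclideanSpace ℝ (Fin n)) M]
  [IsManifold (𝓡 n) ∞ M]

/-- `(x i, t i)`, `i ∈ ℤ`, is a (two-sided infinite) `δ`-pseudo orbit of `X`, with all points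
`x i` in `Λ`. -/
def IsPseudoOrbitIn (X : C1VectorField n M) (Λ : Set M) (δ : ℝ) (x : ℤ → M) (t : ℤ → ℝ) : Prop :=
  (∀ i, x i ∈ Λ) ∧ (∀ i, 1 ≤ t i) ∧
    ∀ i, edist (flow X (t i) (x i)) (x (i + 1)) < ENNReal.ofReal δ

/-- `Λ` is shadowable for the flow of `X`: for every `ε > 0` there is `δ > 0` such that every
`δ`-pseudo orbit in `Λ` is `ε`-shadowed by a true orbit of a point `y` of the ambient manifold, up
to a reparametrization `h`, an increasing homeomorphism of the line fixing `0`. The property makes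
sense for every subset `Λ`; its compactness is not part of it. -/
def IsShadowable (X : C1VectorField n M) (Λ : Set M) : Prop :=
  ∀ ε : ℝ, 0 < ε → ∃ δ : ℝ, 0 < δ ∧ ∀ (x : ℤ → M) (t : ℤ → ℝ), IsPseudoOrbitIn X Λ δ x t →
    ∃ (y : M) (h : ℝ ≃ₜ ℝ), StrictMono h ∧ h 0 = 0 ∧
      ∀ (i : ℤ) (s : ℝ), s ∈ Icc (chainTime t i) (chainTime t (i + 1)) →
        edist (flow X (h s) y) (flow X (s - chainTime t i) (x i)) < ENNReal.ofReal ε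

/-- The compact invariant set `Λ` of `X` is robustly shadowable, with isolating block `U`: for
every `Y` in some `C¹` neighbourhood of `X`, the continuation of `Λ` for `Y` and `U` is
shadowable. -/
def IsRobustlyShadowable (X : C1VectorField n M) (Λ U : Set M) : Prop :=
  IsCompact Λ ∧ IsInvariant X Λ ∧ IsIsolatingBlock X Λ U ∧
    ∃ 𝒰 ∈ 𝓝 X, ∀ Y ∈ 𝒰, IsShadowable Y (continuation Y U)

end Metric

end RobustShadowing

/-!
Failure of hyperbolicity can be seen in linear algebra. For a singularity `σ` of a vector field `Y`
let `L` be the time-one map of the linear part of `Y` at `σ`; for a periodic orbit let `L` be the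
derivative of the return map to a section. If no nonzero vector has a bounded two-sided orbit under
`L` (`boundedOrbits L = ⊥`), then `L` has no eigenvalue on the unit circle, and the singularity or
periodic orbit is hyperbolic (`isHyperbolic_orbit`): the stable and unstable spaces of the time-`T`
tangent map split the tangent space together with the field (`isInternal_stable_fixed_unstable`),
and the tangent flow carries this splitting around the orbit.

Suppose, on the other hand, that some nonzero `v` has a bounded orbit under `L`. An arbitrarily
`C¹`-small perturbation `Z` of `Y` keeps the orbit and makes the dynamics near it exactly linear.
At a singularity, the nonlinear part of the field is cut off in a chart; it is `C¹`-small near the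
singularity since its value and derivative vanish there (`eventually_cutoff_small`). At a periodic
orbit the field is changed in a flow box away from the section, so that orbits which enter the box
at height `y` leave it at height `G y` (`exists_flowBox_perturbation`). With `G = f⁻¹ ∘ L`, where
`f` is the return map, the return map of `Z` is `L` near the origin
(`IsFlowBox.exists_isLinearSection`). Both cases give an `IsLinearSection`.

Such a `Z` is not shadowable on its maximal invariant set in any neighbourhood of the orbit
(`IsLinearSection.not_isShadowable`). The set contains the orbits of all small multiples of `v`.
A pseudo orbit stays on the closed orbit for negative times and then passes, by small jumps between
successive multiples of `v`, to the orbit of `v` itself. A point shadowing it has a parameter `y` in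
the section with bounded orbit under `L`, small in the far past. As `L` acts on `boundedOrbits L` by
uniformly bounded powers, `y` is recurrent, so it is small (`norm_le_of_eventually_backward`), which
contradicts its being close to `L ^ k v` for some `k`. This excludes `v`, since `Z` can be chosen in
the neighbourhood of fields that robust shadowability provides.

The neighbourhood of the given field is the interior of that one, cut down so that the maximal
invariant set stays in the interior of the block. For an open block this is automatic, and for a
compact one it holds for nearby fields (`eventually_continuation_subset_interior`). The remaining
parts supply the facts about `C¹` vector fields used above: completeness and `C¹` dependence of the
flow on time and point (`contMDiff_flow`), continuous dependence on the field
(`continuousAt_flow_field`), and neighbourhoods in the `C¹` topology (`exists_add_pushField_mem`).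
-/

namespace RobustShadowing

/-! ### Bounded orbits of linear automorphisms -/

section LinearDynamics

variable {F : Type*} [NormedAddCommGroup F] [NormedSpace ℝ F]

/-- The vectors whose full orbit under the linear automorphism `L` is bounded. -/
def boundedOrbits (L : F ≃L[ℝ] F) : Submodule ℝ F where
  carrier := {v | ∃ C, ∀ k : ℤ, ‖(L ^ k) v‖ ≤ C}
  zero_mem' := ⟨0, fun k => by simp⟩
  add_mem' := by
    rintro v w ⟨C, hC⟩ ⟨C', hC'⟩
    exact ⟨C + C', fun k => by
      rw [map_add]; exact (norm_add_le _ _).trans (add_le_add (hC k) (hC' k))⟩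
  smul_mem' := by
    rintro c v ⟨C, hC⟩
    exact ⟨‖c‖ * C, fun k => by
      rw [map_smul, norm_smul]; exact mul_le_mul_of_nonneg_left (hC k) (norm_nonneg _)⟩

theorem zpow_apply_add (L : F ≃L[ℝ] F) (j k : ℤ) (v : F) :
    (L ^ (j + k)) v = (L ^ j) ((L ^ k) v) := by
  rw [zpow_add]; rfl

theorem zpow_mem_boundedOrbits {L : F ≃L[ℝ] F} {v : F} (hv : v ∈ boundedOrbits L) (k : ℤ) :
    (L ^ k) v ∈ boundedOrbits L := by
  obtain ⟨C, hC⟩ := hv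
  exact ⟨C, fun j => by rw [← zpow_apply_add]; exact hC _⟩

/-- On the space of vectors with bounded orbit the powers of `L` are uniformly bounded, by the
uniform boundedness principle. -/
theorem boundedOrbits_uniform [FiniteDimensional ℝ F] (L : F ≃L[ℝ] F) :
    ∃ C : ℝ, 0 < C ∧ ∀ v ∈ boundedOrbits L, ∀ k : ℤ, ‖(L ^ k) v‖ ≤ C * ‖v‖ := by
  have : CompleteSpace (boundedOrbits L) := FiniteDimensional.complete ℝ _
  obtain ⟨C, hC⟩ := banach_steinhaus
    (g := fun k : ℤ => ((L ^ k : F ≃L[ℝ] F) : F →L[ℝ] F).comp (boundedOrbits L).subtypeL)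
    (fun x => by obtain ⟨C, hC⟩ := x.2; exact ⟨C, fun k => hC k⟩)
  refine ⟨max C 1, by positivity, fun v hv k => ?_⟩
  have := (((L ^ k : F ≃L[ℝ] F) : F →L[ℝ] F).comp (boundedOrbits L).subtypeL).le_of_opNorm_le
    ((hC k).trans (le_max_left C 1)) ⟨v, hv⟩
  simpa using this

/-- Recurrence: a bounded orbit that is eventually small in the past is always small. -/
theorem norm_le_of_eventually_backward [FiniteDimensional ℝ F] (L : F ≃L[ℝ] F) {y : F}
    (hy : y ∈ boundedOrbits L) {ζ : ℝ} {k₀ : ℕ}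
    (h : ∀ k : ℕ, k₀ ≤ k → ‖(L ^ (-(k : ℤ))) y‖ ≤ ζ) : ‖y‖ ≤ ζ := by
  obtain ⟨C, hC0, hC⟩ := boundedOrbits_uniform L
  have : ProperSpace F := FiniteDimensional.proper ℝ F
  let z : ℕ → F := fun i => (L ^ (-((i * (k₀ + 1) : ℕ) : ℤ))) y
  have hz : ∀ i, z i ∈ Metric.closedBall (0 : F) (C * ‖y‖) := fun i => by
    simpa using hC y hy _
  obtain ⟨a, -, φ, hφ, hlim⟩ := (isCompact_closedBall (0 : F) (C * ‖y‖)).tendsto_subseq hz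
  refine le_of_forall_pos_le_add fun η hη => ?_
  obtain ⟨N, hN⟩ := Metric.cauchySeq_iff.1 hlim.cauchySeq (η / C) (by positivity)
  have hd := hN (N + 1) (by simp) N (by simp)
  have hlt : φ N < φ (N + 1) := hφ (Nat.lt_succ_self N)
  set i := φ N
  set j := φ (N + 1)
  -- translate the two close points `z i`, `z j` by `L ^ (i * (k₀ + 1))`
  have hmem : z i - z j ∈ boundedOrbits L :=
    sub_mem (zpow_mem_boundedOrbits hy _) (zpow_mem_boundedOrbits hy _)
  have h1 := hC _ hmem ((i * (k₀ + 1) : ℕ) : ℤ)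
  rw [map_sub, ← zpow_apply_add, ← zpow_apply_add, add_neg_cancel, zpow_zero] at h1
  have h2 : (((i * (k₀ + 1) : ℕ) : ℤ) + -((j * (k₀ + 1) : ℕ) : ℤ))
      = -(((j - i) * (k₀ + 1) : ℕ) : ℤ) := by
    have : j = i + (j - i) := by omega
    generalize j - i = d at this
    rw [this]
    push_cast; ring
  rw [h2] at h1
  have h3 := h ((j - i) * (k₀ + 1)) (by
    have : 1 ≤ j - i := by omega
    nlinarith)
  have h4 : C * ‖z i - z j‖ ≤ η := by
    have : ‖z i - z j‖ ≤ η / C := by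
      rw [← dist_eq_norm, dist_comm]; exact hd.le
    calc C * ‖z i - z j‖ ≤ C * (η / C) := by gcongr
      _ = η := by field_simp
  have h5 : ‖y‖ ≤ ‖y - (L ^ (-(((j - i) * (k₀ + 1) : ℕ) : ℤ))) y‖
      + ‖(L ^ (-(((j - i) * (k₀ + 1) : ℕ) : ℤ))) y‖ := by
    simpa using norm_add_le (y - (L ^ (-(((j - i) * (k₀ + 1) : ℕ) : ℤ))) y)
      ((L ^ (-(((j - i) * (k₀ + 1) : ℕ) : ℤ))) y)
  have h6 : ‖y - (L ^ (-(((j - i) * (k₀ + 1) : ℕ) : ℤ))) y‖ ≤ C * ‖z i - z j‖ := h1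
  linarith

end LinearDynamics

/-! ### Stable and unstable spaces of linear automorphisms -/

section Splitting

/-- The sequence `a` of vectors decays exponentially. -/
def ExpDecay {G : Type*} [NormedAddCommGroup G] (a : ℕ → G) : Prop :=
  ∃ C θ : ℝ, 0 < θ ∧ θ < 1 ∧ ∀ k, ‖a k‖ ≤ C * θ ^ k

theorem ExpDecay.add {G : Type*} [NormedAddCommGroup G] {a b : ℕ → G} (ha : ExpDecay a)
    (hb : ExpDecay b) : ExpDecay (fun k => a k + b k) := by
  obtain ⟨C, θ, h0, h1, h⟩ := ha
  obtain ⟨C', θ', h0', h1', h'⟩ := hb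
  refine ⟨|C| + |C'|, max θ θ', by positivity, max_lt h1 h1', fun k => ?_⟩
  calc ‖a k + b k‖ ≤ ‖a k‖ + ‖b k‖ := norm_add_le _ _
    _ ≤ |C| * (max θ θ') ^ k + |C'| * (max θ θ') ^ k := by
      refine add_le_add ((h k).trans ?_) ((h' k).trans ?_)
      · exact mul_le_mul (le_abs_self _) (pow_le_pow_left₀ h0.le (le_max_left _ _) _)
          (by positivity) (abs_nonneg _)
      · exact mul_le_mul (le_abs_self _) (pow_le_pow_left₀ h0'.le (le_max_right _ _) _)
          (by positivity) (abs_nonneg _)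
    _ = _ := by ring

theorem expDecay_zero {G : Type*} [NormedAddCommGroup G] : ExpDecay (fun _ => (0 : G)) :=
  ⟨0, 1 / 2, by norm_num, by norm_num, fun k => by simp⟩

/-- A generalized eigenvector for an eigenvalue in the open unit disc has an exponentially
decaying orbit. -/
theorem expDecay_of_genEigenvector {G : Type*} [NormedAddCommGroup G] [NormedSpace ℂ G]
    (f : Module.End ℂ G) {μ : ℂ} (hμ : ‖μ‖ < 1) (d : ℕ) :
    ∀ v : G, ((f - algebraMap ℂ (Module.End ℂ G) μ) ^ d) v = 0 →
      ExpDecay (fun k => (f ^ k) v) := by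
  obtain ⟨θ, hθ, hθ1⟩ := exists_between hμ
  have hθ0 : 0 < θ := (norm_nonneg _).trans_lt hθ
  suffices H : ∀ v : G, ((f - algebraMap ℂ (Module.End ℂ G) μ) ^ d) v = 0 →
      ∃ C, ∀ k, ‖(f ^ k) v‖ ≤ C * θ ^ k by
    intro v hv
    obtain ⟨C, hC⟩ := H v hv
    exact ⟨C, θ, hθ0, hθ1, hC⟩
  induction d with
  | zero =>
    intro v hv
    rw [pow_zero] at hv
    change v = 0 at hv
    exact ⟨0, fun k => by simp [hv]⟩
  | succ d ih =>
    intro v hv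
    set w := (f - algebraMap ℂ (Module.End ℂ G) μ) v with hw
    rw [pow_succ] at hv
    obtain ⟨C, hC⟩ := ih w hv
    have hfv : f v = μ • v + w := by simp [hw]
    refine ⟨max ‖v‖ (C / (θ - ‖μ‖)), fun k => ?_⟩
    set K := max ‖v‖ (C / (θ - ‖μ‖))
    have hK : C ≤ (θ - ‖μ‖) * K := by
      have : C / (θ - ‖μ‖) ≤ K := le_max_right _ _
      rwa [div_le_iff₀ (by linarith), mul_comm] at this
    induction k with
    | zero => simp [K]
    | succ k ihk =>
      rw [pow_succ]
      change ‖(f ^ k) (f v)‖ ≤ _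
      rw [hfv, map_add, map_smul]
      calc ‖μ • (f ^ k) v + (f ^ k) w‖ ≤ ‖μ‖ * ‖(f ^ k) v‖ + ‖(f ^ k) w‖ := by
            rw [← norm_smul]; exact norm_add_le _ _
        _ ≤ ‖μ‖ * (K * θ ^ k) + C * θ ^ k := by
            gcongr
            exact hC k
        _ ≤ ‖μ‖ * (K * θ ^ k) + ((θ - ‖μ‖) * K) * θ ^ k := by gcongr
        _ = K * θ ^ (k + 1) := by ring

/-- Decomposition of a complex vector along the eigenvalues inside and outside the unit circle. -/
theorem exists_expDecay_add_complex {G : Type*} [NormedAddCommGroup G] [NormedSpace ℂ G]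
    [FiniteDimensional ℂ G] (f g : Module.End ℂ G) (hfg : f * g = 1) (hgf : g * f = 1)
    (h : ∀ (μ : ℂ) (v : G), ‖μ‖ = 1 → f v = μ • v → v = 0) (v : G) :
    ∃ a b, v = a + b ∧ ExpDecay (fun k => (f ^ k) a) ∧ ExpDecay (fun k => (g ^ k) b) := by
  have hv : v ∈ ⨆ μ : ℂ, f.maxGenEigenspace μ := by
    rw [Module.End.iSup_maxGenEigenspace_eq_top]; trivial
  refine Submodule.iSup_induction _ (motive := fun v => ∃ a b, v = a + b ∧
    ExpDecay (fun k => (f ^ k) a) ∧ ExpDecay (fun k => (g ^ k) b)) hv ?_ ?_ ?_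
  · intro μ w hw
    rw [Module.End.mem_maxGenEigenspace] at hw
    obtain ⟨d, hd⟩ := hw
    rw [← Algebra.algebraMap_eq_smul_one] at hd
    rcases lt_trichotomy ‖μ‖ 1 with hlt | heq | hgt
    · exact ⟨w, 0, by simp, expDecay_of_genEigenvector f hlt d w hd, by
        simpa using expDecay_zero⟩
    · have hw0 : w = 0 := by
        clear hv
        induction d generalizing w with
        | zero => simpa using hd
        | succ d ih =>
          rw [pow_succ] at hd
          have := ih _ hd
          refine h μ w heq ?_
          simpa [sub_eq_zero] using this
      exact ⟨0, 0, by simp [hw0], by simpa using expDecay_zero, by simpa using expDecay_zero⟩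
    · refine ⟨0, w, by simp, by simpa using expDecay_zero,
        expDecay_of_genEigenvector g (μ := μ⁻¹) ?_ d w ?_⟩
      · rw [norm_inv]; exact inv_lt_one_of_one_lt₀ hgt
      · have hμ : μ ≠ 0 := by rintro rfl; simp at hgt; linarith
        have e : g - algebraMap ℂ (Module.End ℂ G) μ⁻¹
            = (-μ⁻¹ • g) * (f - algebraMap ℂ (Module.End ℂ G) μ) := by
          rw [mul_sub, smul_mul_assoc, hgf, smul_mul_assoc, ← Algebra.commutes, ← Algebra.smul_def,
            smul_smul, Algebra.algebraMap_eq_smul_one]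
          rw [neg_mul, inv_mul_cancel₀ hμ]
          simp; abel
        have hc : Commute (-μ⁻¹ • g) (f - algebraMap ℂ (Module.End ℂ G) μ) := by
          have : Commute g f := by rw [Commute, SemiconjBy, hfg, hgf]
          exact Commute.smul_left (this.sub_right (Algebra.commutes μ g).symm) _
        rw [e, hc.mul_pow]
        change ((-μ⁻¹ • g) ^ d) (((f - algebraMap ℂ (Module.End ℂ G) μ) ^ d) w) = 0
        rw [hd, map_zero]
  · exact ⟨0, 0, by simp, by simpa using expDecay_zero, by simpa using expDecay_zero⟩
  · rintro x y ⟨a, b, rfl, h1, h2⟩ ⟨a', b', rfl, h1', h2'⟩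
    exact ⟨a + a', b + b', by abel, by simpa using h1.add h1', by simpa using h2.add h2'⟩

variable {F : Type*} [NormedAddCommGroup F] [NormedSpace ℝ F] [FiniteDimensional ℝ F]

/-- A linear automorphism without nonzero bounded orbits is hyperbolic: every vector is the sum of
one which decays in the future and one which decays in the past. -/
theorem exists_expDecay_add (L : F ≃L[ℝ] F) (h : boundedOrbits L = ⊥) (v : F) :
    ∃ a b, v = a + b ∧ ExpDecay (fun k : ℕ => (L ^ k) a) ∧
      ExpDecay (fun k : ℕ => (L⁻¹ ^ k) b) := by
  let ι := Fin (Module.finrank ℝ F)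
  let e : F ≃L[ℝ] (ι → ℝ) := (Module.finBasis ℝ F).equivFunL
  -- the complexification of an endomorphism, in coordinates
  let cx : Module.End ℝ F → Module.End ℂ (ι → ℂ) := fun T =>
    Matrix.toLin' ((LinearMap.toMatrix (Module.finBasis ℝ F) (Module.finBasis ℝ F) T).map
      (algebraMap ℝ ℂ))
  let re : (ι → ℂ) →L[ℝ] F := (e.symm : (ι → ℝ) →L[ℝ] F).comp
    (ContinuousLinearMap.pi fun i => Complex.reCLM.comp (ContinuousLinearMap.proj i))
  let im : (ι → ℂ) →L[ℝ] F := (e.symm : (ι → ℝ) →L[ℝ] F).comp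
    (ContinuousLinearMap.pi fun i => Complex.imCLM.comp (ContinuousLinearMap.proj i))
  have hmul : ∀ S T, cx (S * T) = cx S * cx T := by
    intro S T
    simp only [cx]
    rw [Module.End.mul_eq_comp, LinearMap.toMatrix_comp _ (Module.finBasis ℝ F), Matrix.map_mul,
      Matrix.toLin'_mul]
    rfl
  have hone : cx 1 = 1 := by
    simp only [cx]
    rw [Module.End.one_eq_id, LinearMap.toMatrix_id, Matrix.map_one _ (by simp) (by simp),
      Matrix.toLin'_one]
    rfl
  have hpow : ∀ (T : Module.End ℝ F) (k : ℕ), cx (T ^ k) = cx T ^ k := by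
    intro T k
    induction k with
    | zero => simp [hone]
    | succ k ih => rw [pow_succ, hmul, ih, pow_succ]
  have hcoord : ∀ (T : Module.End ℝ F) (x : F),
      e (T x) = Matrix.mulVec (LinearMap.toMatrix (Module.finBasis ℝ F) (Module.finBasis ℝ F) T)
        (e x) := by
    intro T x
    exact (LinearMap.toMatrix_mulVec_repr (Module.finBasis ℝ F) (Module.finBasis ℝ F) T x).symm
  have hre : ∀ (T : Module.End ℝ F) (w : ι → ℂ), re (cx T w) = T (re w) := by
    intro T w
    apply e.injective
    rw [hcoord]
    ext i
    simp [re, cx, Matrix.mulVec, dotProduct]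
    rfl
  have him : ∀ (T : Module.End ℝ F) (w : ι → ℂ), im (cx T w) = T (im w) := by
    intro T w
    apply e.injective
    rw [hcoord]
    ext i
    simp [im, cx, Matrix.mulVec, dotProduct]
    rfl
  have hLpow : ∀ (T : F ≃L[ℝ] F) (k : ℕ) (x : F),
      (T ^ k) x = (((T : F →L[ℝ] F) : F →ₗ[ℝ] F) ^ k : Module.End ℝ F) x := by
    intro T k
    induction k with
    | zero => intro x; rfl
    | succ k ih => intro x; rw [pow_succ, pow_succ]; exact ih (T x)
  have hcL : cx ((L : F →L[ℝ] F) : F →ₗ[ℝ] F) * cx ((L⁻¹ : F ≃L[ℝ] F) : F →L[ℝ] F) = 1 := by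
    rw [← hmul, ← hone]; congr 1; ext x; exact L.apply_symm_apply x
  have hcL' : cx ((L⁻¹ : F ≃L[ℝ] F) : F →L[ℝ] F) * cx ((L : F →L[ℝ] F) : F →ₗ[ℝ] F) = 1 := by
    rw [← hmul, ← hone]; congr 1; ext x; exact L.symm_apply_apply x
  have hneg : ∀ k : ℕ, L ^ (-(k : ℤ)) = L⁻¹ ^ k := by
    intro k; rw [zpow_neg, zpow_natCast, inv_pow]
  -- an eigenvector for an eigenvalue of modulus one has a bounded orbit
  have hbdd : ∀ (P : (ι → ℂ) →L[ℝ] F), (∀ (T : Module.End ℝ F) (w : ι → ℂ),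
      P (cx T w) = T (P w)) → ∀ (μ : ℂ) (w : ι → ℂ), ‖μ‖ = 1 →
      cx ((L : F →L[ℝ] F) : F →ₗ[ℝ] F) w = μ • w → P w = 0 := by
    intro P hP μ w hμ hw
    have hμ0 : μ ≠ 0 := by rintro rfl; simp at hμ
    have h1 : ∀ k : ℕ, (cx ((L : F →L[ℝ] F) : F →ₗ[ℝ] F) ^ k) w = μ ^ k • w := by
      intro k
      induction k with
      | zero => simp
      | succ k ih => rw [pow_succ, Module.End.mul_apply, hw, map_smul, ih, smul_smul, pow_succ']
    have hw' : cx ((L⁻¹ : F ≃L[ℝ] F) : F →L[ℝ] F) w = μ⁻¹ • w := by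
      have := congrArg (cx ((L⁻¹ : F ≃L[ℝ] F) : F →L[ℝ] F)) hw
      rw [← Module.End.mul_apply, hcL', map_smul] at this
      rw [eq_inv_smul_iff₀ hμ0]
      exact this.symm
    have h2 : ∀ k : ℕ, (cx ((L⁻¹ : F ≃L[ℝ] F) : F →L[ℝ] F) ^ k) w = μ⁻¹ ^ k • w := by
      intro k
      induction k with
      | zero => simp
      | succ k ih => rw [pow_succ, Module.End.mul_apply, hw', map_smul, ih, smul_smul, pow_succ']
    have : P w ∈ boundedOrbits L := by
      refine ⟨‖P‖ * ‖w‖, fun k => ?_⟩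
      obtain ⟨k, rfl | rfl⟩ := k.eq_nat_or_neg
      · rw [zpow_natCast, hLpow, ← hP, hpow, h1]
        refine (P.le_opNorm _).trans ?_
        rw [norm_smul, norm_pow, hμ, one_pow, one_mul]
      · rw [hneg, hLpow, ← hP, hpow, h2]
        refine (P.le_opNorm _).trans ?_
        rw [norm_smul, norm_pow, norm_inv, hμ, inv_one, one_pow, one_mul]
    rw [h] at this
    exact this
  have hmod : ∀ (μ : ℂ) (w : ι → ℂ), ‖μ‖ = 1 →
      cx ((L : F →L[ℝ] F) : F →ₗ[ℝ] F) w = μ • w → w = 0 := by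
    intro μ w hμ hw
    have h1 := hbdd re hre μ w hμ hw
    have h2 := hbdd im him μ w hμ hw
    have h1' := (map_eq_zero_iff _ e.symm.injective).1 h1
    have h2' := (map_eq_zero_iff _ e.symm.injective).1 h2
    funext i
    exact Complex.ext (congrFun h1' i) (congrFun h2' i)
  obtain ⟨a, b, hab, ha, hb⟩ := exists_expDecay_add_complex _ _ hcL hcL' hmod
    (fun i => ((e v i : ℝ) : ℂ))
  have hcomp : ∀ (T : F ≃L[ℝ] F) (w : ι → ℂ),
      ExpDecay (fun k => (cx ((T : F →L[ℝ] F) : F →ₗ[ℝ] F) ^ k) w) →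
      ExpDecay (fun k : ℕ => (T ^ k) (re w)) := by
    rintro T w ⟨C, θ, h0, h1, h⟩
    refine ⟨‖re‖ * C, θ, h0, h1, fun k => ?_⟩
    change ‖(T ^ k) (re w)‖ ≤ _
    rw [hLpow, ← hre, hpow, mul_assoc]
    exact (re.le_opNorm _).trans (mul_le_mul_of_nonneg_left (h k) (norm_nonneg _))
  refine ⟨re a, re b, ?_, hcomp _ _ ha, hcomp _ _ hb⟩
  rw [← map_add, ← hab]
  apply e.injective
  ext i
  simp [re]

variable {V : Type*} [NormedAddCommGroup V] [NormedSpace ℝ V]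

/-- The stable space of a linear automorphism: the vectors whose forward orbit tends to `0`. -/
def stableSpace (D : V ≃L[ℝ] V) : Submodule ℝ V where
  carrier := {v | Tendsto (fun k : ℕ => (D ^ k) v) atTop (𝓝 0)}
  zero_mem' := by simp
  add_mem' := by
    intro v w hv hw
    simpa using Tendsto.add hv hw
  smul_mem' := by
    intro c v hv
    simpa using Tendsto.const_smul hv c

theorem mem_stableSpace {D : V ≃L[ℝ] V} {v : V} :
    v ∈ stableSpace D ↔ Tendsto (fun k : ℕ => (D ^ k) v) atTop (𝓝 0) := Iff.rfl

theorem ExpDecay.tendsto {G : Type*} [NormedAddCommGroup G] {a : ℕ → G} (ha : ExpDecay a) : Tendsto a atTop (𝓝 0) := by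
  obtain ⟨C, θ, h0, h1, h⟩ := ha
  refine squeeze_zero_norm h ?_
  simpa using (tendsto_pow_atTop_nhds_zero_of_lt_one h0.le h1).const_mul C

theorem pow_apply_add (D : V ≃L[ℝ] V) (j k : ℕ) (v : V) :
    (D ^ (j + k)) v = (D ^ j) ((D ^ k) v) := by
  rw [pow_add]; rfl

theorem pow_mem_stableSpace {D : V ≃L[ℝ] V} {v : V} (hv : v ∈ stableSpace D) (j : ℕ) :
    (D ^ j) v ∈ stableSpace D := by
  rw [mem_stableSpace] at *
  have := hv.comp (tendsto_add_atTop_nat j)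
  refine this.congr fun k => ?_
  exact pow_apply_add D k j v

/-- On the stable space the convergence to `0` is uniformly exponential. -/
theorem stableSpace_uniform [FiniteDimensional ℝ V] (D : V ≃L[ℝ] V) :
    ∃ C θ : ℝ, 0 < C ∧ 0 < θ ∧ θ < 1 ∧
      ∀ v ∈ stableSpace D, ∀ k : ℕ, ‖(D ^ k) v‖ ≤ C * θ ^ k * ‖v‖ := by
  let S := stableSpace D
  have : CompleteSpace S := FiniteDimensional.complete ℝ _
  let T : ℕ → S →L[ℝ] V := fun k => ((D ^ k : V ≃L[ℝ] V) : V →L[ℝ] V).comp S.subtypeL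
  have hT : ∀ (k : ℕ) (v : S), T k v = (D ^ k) (v : V) := fun k v => rfl
  obtain ⟨K, hK0, hK⟩ := (Module.finBasis ℝ S).exists_opNorm_le (F := V)
  -- pointwise convergence to zero gives convergence in norm
  obtain ⟨m, hm⟩ : ∃ m : ℕ, ‖T (m + 1)‖ ≤ 1 / 2 := by
    have h1 : ∀ᶠ k in atTop, ∀ i, ‖T (k + 1) (Module.finBasis ℝ S i)‖ ≤ 1 / (2 * K) := by
      rw [eventually_all]
      intro i
      have h2 := ((Module.finBasis ℝ S i).2 : Tendsto _ _ _).comp (tendsto_add_atTop_nat 1)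
      have h3 := h2.norm
      rw [norm_zero] at h3
      exact (h3.eventually (gt_mem_nhds (show (0 : ℝ) < 1 / (2 * K) by positivity))).mono
        fun k hk => hk.le
    obtain ⟨k, hk⟩ := h1.exists
    refine ⟨k, (hK (by positivity) hk).trans (le_of_eq ?_)⟩
    field_simp
  set p := m + 1 with hp
  have hhalf : ∀ v ∈ S, ‖(D ^ p) v‖ ≤ 1 / 2 * ‖v‖ := fun v hv =>
    (T p).le_of_opNorm_le hm ⟨v, hv⟩
  have hq : ∀ (q : ℕ), ∀ v ∈ S, ‖(D ^ (p * q)) v‖ ≤ (1 / 2) ^ q * ‖v‖ := by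
    intro q
    induction q with
    | zero => intro v _; rw [mul_zero, pow_zero, pow_zero, one_mul]; exact le_rfl
    | succ q ih =>
      intro v hv
      rw [mul_add, mul_one, pow_apply_add]
      refine (ih _ (pow_mem_stableSpace hv p)).trans ?_
      rw [pow_succ (1 / 2 : ℝ), mul_assoc]
      exact mul_le_mul_of_nonneg_left (hhalf v hv) (by positivity)
  -- the norms of the first powers are bounded
  obtain ⟨B, hB⟩ : ∃ B : ℝ, ∀ r < p, ‖((D ^ r : V ≃L[ℝ] V) : V →L[ℝ] V)‖ ≤ B := by
    refine ⟨∑ r ∈ Finset.range p, ‖((D ^ r : V ≃L[ℝ] V) : V →L[ℝ] V)‖, fun r hr => ?_⟩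
    exact Finset.single_le_sum (f := fun r => ‖((D ^ r : V ≃L[ℝ] V) : V →L[ℝ] V)‖)
      (fun _ _ => norm_nonneg _) (Finset.mem_range.2 hr)
  have hp0 : (0 : ℝ) < p := by positivity
  set θ : ℝ := (1 / 2 : ℝ) ^ (1 / (p : ℝ)) with hθ
  have hθ0 : 0 < θ := by positivity
  have hθ1 : θ < 1 := Real.rpow_lt_one (by norm_num) (by norm_num) (by positivity)
  have hθp : θ ^ p = 1 / 2 := by
    rw [hθ, ← Real.rpow_natCast, ← Real.rpow_mul (by norm_num)]
    rw [one_div_mul_cancel hp0.ne', Real.rpow_one]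
  refine ⟨2 * max B 1, θ, by positivity, hθ0, hθ1, fun v hv k => ?_⟩
  have hk : k = k % p + p * (k / p) := (Nat.mod_add_div k p).symm
  have hr : k % p < p := Nat.mod_lt _ (by omega)
  have hθr : 1 / 2 ≤ θ ^ (k % p) := by
    rw [← hθp]; exact pow_le_pow_of_le_one hθ0.le hθ1.le hr.le
  calc ‖(D ^ k) v‖ = ‖(D ^ (k % p)) ((D ^ (p * (k / p))) v)‖ := by
        rw [← pow_apply_add, ← hk]
    _ ≤ max B 1 * ‖(D ^ (p * (k / p))) v‖ :=
        ((D ^ (k % p) : V ≃L[ℝ] V) : V →L[ℝ] V).le_of_opNorm_le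
          ((hB _ hr).trans (le_max_left _ _)) _
    _ ≤ max B 1 * ((1 / 2) ^ (k / p) * ‖v‖) := by gcongr; exact hq _ v hv
    _ = max B 1 * (θ ^ (p * (k / p)) * ‖v‖) := by rw [pow_mul, hθp]
    _ ≤ max B 1 * ((2 * θ ^ (k % p)) * θ ^ (p * (k / p)) * ‖v‖) := by
        gcongr
        have : 0 ≤ θ ^ (p * (k / p)) := by positivity
        nlinarith
    _ = 2 * max B 1 * θ ^ k * ‖v‖ := by
        conv_rhs => rw [hk, pow_add]
        ring

/-- A vector whose image in the quotient decays exponentially can be corrected by a vector of the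
kernel, on which `D` is the identity, so that it decays itself. -/
theorem exists_stable_lift (D : V ≃L[ℝ] V) (L : F ≃L[ℝ] F) (P : V →L[ℝ] F) [FiniteDimensional ℝ V]
    (hP : Function.Surjective P) (hfix : ∀ v, P v = 0 → D v = v) (hPD : ∀ v, P (D v) = L (P v))
    {a : F} (ha : ExpDecay (fun k : ℕ => (L ^ k) a)) : ∃ v ∈ stableSpace D, P v = a := by
  obtain ⟨σ₀, hσ₀⟩ := (P : V →ₗ[ℝ] F).exists_rightInverse_of_surjective
    (LinearMap.range_eq_top.2 hP)
  let σ : F →L[ℝ] V := LinearMap.toContinuousLinearMap σ₀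
  have hσ : ∀ x, P (σ x) = x := fun x => LinearMap.congr_fun hσ₀ x
  have hPDk : ∀ (k : ℕ) v, P ((D ^ k) v) = (L ^ k) (P v) := by
    intro k
    induction k with
    | zero => intro v; rfl
    | succ k ih =>
      intro v
      rw [pow_succ, pow_succ]
      change P ((D ^ k) (D v)) = (L ^ k) (L (P v))
      rw [ih, hPD]
  -- The defect `d k` lies in the kernel, so its increments are `O(‖L ^ k a‖)` and it converges; the
  -- limit is the correction.
  let d : ℕ → V := fun k => (D ^ k) (σ a) - σ ((L ^ k) a)
  have hdker : ∀ k, P (d k) = 0 := fun k => by simp [d, hPDk, hσ]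
  let Q : F →L[ℝ] V := (D : V →L[ℝ] V).comp σ - σ.comp (L : F →L[ℝ] F)
  have hstep : ∀ k, d (k + 1) = d k + Q ((L ^ k) a) := by
    intro k
    have h1 : (D ^ k) (σ a) = d k + σ ((L ^ k) a) := by simp [d]
    have h2 : (D ^ (k + 1)) (σ a) = D ((D ^ k) (σ a)) := by rw [pow_succ']; rfl
    have h3 : (L ^ (k + 1)) a = L ((L ^ k) a) := by rw [pow_succ']; rfl
    change (D ^ (k + 1)) (σ a) - σ ((L ^ (k + 1)) a) = _
    rw [h2, h1, map_add, hfix _ (hdker k), h3]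
    simp [Q, add_sub_assoc]
  obtain ⟨C, θ, h0, h1, h⟩ := ha
  have hcau : CauchySeq d := by
    refine cauchySeq_of_le_geometric θ (‖Q‖ * C) h1 fun k => ?_
    rw [dist_comm, dist_eq_norm, hstep, add_sub_cancel_left, mul_assoc]
    exact (Q.le_opNorm _).trans (mul_le_mul_of_nonneg_left (h k) (norm_nonneg _))
  have : CompleteSpace V := FiniteDimensional.complete ℝ V
  obtain ⟨e, he⟩ := cauchySeq_tendsto_of_complete hcau
  have hPe : P e = 0 := by
    have h2 := (P.continuous.tendsto e).comp he
    refine tendsto_nhds_unique h2 (tendsto_const_nhds.congr fun k => ?_)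
    exact (hdker k).symm
  have hek : ∀ k : ℕ, (D ^ k) e = e := by
    intro k
    induction k with
    | zero => rfl
    | succ k ih => rw [pow_succ]; change (D ^ k) (D e) = e; rw [hfix e hPe, ih]
  refine ⟨σ a - e, ?_, by rw [map_sub, hσ, hPe, sub_zero]⟩
  rw [mem_stableSpace]
  have h2 : Tendsto (fun k : ℕ => (d k - e) + σ ((L ^ k) a)) atTop (𝓝 (e - e + σ 0)) := by
    refine (he.sub_const e).add ((σ.continuous.tendsto 0).comp ?_)
    exact ExpDecay.tendsto ⟨C, θ, h0, h1, h⟩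
  rw [sub_self, map_zero, add_zero] at h2
  refine h2.congr fun k => ?_
  rw [map_sub, hek]
  simp only [d]
  abel

/-- If the quotient `L` of `D` by a line (or zero) of fixed vectors has no nonzero bounded orbits,
the space is the direct sum of the stable space, this line, and the unstable space. -/
theorem isInternal_stable_fixed_unstable [FiniteDimensional ℝ V] (D : V ≃L[ℝ] V) (L : F ≃L[ℝ] F)
    (P : V →L[ℝ] F) (u : V) (hP : Function.Surjective P) (hker : ∀ v, P v = 0 ↔ v ∈ ℝ ∙ u)
    (hu : D u = u) (hPD : ∀ v, P (D v) = L (P v)) (hL : boundedOrbits L = ⊥) :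
    DirectSum.IsInternal ![stableSpace D, ℝ ∙ u, stableSpace D⁻¹] := by
  have hfix : ∀ v, P v = 0 → D v = v := by
    intro v hv
    obtain ⟨c, rfl⟩ := Submodule.mem_span_singleton.1 ((hker v).1 hv)
    rw [map_smul, hu]
  have hfix' : ∀ v, P v = 0 → D⁻¹ v = v := fun v hv => by
    have h := congrArg (D⁻¹ : V ≃L[ℝ] V) (hfix v hv)
    exact h.symm.trans (D.symm_apply_apply v)
  have hPD' : ∀ v, P (D⁻¹ v) = L⁻¹ (P v) := fun v => by
    have h := hPD (D⁻¹ v)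
    have h1 : D (D⁻¹ v) = v := D.apply_symm_apply v
    rw [h1] at h
    rw [h]
    exact (L.symm_apply_apply _).symm
  have hpowfix : ∀ (T : V ≃L[ℝ] V), (∀ v, P v = 0 → T v = v) → ∀ (k : ℕ) v, P v = 0 →
      (T ^ k) v = v := by
    intro T hT k v hv
    induction k with
    | zero => rfl
    | succ k ih => rw [pow_succ]; change (T ^ k) (T v) = v; rw [hT v hv, ih]
  have hPpow : ∀ (T : V ≃L[ℝ] V) (R : F ≃L[ℝ] F), (∀ v, P (T v) = R (P v)) → ∀ (k : ℕ) v,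
      P ((T ^ k) v) = (R ^ k) (P v) := by
    intro T R h k
    induction k with
    | zero => intro v; rfl
    | succ k ih =>
      intro v
      rw [pow_succ, pow_succ]
      change P ((T ^ k) (T v)) = (R ^ k) (R (P v))
      rw [ih, h]
  have hconv : ∀ {a : ℕ → F} {l : F}, Tendsto a atTop (𝓝 l) → ∃ C, ∀ k, ‖a k‖ ≤ C := by
    intro a l ha
    obtain ⟨C, hC⟩ := ha.norm.bddAbove_range
    exact ⟨C, fun k => hC ⟨k, rfl⟩⟩
  -- a vector whose forward and backward orbits both converge is fixed
  have hboth : ∀ v (l l' : V), Tendsto (fun k : ℕ => (D ^ k) v) atTop (𝓝 l) →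
      Tendsto (fun k : ℕ => (D⁻¹ ^ k) v) atTop (𝓝 l') → P v = 0 := by
    intro v l l' h1 h2
    obtain ⟨C, hC⟩ := hconv ((P.continuous.tendsto l).comp h1)
    obtain ⟨C', hC'⟩ := hconv ((P.continuous.tendsto l').comp h2)
    have : P v ∈ boundedOrbits L := by
      refine ⟨max C C', fun k => ?_⟩
      obtain ⟨k, rfl | rfl⟩ := k.eq_nat_or_neg
      · rw [zpow_natCast, ← hPpow D L hPD]
        exact (hC k).trans (le_max_left _ _)
      · rw [zpow_neg, zpow_natCast, ← inv_pow, ← hPpow D⁻¹ L⁻¹ hPD']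
        exact (hC' k).trans (le_max_right _ _)
    rw [hL] at this
    exact this
  have hPu : ∀ w ∈ ℝ ∙ u, P w = 0 := fun w hw => (hker w).2 hw
  have hzero : ∀ (T : V ≃L[ℝ] V), (∀ v, P v = 0 → T v = v) → ∀ v ∈ stableSpace T, P v = 0 →
      v = 0 := by
    intro T hT v hv hPv
    rw [mem_stableSpace] at hv
    refine tendsto_nhds_unique (tendsto_const_nhds.congr fun k => ?_) hv
    exact (hpowfix T hT k v hPv).symm
  have huniq : ∀ s ∈ stableSpace D, ∀ c ∈ ℝ ∙ u, ∀ w ∈ stableSpace D⁻¹, s + c + w = 0 →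
      s = 0 ∧ c = 0 ∧ w = 0 := by
    intro s hs c hc w hw h
    have hs0 : s = 0 := by
      refine hzero D hfix s hs (hboth s 0 (-c) hs ?_)
      have e : s = -c - w := by rw [eq_sub_iff_add_eq, ← add_eq_zero_iff_eq_neg]; rw [← h]; abel
      have h1 : Tendsto (fun k : ℕ => -c - (D⁻¹ ^ k) w) atTop (𝓝 (-c - 0)) :=
        tendsto_const_nhds.sub hw
      rw [sub_zero] at h1
      refine h1.congr fun k => ?_
      rw [e, map_sub, map_neg, hpowfix _ hfix' k c (hPu c hc)]
    have hw0 : w = 0 := by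
      refine hzero D⁻¹ hfix' w hw (hboth w (-c) 0 ?_ hw)
      have e : w = -c := by rw [hs0, zero_add, add_comm] at h; exact eq_neg_of_add_eq_zero_left h
      refine tendsto_const_nhds.congr fun k => ?_
      rw [e, map_neg, hpowfix _ hfix k c (hPu c hc)]
    refine ⟨hs0, ?_, hw0⟩
    simpa [hs0, hw0] using h
  rw [DirectSum.isInternal_submodule_iff_iSupIndep_and_iSup_eq_top]
  constructor
  · rw [iSupIndep_iff_finsetSum_eq_zero_imp_eq_zero]
    intro t v hv h i hi
    let w : Fin 3 → V := fun i => if i ∈ t then v i else 0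
    have hw : ∀ i, w i ∈ ![stableSpace D, ℝ ∙ u, stableSpace D⁻¹] i := by
      intro i
      simp only [w]
      split_ifs with h
      · exact hv i h
      · exact zero_mem _
    have hsum : w 0 + w 1 + w 2 = 0 := by
      rw [← Fin.sum_univ_three, ← h]
      simp [w, Finset.sum_ite_mem]
    obtain ⟨h0, h1, h2⟩ := huniq (w 0) (hw 0) (w 1) (hw 1) (w 2) (hw 2) hsum
    have hwi : w i = v i := by simp [w, hi]
    rw [← hwi]
    fin_cases i
    · exact h0
    · exact h1
    · exact h2
  · rw [eq_top_iff]
    intro v _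
    obtain ⟨a, b, hab, ha, hb⟩ := exists_expDecay_add L hL (P v)
    obtain ⟨s, hs, hsa⟩ := exists_stable_lift D L P hP hfix hPD ha
    obtain ⟨w, hw, hwb⟩ := exists_stable_lift D⁻¹ L⁻¹ P hP hfix' hPD' hb
    have hc : v - s - w ∈ ℝ ∙ u := by
      rw [← hker, map_sub, map_sub, hsa, hwb, hab]; abel
    have e : v = s + (v - s - w) + w := by abel
    rw [e]
    have hle := fun i => le_iSup ![stableSpace D, ℝ ∙ u, stableSpace D⁻¹] i
    exact add_mem (add_mem (hle 0 hs) (hle 1 hc)) (hle 2 hw)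

end Splitting

/-! ### Local flows of `C¹` vector fields in a vector space -/

section LocalFlow

variable {E : Type*} [NormedAddCommGroup E] [NormedSpace ℝ E]

/-- A variant of the Picard–Lindelöf theorem that records that the solution stays in the ball. -/
theorem exists_mem_closedBall_of_isPicardLindelof [CompleteSpace E] {f : ℝ → E → E}
    {tmin tmax : ℝ} {t₀ : Icc tmin tmax} {x₀ x : E} {a r L K : NNReal}
    (hf : IsPicardLindelof f t₀ x₀ a r L K) (hx : x ∈ Metric.closedBall x₀ r) :
    ∃ α : ℝ → E, α t₀ = x ∧ ∀ t ∈ Icc tmin tmax, α t ∈ Metric.closedBall x₀ a ∧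
      HasDerivWithinAt α (f t (α t)) (Icc tmin tmax) t := by
  obtain ⟨α, hα⟩ := ODE.FunSpace.exists_isFixedPt_next hf hx
  refine ⟨α.compProj, by rw [ODE.FunSpace.compProj_val, ← hα, ODE.FunSpace.next_apply₀],
    fun t ht => ⟨α.compProj_mem_closedBall hf.mul_max_le, ?_⟩⟩
  apply ODE.hasDerivWithinAt_picard_Icc t₀.2 hf.continuousOn_uncurry
    α.continuous_compProj.continuousOn (fun _ ht' => α.compProj_mem_closedBall hf.mul_max_le)
    x ht |>.congr_of_mem _ ht
  intro t' ht'
  nth_rw 1 [← hα]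
  rw [ODE.FunSpace.compProj_of_mem ht', ODE.FunSpace.next_apply]

/-- The linear differential equation `D' = A(t) D` with small coefficients has a solution on the
unit interval. -/
theorem exists_linear_solution [CompleteSpace E] {A : ℝ → E →L[ℝ] E}
    (hA : ContinuousOn A (Icc 0 1)) (hA' : ∀ t ∈ Icc (0 : ℝ) 1, ‖A t‖ ≤ 1 / 2) :
    ∃ D : ℝ → E →L[ℝ] E, D 0 = ContinuousLinearMap.id ℝ E ∧
      ∀ t ∈ Icc (0 : ℝ) 1, HasDerivWithinAt D ((A t).comp (D t)) (Icc 0 1) t := by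
  have h : IsPicardLindelof (fun t (D : E →L[ℝ] E) => (A t).comp D)
      (⟨0, by simp⟩ : Icc (0 : ℝ) 1) (ContinuousLinearMap.id ℝ E) 1 0 1 1 := by
    constructor
    · intro t ht
      refine LipschitzOnWith.of_dist_le_mul fun D _ D' _ => ?_
      rw [dist_eq_norm, dist_eq_norm, ← ContinuousLinearMap.comp_sub]
      refine (ContinuousLinearMap.opNorm_comp_le _ _).trans ?_
      have := hA' t ht
      rw [NNReal.coe_one]
      gcongr
      linarith
    · intro D _
      exact hA.clm_comp continuousOn_const
    · intro t ht D hD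
      refine (ContinuousLinearMap.opNorm_comp_le _ _).trans ?_
      have h1 : ‖D‖ ≤ 2 := by
        have h2 : ‖D - ContinuousLinearMap.id ℝ E‖ ≤ 1 := by simpa [dist_eq_norm] using hD
        have h3 := ContinuousLinearMap.norm_id_le (𝕜 := ℝ) (E := E)
        calc ‖D‖ = ‖(D - ContinuousLinearMap.id ℝ E) + ContinuousLinearMap.id ℝ E‖ := by simp
          _ ≤ _ := norm_add_le _ _
          _ ≤ 2 := by linarith
      calc ‖A t‖ * ‖D‖ ≤ 1 / 2 * 2 := by gcongr; exact hA' t ht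
        _ = ((1 : NNReal) : ℝ) := by simp
    · simp
  obtain ⟨D, hD0, hD⟩ := h.exists_eq_forall_mem_Icc_hasDerivWithinAt₀
  exact ⟨D, hD0, hD⟩

/-- Differentiable dependence on the initial condition: if `D` solves the variational equation
along the trajectory of `x₁`, then `D 1` is the strict derivative of the time one map at `x₁`. -/
theorem hasStrictFDerivAt_of_variational {f : E → E} {f' : E → E →L[ℝ] E} {S : Set E}
    (hS : IsCompact S) (hSc : Convex ℝ S) (hf : ∀ z ∈ S, HasFDerivWithinAt f (f' z) S z)
    (hf' : ContinuousOn f' S) {ψ : E → ℝ → E} {V : Set E} {x₁ : E} (hV : V ∈ 𝓝 x₁)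
    (hψ0 : ∀ x ∈ V, ψ x 0 = x) (hψS : ∀ x ∈ V, ∀ t ∈ Icc (0 : ℝ) 1, ψ x t ∈ S)
    (hψ : ∀ x ∈ V, ∀ t ∈ Icc (0 : ℝ) 1, HasDerivWithinAt (ψ x) (f (ψ x t)) (Icc 0 1) t)
    {D : ℝ → E →L[ℝ] E} (hD0 : D 0 = ContinuousLinearMap.id ℝ E)
    (hD : ∀ t ∈ Icc (0 : ℝ) 1, HasDerivWithinAt D ((f' (ψ x₁ t)).comp (D t)) (Icc 0 1) t) :
    HasStrictFDerivAt (fun x => ψ x 1) (D 1) x₁ := by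
  have hx₁ : x₁ ∈ V := mem_of_mem_nhds hV
  obtain ⟨k₀, hk₀⟩ := hS.exists_bound_of_continuousOn hf'
  obtain ⟨k, hk1, hk⟩ : ∃ k : NNReal, 1 ≤ k ∧ ∀ z ∈ S, ‖f' z‖ ≤ k :=
    ⟨(max k₀ 1).toNNReal, by simp, fun z hz => ((hk₀ z hz).trans (le_max_left _ 1)).trans
      (Real.le_coe_toNNReal _)⟩
  have hkr : (1 : ℝ) ≤ k := by exact_mod_cast hk1
  have hlip : LipschitzOnWith k f S :=
    hSc.lipschitzOnWith_of_nnnorm_hasFDerivWithin_le hf fun z hz => by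
      rw [← NNReal.coe_le_coe]; exact hk z hz
  have hIci : ∀ {G : Type _} [NormedAddCommGroup G] [NormedSpace ℝ G] {g : ℝ → G} {g' : G} {t : ℝ},
      t ∈ Ico (0 : ℝ) 1 → HasDerivWithinAt g g' (Icc 0 1) t → HasDerivWithinAt g g' (Ici t) t :=
    fun ht h => h.mono_of_mem_nhdsWithin (Icc_mem_nhdsGE_of_mem ht)
  have hcont : ∀ x ∈ V, ContinuousOn (ψ x) (Icc 0 1) := fun x hx t ht =>
    (hψ x hx t ht).continuousWithinAt
  have hexp : ∀ x ∈ V, ∀ y ∈ V, ∀ t ∈ Icc (0 : ℝ) 1,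
      ‖ψ x t - ψ y t‖ ≤ Real.exp k * ‖x - y‖ := by
    intro x hx y hy t ht
    have h := dist_le_of_trajectories_ODE_of_mem (v := fun _ => f) (s := fun _ => S)
      (fun _ _ => hlip) (hcont x hx)
      (fun t ht => hIci ht (hψ x hx t (Ico_subset_Icc_self ht)))
      (fun t ht => hψS x hx t (Ico_subset_Icc_self ht)) (hcont y hy)
      (fun t ht => hIci ht (hψ y hy t (Ico_subset_Icc_self ht)))
      (fun t ht => hψS y hy t (Ico_subset_Icc_self ht)) le_rfl t ht
    rw [hψ0 x hx, hψ0 y hy, dist_eq_norm, dist_eq_norm] at h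
    rw [mul_comm]
    refine h.trans ?_
    gcongr
    have := ht.2
    nlinarith [ht.1]
  rw [hasStrictFDerivAt_iff_isLittleO, Asymptotics.isLittleO_iff]
  intro c hc
  set η := c / (Real.exp k * Real.exp k) with hη
  have hη0 : 0 < η := by positivity
  obtain ⟨δ, hδ0, hδ⟩ := Metric.uniformContinuousOn_iff_le.1
    (hS.uniformContinuousOn_of_continuous hf') η hη0
  have hball : V ∩ Metric.ball x₁ (δ / Real.exp k) ∈ 𝓝 x₁ :=
    inter_mem hV (Metric.ball_mem_nhds _ (by positivity))
  have : ∀ᶠ q : E × E in 𝓝 (x₁, x₁), q.1 ∈ V ∩ Metric.ball x₁ (δ / Real.exp k) ∧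
      q.2 ∈ V ∩ Metric.ball x₁ (δ / Real.exp k) := by
    rw [nhds_prod_eq]; exact prod_mem_prod hball hball
  filter_upwards [this]
  rintro ⟨x, y⟩ ⟨⟨hx, hxb⟩, ⟨hy, hyb⟩⟩
  dsimp only at hx hxb hy hyb ⊢
  have hnear : ∀ x ∈ V, x ∈ Metric.ball x₁ (δ / Real.exp k) → ∀ t ∈ Icc (0 : ℝ) 1,
      ψ x t ∈ Metric.closedBall (ψ x₁ t) δ := by
    intro x hx hxb t ht
    rw [Metric.mem_closedBall, dist_eq_norm]
    refine (hexp x hx x₁ hx₁ t ht).trans ?_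
    rw [Metric.mem_ball, dist_eq_norm, lt_div_iff₀ (Real.exp_pos _)] at hxb
    rw [mul_comm]; exact hxb.le
  let e : ℝ → E := fun t => ψ x t - ψ y t - D t (x - y)
  have hder : ∀ t ∈ Icc (0 : ℝ) 1, HasDerivWithinAt e
      (f (ψ x t) - f (ψ y t) - f' (ψ x₁ t) (D t (x - y))) (Icc 0 1) t := by
    intro t ht
    refine ((hψ x hx t ht).sub (hψ y hy t ht)).sub ?_
    simpa using (hD t ht).clm_apply (hasDerivWithinAt_const t (Icc 0 1) (x - y))
  have hbound : ∀ t ∈ Ico (0 : ℝ) 1, ‖f (ψ x t) - f (ψ y t) - f' (ψ x₁ t) (D t (x - y))‖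
      ≤ k * ‖e t‖ + η * (Real.exp k * ‖x - y‖) := by
    intro t ht
    have ht' := Ico_subset_Icc_self ht
    have hconv : Convex ℝ (S ∩ Metric.closedBall (ψ x₁ t) δ) :=
      hSc.inter (convex_closedBall _ _)
    have h1 : ‖f (ψ x t) - f (ψ y t) - f' (ψ x₁ t) (ψ x t - ψ y t)‖ ≤ η * ‖ψ x t - ψ y t‖ := by
      refine hconv.norm_image_sub_le_of_norm_hasFDerivWithin_le' (f' := f')
        (fun z hz => (hf z hz.1).mono inter_subset_left) (fun z hz => ?_)
        ⟨hψS y hy t ht', hnear y hy hyb t ht'⟩ ⟨hψS x hx t ht', hnear x hx hxb t ht'⟩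
      rw [← dist_eq_norm]
      exact hδ z hz.1 _ (hψS x₁ hx₁ t ht') hz.2
    have e1 : f (ψ x t) - f (ψ y t) - f' (ψ x₁ t) (D t (x - y))
        = f' (ψ x₁ t) (e t) + (f (ψ x t) - f (ψ y t) - f' (ψ x₁ t) (ψ x t - ψ y t)) := by
      simp only [e, map_sub]; abel
    rw [e1]
    refine (norm_add_le _ _).trans (add_le_add ?_ (h1.trans ?_))
    · exact (f' (ψ x₁ t)).le_of_opNorm_le (hk _ (hψS x₁ hx₁ t ht')) _
    · gcongr; exact hexp x hx y hy t ht'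
  have hgron := norm_le_gronwallBound_of_norm_deriv_right_le (δ := 0)
    (fun t ht => (hder t ht).continuousWithinAt)
    (fun t ht => hIci ht (hder t (Ico_subset_Icc_self ht)))
    (by simp [e, hψ0 x hx, hψ0 y hy, hD0]) hbound 1 (by simp)
  refine hgron.trans ?_
  rw [gronwallBound_of_K_ne_0 (by positivity)]
  simp only [zero_mul, zero_add, sub_zero, mul_one]
  have h3 : η * (Real.exp k * ‖x - y‖) / k * (Real.exp k - 1)
      ≤ η * (Real.exp k * ‖x - y‖) * Real.exp k := by
    have h4 : 0 ≤ η * (Real.exp k * ‖x - y‖) := by positivity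
    refine mul_le_mul (div_le_self h4 hkr) (by linarith) ?_ h4
    have := Real.add_one_le_exp (k : ℝ); linarith
  refine h3.trans (le_of_eq ?_)
  rw [hη]; field_simp

/-- A map which is strictly differentiable on an open set is `C¹` there. -/
theorem contDiffOn_of_hasStrictFDerivAt {G : Type*} [NormedAddCommGroup G] [NormedSpace ℝ G]
    {g : E → G} {g' : E → E →L[ℝ] G} {U : Set E} (hU : IsOpen U)
    (h : ∀ x ∈ U, HasStrictFDerivAt g (g' x) x) : ContDiffOn ℝ 1 g U := by
  rw [show (1 : WithTop ℕ∞) = 0 + 1 from rfl, contDiffOn_succ_iff_hasFDerivWithinAt (by simp)]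
  intro x hx
  rw [insert_eq_of_mem hx]
  refine ⟨U, self_mem_nhdsWithin, by simp, g', fun y hy => (h y hy).hasFDerivAt.hasFDerivWithinAt,
    ?_⟩
  rw [contDiffOn_zero]
  intro x hx
  refine ContinuousAt.continuousWithinAt ?_
  rw [Metric.continuousAt_iff']
  intro c hc
  have h1 := (h x hx).isLittleO.def (half_pos hc)
  rw [Metric.eventually_nhds_iff] at h1
  obtain ⟨δ, hδ, h1⟩ := h1
  filter_upwards [hU.mem_nhds hx, Metric.ball_mem_nhds x hδ] with y hyU hy
  rw [dist_eq_norm]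
  have h2 : HasFDerivAt (fun z => g z - g' x z) (g' y - g' x) y :=
    (h y hyU).hasFDerivAt.sub (g' x).hasFDerivAt
  refine (h2.le_of_lip' (half_pos hc).le ?_).trans_lt (half_lt_self hc)
  filter_upwards [Metric.isOpen_ball.mem_nhds hy] with z hz
  have h3 := h1 (y := (z, y)) (by simpa [Prod.dist_eq] using ⟨hz, hy⟩)
  dsimp only at h3
  rw [map_sub] at h3
  rwa [sub_sub_sub_comm]

/-- Local existence, and `C¹` dependence on time and initial condition, of the flow of a `C¹`
vector field. -/
theorem exists_contDiffOn_localFlow [FiniteDimensional ℝ E] {f : E → E} {Ω : Set E} (hΩ : IsOpen Ω)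
    (hf : ContDiffOn ℝ 1 f Ω) {z₀ : E} (hz₀ : z₀ ∈ Ω) :
    ∃ ε > 0, ∃ ρ > 0, ∃ φ : ℝ → E → E,
      (∀ z ∈ Metric.ball z₀ ρ, φ 0 z = z ∧ ∀ t ∈ Ioo (-ε) ε,
        φ t z ∈ Ω ∧ HasDerivAt (fun s => φ s z) (f (φ t z)) t) ∧
      ContDiffOn ℝ 1 (fun q : ℝ × E => φ q.1 q.2) (Ioo (-ε) ε ×ˢ Metric.ball z₀ ρ) ∧
      (f z₀ = 0 → ∀ t ∈ Ioo (-ε) ε,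
        HasFDerivAt (φ t) (NormedSpace.exp (t • fderiv ℝ f z₀)) z₀) := by
  have : CompleteSpace E := FiniteDimensional.complete ℝ E
  have : ProperSpace E := FiniteDimensional.proper ℝ E
  obtain ⟨R, hR0, hRΩ⟩ := Metric.nhds_basis_closedBall.mem_iff.1 (hΩ.mem_nhds hz₀)
  have hder : ∀ z ∈ Ω, HasFDerivAt f (fderiv ℝ f z) z := fun z hz =>
    ((hf.differentiableOn one_ne_zero).differentiableAt (hΩ.mem_nhds hz)).hasFDerivAt
  have hcd : ContinuousOn (fderiv ℝ f) Ω := hf.continuousOn_fderiv_of_isOpen hΩ le_rfl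
  set K := Metric.closedBall z₀ R with hK
  have hKc : IsCompact K := isCompact_closedBall _ _
  obtain ⟨B₀, hB₀⟩ := hKc.exists_bound_of_continuousOn (hf.continuousOn.mono hRΩ)
  obtain ⟨k₀, hk₀⟩ := hKc.exists_bound_of_continuousOn (hcd.mono hRΩ)
  set B := max B₀ 1
  set k := max k₀ 1
  have hB1 : 1 ≤ B := le_max_right _ _
  have hk1 : 1 ≤ k := le_max_right _ _
  have hB : ∀ z ∈ K, ‖f z‖ ≤ B := fun z hz => (hB₀ z hz).trans (le_max_left _ _)
  have hk : ∀ z ∈ K, ‖fderiv ℝ f z‖ ≤ k := fun z hz => (hk₀ z hz).trans (le_max_left _ _)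
  set ε := min (R / (2 * B)) (1 / (2 * (B + k))) with hε
  have hε0 : 0 < ε := by positivity
  have hεB : B * ε ≤ R / 2 := by
    calc B * ε ≤ B * (R / (2 * B)) := by gcongr; exact min_le_left _ _
      _ = R / 2 := by field_simp
  have hεk : ε * (B + k) ≤ 1 / 2 := by
    calc ε * (B + k) ≤ 1 / (2 * (B + k)) * (B + k) := by gcongr; exact min_le_right _ _
      _ = 1 / 2 := by field_simp
  have hlip : LipschitzOnWith k.toNNReal f K :=
    (convex_closedBall z₀ R).lipschitzOnWith_of_nnnorm_hasFDerivWithin_le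
      (fun z hz => (hder z (hRΩ hz)).hasFDerivWithinAt) fun z hz => by
        rw [← NNReal.coe_le_coe]; exact (hk z hz).trans (Real.le_coe_toNNReal _)
  have hPL : IsPicardLindelof (fun _ => f) (tmin := -ε) (tmax := ε)
      ⟨0, by constructor <;> linarith⟩ z₀ R.toNNReal (R / 2).toNNReal B.toNNReal k.toNNReal := by
    refine IsPicardLindelof.of_time_independent ?_ ?_ ?_
    · intro x hx
      rw [Real.coe_toNNReal _ hR0.le] at hx
      exact (hB x hx).trans (Real.le_coe_toNNReal _)
    · rw [Real.coe_toNNReal _ hR0.le]; exact hlip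
    · rw [Real.coe_toNNReal _ hR0.le, Real.coe_toNNReal _ (by positivity),
        Real.coe_toNNReal _ (by positivity)]
      simp only [sub_zero, zero_sub, neg_neg, max_self]
      linarith
  have hsol : ∀ z : E, ∃ α : ℝ → E, z ∈ Metric.ball z₀ (R / 2) → α 0 = z ∧ ∀ t ∈ Icc (-ε) ε,
      α t ∈ K ∧ HasDerivWithinAt α (f (α t)) (Icc (-ε) ε) t := by
    intro z
    by_cases hz : z ∈ Metric.ball z₀ (R / 2)
    · obtain ⟨α, h0, h1⟩ := exists_mem_closedBall_of_isPicardLindelof hPL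
        (x := z) (by
          rw [Real.coe_toNNReal _ (by positivity)]; exact Metric.ball_subset_closedBall hz)
      rw [Real.coe_toNNReal _ hR0.le] at h1
      exact ⟨α, fun _ => ⟨h0, h1⟩⟩
    · exact ⟨fun _ => 0, fun h => absurd h hz⟩
  choose α hα using hsol
  -- Dependence on time is reduced to dependence on the initial value: the equation for `(τ, z)` with
  -- field `(0, ε τ f z)` carries `(τ, z)` in unit time to `(τ, α z (ε τ))`.
  let g : ℝ × E → ℝ × E := fun q => (0, (ε * q.1) • f q.2)
  let g' : ℝ × E → (ℝ × E) →L[ℝ] (ℝ × E) := fun q =>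
    (0 : (ℝ × E) →L[ℝ] ℝ).prod ((ε * q.1) • (fderiv ℝ f q.2).comp (ContinuousLinearMap.snd ℝ ℝ E) +
      (ε • ContinuousLinearMap.fst ℝ ℝ E).smulRight (f q.2))
  let S : Set (ℝ × E) := Icc (-1) 1 ×ˢ K
  have hSc : IsCompact S := isCompact_Icc.prod hKc
  have hSconv : Convex ℝ S := (convex_Icc _ _).prod (convex_closedBall _ _)
  have hg : ∀ q ∈ S, HasFDerivWithinAt g (g' q) S q := by
    rintro ⟨τ, z⟩ ⟨_, hz⟩
    refine HasFDerivAt.hasFDerivWithinAt ?_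
    refine (hasFDerivAt_const (0 : ℝ) (τ, z)).prodMk ?_
    have h1 : HasFDerivAt (fun q : ℝ × E => ε * q.1) (ε • ContinuousLinearMap.fst ℝ ℝ E) (τ, z) :=
      (hasFDerivAt_fst (p := (τ, z))).const_mul ε
    have h2 : HasFDerivAt (fun q : ℝ × E => f q.2)
        ((fderiv ℝ f z).comp (ContinuousLinearMap.snd ℝ ℝ E)) (τ, z) :=
      (hder z (hRΩ hz)).comp (τ, z) (hasFDerivAt_snd (p := (τ, z)))
    exact h1.smul h2
  have hg' : ContinuousOn g' S := by
    have hsnd : ContinuousOn (fun q : ℝ × E => fderiv ℝ f q.2) S :=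
      (hcd.mono hRΩ).comp continuousOn_snd fun q hq => hq.2
    have hfs : ContinuousOn (fun q : ℝ × E => f q.2) S :=
      (hf.continuousOn.mono hRΩ).comp continuousOn_snd fun q hq => hq.2
    have h1 : ContinuousOn (fun q : ℝ × E => (ε * q.1) •
        (fderiv ℝ f q.2).comp (ContinuousLinearMap.snd ℝ ℝ E) +
        (ε • ContinuousLinearMap.fst ℝ ℝ E).smulRight (f q.2)) S := by
      refine ContinuousOn.add ?_ ?_
      · exact (continuousOn_const.mul continuousOn_fst).smul (hsnd.clm_comp continuousOn_const)
      · exact ((ContinuousLinearMap.smulRightL ℝ (ℝ × E) E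
          (ε • ContinuousLinearMap.fst ℝ ℝ E)).continuous.comp_continuousOn hfs)
    have h2 : ContinuousOn (fun q : ℝ × E => (ContinuousLinearMap.prodₗᵢ ℝ :
        (((ℝ × E) →L[ℝ] ℝ) × ((ℝ × E) →L[ℝ] E)) ≃ₗᵢ[ℝ] _) ((0 : (ℝ × E) →L[ℝ] ℝ),
        ((ε * q.1) • (fderiv ℝ f q.2).comp (ContinuousLinearMap.snd ℝ ℝ E) +
        (ε • ContinuousLinearMap.fst ℝ ℝ E).smulRight (f q.2)))) S :=
      (LinearIsometryEquiv.continuous _).comp_continuousOn (continuousOn_const.prodMk h1)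
    exact h2
  have hg'norm : ∀ q ∈ S, ‖g' q‖ ≤ 1 / 2 := by
    rintro ⟨τ, z⟩ ⟨hτ, hz⟩
    refine ContinuousLinearMap.opNorm_le_bound _ (by norm_num) fun v => ?_
    have h1 : g' (τ, z) v = (0, (ε * τ) • fderiv ℝ f z v.2 + (ε * v.1) • f z) := by
      simp [g']
    rw [h1, Prod.norm_mk, norm_zero, max_eq_right (norm_nonneg _)]
    have hτ' : |τ| ≤ 1 := abs_le.2 hτ
    have hv1 : ‖v.1‖ ≤ ‖v‖ := norm_fst_le v
    have hv2 : ‖v.2‖ ≤ ‖v‖ := norm_snd_le v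
    calc ‖(ε * τ) • fderiv ℝ f z v.2 + (ε * v.1) • f z‖
        ≤ ‖(ε * τ) • fderiv ℝ f z v.2‖ + ‖(ε * v.1) • f z‖ := norm_add_le _ _
      _ = ε * |τ| * ‖fderiv ℝ f z v.2‖ + ε * ‖v.1‖ * ‖f z‖ := by
          rw [norm_smul, norm_smul, norm_mul, norm_mul, Real.norm_of_nonneg hε0.le,
            Real.norm_eq_abs τ]
      _ ≤ ε * 1 * (k * ‖v‖) + ε * ‖v‖ * B := by
          gcongr
          · exact ((fderiv ℝ f z).le_of_opNorm_le (hk z hz) _).trans (by gcongr)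
          · exact hB z hz
      _ = ε * (B + k) * ‖v‖ := by ring
      _ ≤ 1 / 2 * ‖v‖ := by gcongr
  let ψ : ℝ × E → ℝ → ℝ × E := fun q s => (q.1, α q.2 (ε * q.1 * s))
  let V : Set (ℝ × E) := Ioo (-1) 1 ×ˢ Metric.ball z₀ (R / 2)
  have hVo : IsOpen V := isOpen_Ioo.prod Metric.isOpen_ball
  have htime : ∀ τ ∈ Ioo (-1 : ℝ) 1, ∀ s ∈ Icc (0 : ℝ) 1, ε * τ * s ∈ Icc (-ε) ε := by
    intro τ hτ s hs
    have h1 : |τ * s| ≤ 1 := by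
      rw [abs_mul]
      exact mul_le_one₀ (abs_le.2 ⟨hτ.1.le, hτ.2.le⟩) (abs_nonneg _)
        (abs_le.2 ⟨by linarith [hs.1], hs.2⟩)
    have h2 := abs_le.1 h1
    constructor <;> nlinarith
  have hψ : ∀ q ∈ V, ∀ s ∈ Icc (0 : ℝ) 1, HasDerivWithinAt (ψ q) (g (ψ q s)) (Icc 0 1) s := by
    rintro ⟨τ, z⟩ ⟨hτ, hz⟩ s hs
    refine (hasDerivWithinAt_const s (Icc 0 1) τ).prodMk ?_
    have h1 : HasDerivWithinAt (fun s : ℝ => ε * τ * s) (ε * τ) (Icc 0 1) s := by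
      simpa using (hasDerivWithinAt_id s (Icc 0 1)).const_mul (ε * τ)
    exact HasDerivWithinAt.scomp s (((hα z hz).2 _ (htime τ hτ s hs)).2) h1
      (fun s hs => htime τ hτ s hs)
  have hstrict : ∀ q ∈ V, ∃ D : (ℝ × E) →L[ℝ] (ℝ × E),
      HasStrictFDerivAt (fun q => ψ q 1) D q := by
    intro q hq
    have hqS : ∀ q ∈ V, ∀ t ∈ Icc (0 : ℝ) 1, ψ q t ∈ S := fun q hq t ht =>
      ⟨Ioo_subset_Icc_self hq.1, ((hα q.2 hq.2).2 _ (htime q.1 hq.1 t ht)).1⟩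
    have hψc : ContinuousOn (ψ q) (Icc 0 1) := fun t ht => (hψ q hq t ht).continuousWithinAt
    obtain ⟨D, hD0, hD⟩ := exists_linear_solution (A := fun t => g' (ψ q t))
      (hg'.comp hψc (hqS q hq)) (fun t ht => hg'norm _ (hqS q hq t ht))
    refine ⟨D 1, hasStrictFDerivAt_of_variational hSc hSconv hg hg' (hVo.mem_nhds hq) ?_ hqS hψ
      hD0 hD⟩
    rintro ⟨τ, z⟩ ⟨_, hz⟩
    simp only [ψ, mul_zero]
    rw [(hα z hz).1]
  choose! D hD using hstrict
  have hψsmooth : ContDiffOn ℝ 1 (fun q => ψ q 1) V := contDiffOn_of_hasStrictFDerivAt hVo hD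
  refine ⟨ε, hε0, R / 2, by positivity, fun t z => α z t, ?_, ?_, ?_⟩
  · intro z hz
    refine ⟨(hα z hz).1, fun t ht => ⟨hRΩ ((hα z hz).2 t (Ioo_subset_Icc_self ht)).1, ?_⟩⟩
    exact ((hα z hz).2 t (Ioo_subset_Icc_self ht)).2.hasDerivAt (Icc_mem_nhds ht.1 ht.2)
  · have h1 : ContDiff ℝ 1 (fun q : ℝ × E => (q.1 / ε, q.2)) :=
      (contDiff_fst.div_const ε).prodMk contDiff_snd
    have h2 := (contDiff_snd.comp_contDiffOn hψsmooth).comp (h1.contDiffOn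
      (s := Ioo (-ε) ε ×ˢ Metric.ball z₀ (R / 2))) (by
        rintro ⟨t, z⟩ ⟨ht, hz⟩
        refine ⟨⟨?_, ?_⟩, hz⟩
        · rw [lt_div_iff₀ hε0]; simpa using ht.1
        · rw [div_lt_iff₀ hε0]; simpa using ht.2)
    refine h2.congr ?_
    rintro ⟨t, z⟩ _
    simp only [ψ, Function.comp, mul_one]
    rw [mul_div_cancel₀ _ hε0.ne']
  · intro hf0 t ht
    set A := fderiv ℝ f z₀ with hA
    have hz₀b : z₀ ∈ Metric.ball z₀ (R / 2) := Metric.mem_ball_self (by positivity)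
    have hKΩ : ∀ z ∈ K, HasFDerivWithinAt (fun z => t • f z) (t • fderiv ℝ f z) K z := fun z hz =>
      ((hder z (hRΩ hz)).const_smul t).hasFDerivWithinAt
    have hts : ∀ s ∈ Icc (0 : ℝ) 1, t * s ∈ Icc (-ε) ε := by
      intro s hs
      have h1 : |t * s| ≤ ε := by
        rw [abs_mul, abs_of_nonneg hs.1]
        nlinarith [abs_nonneg t, hs.2, abs_lt.2 ht]
      exact abs_le.1 h1
    have hψt : ∀ z ∈ Metric.ball z₀ (R / 2), ∀ s ∈ Icc (0 : ℝ) 1,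
        HasDerivWithinAt (fun s => α z (t * s)) (t • f (α z (t * s))) (Icc 0 1) s := by
      intro z hz s hs
      have h1 : HasDerivWithinAt (fun s : ℝ => t * s) t (Icc 0 1) s := by
        simpa using (hasDerivWithinAt_id s (Icc 0 1)).const_mul t
      exact HasDerivWithinAt.scomp s (((hα z hz).2 _ (hts s hs)).2) h1 (fun s hs => hts s hs)
    have hIci : ∀ {g : ℝ → E} {g' : E} {t : ℝ},
        t ∈ Ico (0 : ℝ) 1 → HasDerivWithinAt g g' (Icc 0 1) t → HasDerivWithinAt g g' (Ici t) t :=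
      fun ht h => h.mono_of_mem_nhdsWithin (Icc_mem_nhdsGE_of_mem ht)
    -- At a zero of `f` the trajectory is constant, so that the variational equation has constant
    -- coefficients.
    have hconst : ∀ s ∈ Icc (0 : ℝ) 1, α z₀ (t * s) = z₀ := by
      intro s hs
      have hlip' : LipschitzOnWith (‖t‖₊ * k.toNNReal) (fun z => t • f z) K :=
        LipschitzOnWith.of_dist_le_mul fun x hx y hy => by
          rw [dist_smul₀, NNReal.coe_mul, coe_nnnorm, mul_assoc]
          exact mul_le_mul_of_nonneg_left (hlip.dist_le_mul x hx y hy) (norm_nonneg _)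
      have h := dist_le_of_trajectories_ODE_of_mem (v := fun _ z => t • f z) (s := fun _ => K)
        (f := fun s => α z₀ (t * s)) (g := fun _ => z₀) (δ := 0) (fun _ _ => hlip')
        (fun s hs => (hψt z₀ hz₀b s hs).continuousWithinAt)
        (fun s hs => hIci hs (hψt z₀ hz₀b s (Ico_subset_Icc_self hs)))
        (fun s hs => ((hα z₀ hz₀b).2 _ (hts s (Ico_subset_Icc_self hs))).1)
        continuousOn_const
        (fun s _ => by simpa [hf0] using hasDerivWithinAt_const s (Ici s) z₀)
        (fun _ _ => Metric.mem_closedBall_self hR0.le)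
        (by simp [(hα z₀ hz₀b).1]) s hs
      rw [zero_mul] at h
      exact dist_le_zero.1 h
    have h := hasStrictFDerivAt_of_variational (f := fun z => t • f z)
      (f' := fun z => t • fderiv ℝ f z) (S := K) hKc (convex_closedBall _ _) hKΩ
      ((hcd.mono hRΩ).const_smul t) (ψ := fun z s => α z (t * s))
      (Metric.isOpen_ball.mem_nhds hz₀b) (fun z hz => by
        simp only [mul_zero]; exact (hα z hz).1)
      (fun z hz s hs => ((hα z hz).2 _ (hts s hs)).1) hψt
      (D := fun s => NormedSpace.exp (s • (t • A))) (by simp; rfl) (fun s hs => by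
        rw [hconst s hs]
        exact (hasDerivAt_exp_smul_const' (𝕂 := ℝ) (t • A) s).hasDerivWithinAt)
    simpa using h.hasFDerivAt

end LocalFlow

/-! ### Vector fields on a manifold in charts -/

section ChartExpression

variable {n : ℕ} {M : Type*} [TopologicalSpace M] [ChartedSpace (EuclideanSpace ℝ (Fin n)) M]
  [IsManifold (𝓡 n) ∞ M]

theorem chart_symm_mem_source {c : M} {z : EuclideanSpace ℝ (Fin n)}
    (hz : z ∈ (extChartAt (𝓡 n) c).target) :
    (extChartAt (𝓡 n) c).symm z ∈ (chartAt (EuclideanSpace ℝ (Fin n)) c).source := by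
  rw [← extChartAt_source (I := 𝓡 n)]
  exact (extChartAt (𝓡 n) c).map_target hz

theorem localRep_eq_trivialization (X : C1VectorField n M) {c : M} {z : EuclideanSpace ℝ (Fin n)}
    (hz : z ∈ (extChartAt (𝓡 n) c).target) :
    localRep X c z = (trivializationAt (EuclideanSpace ℝ (Fin n)) (TangentSpace (𝓡 n) : M → Type _) c
      ⟨(extChartAt (𝓡 n) c).symm z, X ((extChartAt (𝓡 n) c).symm z)⟩).2 := by
  have h := chart_symm_mem_source hz
  refine (DFunLike.congr_fun
    (TangentBundle.continuousLinearMapAt_trivializationAt h).symm _).trans ?_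
  exact congrFun (Trivialization.coe_linearMapAt_of_mem _ h) _

theorem contDiffOn_localRep (X : C1VectorField n M) (c : M) :
    ContDiffOn ℝ 1 (localRep X c) (extChartAt (𝓡 n) c).target := by
  have h1 : ContMDiffOn (𝓡 n) 𝓘(ℝ, EuclideanSpace ℝ (Fin n)) 1
      (fun x => (trivializationAt (EuclideanSpace ℝ (Fin n))
        (TangentSpace (𝓡 n) : M → Type _) c ⟨x, X x⟩).2)
      (chartAt (EuclideanSpace ℝ (Fin n)) c).source :=
    (Trivialization.contMDiffOn_section_iff _ (chartAt _ c).open_source subset_rfl).1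
      X.contMDiff.contMDiffOn
  have h2 : ContMDiffOn 𝓘(ℝ, EuclideanSpace ℝ (Fin n)) (𝓡 n) 1 (extChartAt (𝓡 n) c).symm
      (extChartAt (𝓡 n) c).target := contMDiffOn_extChartAt_symm c
  have h3 := h1.comp h2 fun z hz => chart_symm_mem_source hz
  rw [contMDiffOn_iff_contDiffOn] at h3
  exact h3.congr fun z hz => localRep_eq_trivialization X hz

theorem hasFDerivAt_localRep (X : C1VectorField n M) {c : M} {z : EuclideanSpace ℝ (Fin n)}
    (hz : z ∈ (extChartAt (𝓡 n) c).target) :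
    HasFDerivAt (localRep X c) (fderiv ℝ (localRep X c) z) z :=
  (((contDiffOn_localRep X c).differentiableOn one_ne_zero).differentiableAt
    ((isOpen_extChartAt_target c).mem_nhds hz)).hasFDerivAt

theorem hasMFDerivAt_chart_symm {c : M} {z : EuclideanSpace ℝ (Fin n)}
    (hz : z ∈ (extChartAt (𝓡 n) c).target) :
    HasMFDerivAt 𝓘(ℝ, EuclideanSpace ℝ (Fin n)) (𝓡 n) (extChartAt (𝓡 n) c).symm z
      (mfderivWithin 𝓘(ℝ, EuclideanSpace ℝ (Fin n)) (𝓡 n) (extChartAt (𝓡 n) c).symm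
        (range (𝓡 n)) z) := by
  have h := (mdifferentiableWithinAt_extChartAt_symm hz).hasMFDerivWithinAt
  exact h.hasMFDerivAt (by simp)

theorem chart_symm_deriv_localRep (X : C1VectorField n M) {c : M} {z : EuclideanSpace ℝ (Fin n)}
    (hz : z ∈ (extChartAt (𝓡 n) c).target) :
    mfderivWithin 𝓘(ℝ, EuclideanSpace ℝ (Fin n)) (𝓡 n) (extChartAt (𝓡 n) c).symm
      (range (𝓡 n)) z (localRep X c z) = X ((extChartAt (𝓡 n) c).symm z) :=
  DFunLike.congr_fun (mfderivWithin_extChartAt_symm_comp_mfderiv_extChartAt hz) _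

/-- A solution of the differential equation in a chart is an integral curve on the manifold. -/
theorem isMIntegralCurveOn_of_chart (X : C1VectorField n M) {c : M}
    {ζ : ℝ → EuclideanSpace ℝ (Fin n)} {J : Set ℝ}
    (h : ∀ t ∈ J, ζ t ∈ (extChartAt (𝓡 n) c).target ∧ HasDerivAt ζ (localRep X c (ζ t)) t) :
    IsMIntegralCurveOn (I := 𝓡 n) (fun t => (extChartAt (𝓡 n) c).symm (ζ t)) (fun p => X p) J := by
  intro t ht
  obtain ⟨h1, h2⟩ := h t ht
  have h3 := (hasMFDerivAt_chart_symm h1).comp t (h2.hasFDerivAt.hasMFDerivAt)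
  refine HasMFDerivAt.hasMFDerivWithinAt ?_
  refine h3.congr_mfderiv ?_
  ext
  change mfderivWithin 𝓘(ℝ, EuclideanSpace ℝ (Fin n)) (𝓡 n) (extChartAt (𝓡 n) c).symm
      (range (𝓡 n)) (ζ t) ((1 : ℝ) • localRep X c (ζ t)) = (1 : ℝ) • _
  rw [one_smul, one_smul]
  exact chart_symm_deriv_localRep X h1

/-- The set of points of `M` whose coordinates in the chart at `c` belong to `K`. -/
def chartSet (c : M) (K : Set (EuclideanSpace ℝ (Fin n))) : Set M :=
  (extChartAt (𝓡 n) c).symm '' K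

theorem isCompact_chartSet {c : M} {K : Set (EuclideanSpace ℝ (Fin n))} (hK : IsCompact K)
    (h : K ⊆ (extChartAt (𝓡 n) c).target) : IsCompact (chartSet c K) :=
  hK.image_of_continuousOn ((continuousOn_extChartAt_symm c).mono h)

theorem chartSet_subset_source {c : M} {K : Set (EuclideanSpace ℝ (Fin n))}
    (h : K ⊆ (extChartAt (𝓡 n) c).target) :
    chartSet c K ⊆ (chartAt (EuclideanSpace ℝ (Fin n)) c).source := by
  rintro _ ⟨z, hz, rfl⟩
  exact chart_symm_mem_source (h hz)

open Classical in
/-- The vector field on `M` with the given expression `W` in the chart at `c`, extended by `0`. -/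
noncomputable def pushVector (c : M) (W : EuclideanSpace ℝ (Fin n) → EuclideanSpace ℝ (Fin n))
    (x : M) : TangentSpace (𝓡 n) x :=
  if x ∈ (chartAt (EuclideanSpace ℝ (Fin n)) c).source then
    (trivializationAt (EuclideanSpace ℝ (Fin n)) (TangentSpace (𝓡 n) : M → Type _) c).symmL ℝ x
      (W (extChartAt (𝓡 n) c x))
  else 0

theorem pushVector_of_not_mem {c : M} {W : EuclideanSpace ℝ (Fin n) → EuclideanSpace ℝ (Fin n)}
    {x : M} (hx : x ∉ chartSet c (tsupport W)) : pushVector c W x = 0 := by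
  rw [pushVector]
  split_ifs with h
  · have : W (extChartAt (𝓡 n) c x) = 0 := by
      by_contra h0
      refine hx ⟨extChartAt (𝓡 n) c x, subset_tsupport W h0, ?_⟩
      exact (extChartAt (𝓡 n) c).left_inv (by rwa [extChartAt_source])
    rw [this, map_zero]
  · rfl

theorem contMDiff_pushVector [T2Space M] {c : M}
    {W : EuclideanSpace ℝ (Fin n) → EuclideanSpace ℝ (Fin n)} (hW : ContDiff ℝ 1 W)
    (hc : HasCompactSupport W) (h : tsupport W ⊆ (extChartAt (𝓡 n) c).target) :
    ContMDiff (𝓡 n) ((𝓡 n).prod 𝓘(ℝ, EuclideanSpace ℝ (Fin n))) 1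
      (fun x => (⟨x, pushVector c W x⟩ :
        TotalSpace (EuclideanSpace ℝ (Fin n)) (TangentSpace (𝓡 n) : M → Type _))) := by
  intro x
  by_cases hx : x ∈ (chartAt (EuclideanSpace ℝ (Fin n)) c).source
  · rw [Trivialization.contMDiffAt_section_iff (trivializationAt (EuclideanSpace ℝ (Fin n))
      (TangentSpace (𝓡 n) : M → Type _) c) (by exact hx)]
    have h1 : ContMDiffAt (𝓡 n) 𝓘(ℝ, EuclideanSpace ℝ (Fin n)) 1
        (fun x => W (extChartAt (𝓡 n) c x)) x :=
      hW.contMDiff.contMDiffAt.comp x (contMDiffAt_extChartAt' hx)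
    refine h1.congr_of_eventuallyEq ?_
    filter_upwards [(chartAt _ c).open_source.mem_nhds hx] with y hy
    rw [pushVector, if_pos hy, Trivialization.symmL_apply _ hy]
    exact congrArg Prod.snd (Trivialization.apply_mk_symm _ hy _)
  · have h0 : IsClosed (chartSet c (tsupport W)) := (isCompact_chartSet hc h).isClosed
    have hx' : x ∉ chartSet c (tsupport W) := fun hx' => hx (chartSet_subset_source h hx')
    have h1 : ContMDiffAt (𝓡 n) ((𝓡 n).prod 𝓘(ℝ, EuclideanSpace ℝ (Fin n))) 1
        (fun x => (⟨x, 0⟩ :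
          TotalSpace (EuclideanSpace ℝ (Fin n)) (TangentSpace (𝓡 n) : M → Type _))) x :=
      (contMDiff_zeroSection ℝ (TangentSpace (𝓡 n) : M → Type _)).contMDiffAt
    refine h1.congr_of_eventuallyEq ?_
    filter_upwards [h0.isOpen_compl.mem_nhds hx'] with y hy
    rw [pushVector_of_not_mem hy]

/-- The `C¹` vector field with expression `W` in the chart at `c`, where `W` is `C¹` with compact
support in the target of the chart. -/
noncomputable def pushField [T2Space M] (c : M)
    (W : EuclideanSpace ℝ (Fin n) → EuclideanSpace ℝ (Fin n)) (hW : ContDiff ℝ 1 W)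
    (hc : HasCompactSupport W) (h : tsupport W ⊆ (extChartAt (𝓡 n) c).target) :
    C1VectorField n M := ⟨pushVector c W, contMDiff_pushVector hW hc h⟩

theorem localRep_add (X Y : C1VectorField n M) (c : M) (z : EuclideanSpace ℝ (Fin n)) :
    localRep (X + Y) c z = localRep X c z + localRep Y c z := by
  simp only [localRep]
  exact map_add _ _ _

variable [T2Space M] {c : M} {W : EuclideanSpace ℝ (Fin n) → EuclideanSpace ℝ (Fin n)}
  {hW : ContDiff ℝ 1 W} {hc : HasCompactSupport W}
  {h : tsupport W ⊆ (extChartAt (𝓡 n) c).target}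

theorem pushField_of_not_mem {x : M} (hx : x ∉ chartSet c (tsupport W)) :
    pushField c W hW hc h x = 0 := pushVector_of_not_mem hx

/-- The expression of a pushed forward field in another chart, by the change of coordinates. -/
theorem localRep_pushField_of_mem {c' : M} {z : EuclideanSpace ℝ (Fin n)}
    (hz : z ∈ (extChartAt (𝓡 n) c').target)
    (hz' : (extChartAt (𝓡 n) c').symm z ∈ (chartAt (EuclideanSpace ℝ (Fin n)) c).source) :
    localRep (pushField c W hW hc h) c' z =
      fderiv ℝ (fun z => extChartAt (𝓡 n) c' ((extChartAt (𝓡 n) c).symm z))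
        (extChartAt (𝓡 n) c ((extChartAt (𝓡 n) c').symm z))
        (W (extChartAt (𝓡 n) c ((extChartAt (𝓡 n) c').symm z))) := by
  set x := (extChartAt (𝓡 n) c').symm z with hx
  have hxs : x ∈ (extChartAt (𝓡 n) c).source := by rwa [extChartAt_source]
  have hw : extChartAt (𝓡 n) c x ∈ (extChartAt (𝓡 n) c).target :=
    (extChartAt (𝓡 n) c).map_source hxs
  have h1 : localRep (pushField c W hW hc h) c' z = mfderiv (𝓡 n) 𝓘(ℝ, EuclideanSpace ℝ (Fin n))
      (extChartAt (𝓡 n) c') x (mfderivWithin 𝓘(ℝ, EuclideanSpace ℝ (Fin n)) (𝓡 n) (extChartAt (𝓡 n) c).symm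
        (range (𝓡 n)) (extChartAt (𝓡 n) c x) (W (extChartAt (𝓡 n) c x))) := by
    rw [← TangentBundle.symmL_trivializationAt hz']
    change mfderiv (𝓡 n) 𝓘(ℝ, EuclideanSpace ℝ (Fin n)) (extChartAt (𝓡 n) c') x
      (pushVector c W x) = _
    rw [pushVector, if_pos hz']
    rfl
  rw [h1]
  have h2 := hasMFDerivAt_chart_symm hw
  have h3 : HasMFDerivAt (𝓡 n) 𝓘(ℝ, EuclideanSpace ℝ (Fin n)) (extChartAt (𝓡 n) c')
      ((extChartAt (𝓡 n) c).symm (extChartAt (𝓡 n) c x))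
      (mfderiv (𝓡 n) 𝓘(ℝ, EuclideanSpace ℝ (Fin n)) (extChartAt (𝓡 n) c')
        ((extChartAt (𝓡 n) c).symm (extChartAt (𝓡 n) c x))) := by
    refine (mdifferentiableAt_extChartAt ?_).hasMFDerivAt
    rw [(extChartAt (𝓡 n) c).left_inv hxs]
    exact chart_symm_mem_source hz
  let A : EuclideanSpace ℝ (Fin n) →L[ℝ] EuclideanSpace ℝ (Fin n) :=
    mfderiv (𝓡 n) 𝓘(ℝ, EuclideanSpace ℝ (Fin n)) (extChartAt (𝓡 n) c')
      ((extChartAt (𝓡 n) c).symm (extChartAt (𝓡 n) c x))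
  let B : EuclideanSpace ℝ (Fin n) →L[ℝ] EuclideanSpace ℝ (Fin n) :=
    mfderivWithin 𝓘(ℝ, EuclideanSpace ℝ (Fin n)) (𝓡 n) (extChartAt (𝓡 n) c).symm
      (range (𝓡 n)) (extChartAt (𝓡 n) c x)
  have h4 : HasFDerivAt (fun z => extChartAt (𝓡 n) c' ((extChartAt (𝓡 n) c).symm z)) (A.comp B)
      (extChartAt (𝓡 n) c x) := hasMFDerivAt_iff_hasFDerivAt.1 (h3.comp _ h2)
  rw [h4.fderiv]
  change _ = mfderiv (𝓡 n) 𝓘(ℝ, EuclideanSpace ℝ (Fin n)) (extChartAt (𝓡 n) c')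
        ((extChartAt (𝓡 n) c).symm (extChartAt (𝓡 n) c x)) _
  rw [(extChartAt (𝓡 n) c).left_inv hxs]
  rfl

theorem localRep_pushField_self {z : EuclideanSpace ℝ (Fin n)}
    (hz : z ∈ (extChartAt (𝓡 n) c).target) : localRep (pushField c W hW hc h) c z = W z := by
  rw [localRep_pushField_of_mem hz (chart_symm_mem_source hz), (extChartAt (𝓡 n) c).right_inv hz]
  have : (fun z => extChartAt (𝓡 n) c ((extChartAt (𝓡 n) c).symm z)) =ᶠ[𝓝 z] id := by
    filter_upwards [(isOpen_extChartAt_target c).mem_nhds hz] with w hw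
    exact (extChartAt (𝓡 n) c).right_inv hw
  rw [this.fderiv_eq, fderiv_id]
  rfl

end ChartExpression

/-! ### Small perturbations in the `C¹` topology -/

section C1Topology

variable {n : ℕ} {M : Type*} [TopologicalSpace M] [ChartedSpace (EuclideanSpace ℝ (Fin n)) M]
  [IsManifold (𝓡 n) ∞ M]

/-- Convergence in the `C¹` topology is uniform convergence, with first derivatives, on compact subsets
of all charts. -/
theorem tendsto_c1VectorField_iff {ι : Type*} {l : Filter ι} {Φ : ι → C1VectorField n M}
    {X : C1VectorField n M} :
    Tendsto Φ l (𝓝 X) ↔ ∀ (c : M) (K : Set (EuclideanSpace ℝ (Fin n))), IsCompact K →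
      K ⊆ (extChartAt (𝓡 n) c).target →
      TendstoUniformlyOn (fun k z => (localRep (Φ k) c z, fderiv ℝ (localRep (Φ k) c) z))
        (fun z => (localRep X c z, fderiv ℝ (localRep X c) z)) l K := by
  change Tendsto Φ l (@nhds _ (⨅ c : M, _) X) ↔ _
  simp only [nhds_iInf, nhds_induced, tendsto_iInf, tendsto_comap_iff,
    UniformOnFun.tendsto_iff_tendstoUniformlyOn, mem_ofPred_eq, and_imp]
  rfl

/-- Nearby fields are uniformly `C¹` close on compact sets of charts. -/
theorem eventually_localRep_near (X : C1VectorField n M) (c : M)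
    {K : Set (EuclideanSpace ℝ (Fin n))} (hK : IsCompact K)
    (hKt : K ⊆ (extChartAt (𝓡 n) c).target) {ε : ℝ} (hε : 0 < ε) :
    ∀ᶠ Y in 𝓝 X, ∀ z ∈ K, ‖localRep Y c z - localRep X c z‖ < ε ∧
      ‖fderiv ℝ (localRep Y c) z - fderiv ℝ (localRep X c) z‖ < ε := by
  have h := Metric.tendstoUniformlyOn_iff.1
    (tendsto_c1VectorField_iff.1 (tendsto_id : Tendsto id (𝓝 X) (𝓝 X)) c K hK hKt) ε hε
  filter_upwards [h] with Y hY z hz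
  have h1 := hY z hz
  rw [dist_comm, Prod.dist_eq, max_lt_iff, dist_eq_norm, dist_eq_norm] at h1
  exact h1

variable [T2Space M]

/-- The `C¹` size, in any chart, of a vector field pushed forward from the chart at `c` is
controlled by its `C¹` size in the chart at `c`. -/
theorem exists_localRep_pushField_bound (c c' : M) {K₀ K : Set (EuclideanSpace ℝ (Fin n))}
    (hK₀ : IsCompact K₀) (hK₀t : K₀ ⊆ (extChartAt (𝓡 n) c).target) (hK : IsCompact K)
    (hKt : K ⊆ (extChartAt (𝓡 n) c').target) :
    ∃ C : ℝ, 0 < C ∧ ∀ (W : EuclideanSpace ℝ (Fin n) → EuclideanSpace ℝ (Fin n))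
      (hW : ContDiff ℝ 1 W) (hc : HasCompactSupport W)
      (h : tsupport W ⊆ (extChartAt (𝓡 n) c).target) (ε : ℝ), tsupport W ⊆ K₀ →
      (∀ z, ‖W z‖ ≤ ε ∧ ‖fderiv ℝ W z‖ ≤ ε) → ∀ z ∈ K,
        ‖localRep (pushField c W hW hc h) c' z‖ ≤ C * ε ∧
        ‖fderiv ℝ (localRep (pushField c W hW hc h) c') z‖ ≤ C * ε := by
  set S := chartSet c K₀ with hS
  have hSc : IsCompact S := isCompact_chartSet hK₀ hK₀t
  have hSs : S ⊆ (chartAt (EuclideanSpace ℝ (Fin n)) c).source := chartSet_subset_source hK₀t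
  set τ : EuclideanSpace ℝ (Fin n) → EuclideanSpace ℝ (Fin n) :=
    fun z => extChartAt (𝓡 n) c ((extChartAt (𝓡 n) c').symm z) with hτ
  set η : EuclideanSpace ℝ (Fin n) → EuclideanSpace ℝ (Fin n) :=
    fun z => extChartAt (𝓡 n) c' ((extChartAt (𝓡 n) c).symm z) with hη
  -- domains of the two coordinate changes
  set O := (extChartAt (𝓡 n) c').target ∩
    (extChartAt (𝓡 n) c').symm ⁻¹' (chartAt (EuclideanSpace ℝ (Fin n)) c).source with hO
  set O' := (extChartAt (𝓡 n) c).target ∩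
    (extChartAt (𝓡 n) c).symm ⁻¹' (chartAt (EuclideanSpace ℝ (Fin n)) c').source with hO'
  have hOo : IsOpen O := (continuousOn_extChartAt_symm c').isOpen_inter_preimage
    (isOpen_extChartAt_target c') (chartAt _ c).open_source
  have hOo' : IsOpen O' := (continuousOn_extChartAt_symm c).isOpen_inter_preimage
    (isOpen_extChartAt_target c) (chartAt _ c').open_source
  have hle : (2 : WithTop ℕ∞) ≤ ∞ :=
    WithTop.coe_le_coe.2 (le_top : (2 : ℕ∞) ≤ ⊤)
  have hτs : ContDiffOn ℝ 2 τ O := by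
    rw [← contMDiffOn_iff_contDiffOn]
    have h1 : ContMDiffOn (𝓡 n) 𝓘(ℝ, EuclideanSpace ℝ (Fin n)) ∞ (extChartAt (𝓡 n) c) _ :=
      contMDiffOn_extChartAt
    have h2 : ContMDiffOn 𝓘(ℝ, EuclideanSpace ℝ (Fin n)) (𝓡 n) ∞ (extChartAt (𝓡 n) c').symm
      (extChartAt (𝓡 n) c').target := contMDiffOn_extChartAt_symm c'
    exact (h1.comp (h2.mono inter_subset_left) fun z hz => hz.2).of_le
      hle
  have hηs : ContDiffOn ℝ 2 η O' := by
    rw [← contMDiffOn_iff_contDiffOn]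
    have h1 : ContMDiffOn (𝓡 n) 𝓘(ℝ, EuclideanSpace ℝ (Fin n)) ∞ (extChartAt (𝓡 n) c') _ :=
      contMDiffOn_extChartAt
    have h2 : ContMDiffOn 𝓘(ℝ, EuclideanSpace ℝ (Fin n)) (𝓡 n) ∞ (extChartAt (𝓡 n) c).symm
      (extChartAt (𝓡 n) c).target := contMDiffOn_extChartAt_symm c
    exact (h1.comp (h2.mono inter_subset_left) fun z hz => hz.2).of_le
      hle
  have hτm : MapsTo τ O O' := by
    intro z hz
    have hzs : (extChartAt (𝓡 n) c').symm z ∈ (extChartAt (𝓡 n) c).source := by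
      rw [extChartAt_source]; exact hz.2
    refine ⟨(extChartAt (𝓡 n) c).map_source hzs, ?_⟩
    rw [mem_preimage, hτ]
    beta_reduce
    rw [(extChartAt (𝓡 n) c).left_inv hzs]
    exact chart_symm_mem_source hz.1
  set g : EuclideanSpace ℝ (Fin n) → EuclideanSpace ℝ (Fin n) →L[ℝ] EuclideanSpace ℝ (Fin n) :=
    fun z => fderiv ℝ η (τ z) with hg
  have hgs : ContDiffOn ℝ 1 g O :=
    (hηs.fderiv_of_isOpen hOo' (by norm_num)).comp (hτs.of_le (by norm_num)) hτm
  set K₁ := K ∩ (extChartAt (𝓡 n) c').symm ⁻¹' S with hK₁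
  have hK₁c : IsCompact K₁ := by
    have : IsClosed K₁ := ((continuousOn_extChartAt_symm c').mono hKt).preimage_isClosed_of_isClosed
      hK.isClosed hSc.isClosed
    exact hK.of_isClosed_subset this inter_subset_left
  have hK₁O : K₁ ⊆ O := fun z hz => ⟨hKt hz.1, hSs hz.2⟩
  obtain ⟨C1, hC1⟩ := hK₁c.exists_bound_of_continuousOn (hgs.continuousOn.mono hK₁O)
  obtain ⟨C2, hC2⟩ := hK₁c.exists_bound_of_continuousOn
    (((hgs.fderiv_of_isOpen (m := 0) hOo (by norm_num)).continuousOn).mono hK₁O)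
  obtain ⟨C3, hC3⟩ := hK₁c.exists_bound_of_continuousOn
    (((hτs.fderiv_of_isOpen (m := 0) hOo (by norm_num)).continuousOn).mono hK₁O)
  refine ⟨|C1| + |C1| * |C3| + |C2| + 1, by positivity, ?_⟩
  intro W hW hc h ε hWK hε z hz
  have hε0 : 0 ≤ ε := (norm_nonneg _).trans (hε z).1
  by_cases hzS : (extChartAt (𝓡 n) c').symm z ∈ S
  · have hz1 : z ∈ K₁ := ⟨hz, hzS⟩
    have hzO := hK₁O hz1
    have heq : localRep (pushField c W hW hc h) c' =ᶠ[𝓝 z] fun z => g z (W (τ z)) := by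
      filter_upwards [hOo.mem_nhds hzO] with w hw
      exact localRep_pushField_of_mem hw.1 hw.2
    have hd1 : HasFDerivAt g (fderiv ℝ g z) z :=
      ((hgs.differentiableOn one_ne_zero).differentiableAt (hOo.mem_nhds hzO)).hasFDerivAt
    have hd2 : HasFDerivAt τ (fderiv ℝ τ z) z :=
      ((hτs.differentiableOn two_ne_zero).differentiableAt (hOo.mem_nhds hzO)).hasFDerivAt
    have hd3 : HasFDerivAt W (fderiv ℝ W (τ z)) (τ z) :=
      (hW.differentiable one_ne_zero _).hasFDerivAt
    have hd := hd1.clm_apply (hd3.comp z hd2)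
    rw [heq.fderiv_eq, heq.eq_of_nhds,
      (show fderiv ℝ (fun z => g z (W (τ z))) z = _ from hd.fderiv)]
    have b1 : ‖g z‖ ≤ |C1| := (hC1 z hz1).trans (le_abs_self _)
    have b2 : ‖fderiv ℝ g z‖ ≤ |C2| := (hC2 z hz1).trans (le_abs_self _)
    have b3 : ‖fderiv ℝ τ z‖ ≤ |C3| := (hC3 z hz1).trans (le_abs_self _)
    have w1 := (hε (τ z)).1
    have w2 := (hε (τ z)).2
    constructor
    · calc ‖g z (W (τ z))‖ ≤ ‖g z‖ * ‖W (τ z)‖ := (g z).le_opNorm _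
        _ ≤ |C1| * ε := by gcongr
        _ ≤ _ := by
          gcongr
          have : 0 ≤ |C1| * |C3| := by positivity
          have := abs_nonneg C2
          linarith
    · refine (ContinuousLinearMap.opNorm_le_bound _ (by positivity) (M := |C1| * |C3| * ε + |C2| * ε)
        fun v => ?_).trans ?_
      · have e1 : ‖g z (fderiv ℝ W (τ z) (fderiv ℝ τ z v))‖ ≤ |C1| * (ε * (|C3| * ‖v‖)) := by
          refine ((g z).le_opNorm _).trans ?_
          gcongr
          refine ((fderiv ℝ W (τ z)).le_opNorm _).trans ?_
          gcongr
          exact ((fderiv ℝ τ z).le_opNorm _).trans (by gcongr)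
        have e2 : ‖fderiv ℝ g z v (W (τ z))‖ ≤ |C2| * ‖v‖ * ε := by
          refine ((fderiv ℝ g z v).le_opNorm _).trans ?_
          gcongr
          exact ((fderiv ℝ g z).le_opNorm _).trans (by gcongr)
        calc _ = ‖g z (fderiv ℝ W (τ z) (fderiv ℝ τ z v)) + fderiv ℝ g z v (W (τ z))‖ := rfl
          _ ≤ _ := (norm_add_le _ _).trans (add_le_add e1 e2)
          _ = _ := by ring
      · have : 0 ≤ (|C1| + 1) * ε := by positivity
        linarith
  · have hz0 : localRep (pushField c W hW hc h) c' =ᶠ[𝓝 z] fun _ => 0 := by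
      have : ∀ᶠ w in 𝓝 z, (extChartAt (𝓡 n) c').symm w ∈ Sᶜ :=
        ((continuousOn_extChartAt_symm c').continuousAt
          ((isOpen_extChartAt_target c').mem_nhds (hKt hz))).eventually
          (hSc.isClosed.isOpen_compl.mem_nhds hzS)
      filter_upwards [this] with w hw
      rw [localRep, pushField_of_not_mem fun hw' => hw (image_mono hWK hw')]
      exact map_zero _
    rw [hz0.fderiv_eq, hz0.eq_of_nhds]
    simp only [norm_zero, fderiv_fun_const, Pi.zero_apply]
    exact ⟨by positivity, by positivity⟩

/-- Vector fields supported in a fixed compact subset of a chart and tending to `0` in the `C¹`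
norm of that chart are small `C¹` perturbations. -/
theorem tendsto_add_pushField {ι : Type*} {l : Filter ι} (Y : C1VectorField n M) {c : M}
    {W : ι → EuclideanSpace ℝ (Fin n) → EuclideanSpace ℝ (Fin n)} (hW : ∀ k, ContDiff ℝ 1 (W k))
    (hc : ∀ k, HasCompactSupport (W k)) (h : ∀ k, tsupport (W k) ⊆ (extChartAt (𝓡 n) c).target)
    {K₀ : Set (EuclideanSpace ℝ (Fin n))} (hK₀ : IsCompact K₀)
    (hK₀t : K₀ ⊆ (extChartAt (𝓡 n) c).target) (hs : ∀ k, tsupport (W k) ⊆ K₀)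
    (hlim : ∀ ε > 0, ∀ᶠ k in l, ∀ z, ‖W k z‖ ≤ ε ∧ ‖fderiv ℝ (W k) z‖ ≤ ε) :
    Tendsto (fun k => Y + pushField c (W k) (hW k) (hc k) (h k)) l (𝓝 Y) := by
  rw [tendsto_c1VectorField_iff]
  intro c' K hK hKt
  obtain ⟨C, hC, hb⟩ := exists_localRep_pushField_bound c c' hK₀ hK₀t hK hKt
  rw [Metric.tendstoUniformlyOn_iff]
  intro ε hε
  filter_upwards [hlim (ε / (2 * C)) (by positivity)] with k hk z hz
  obtain ⟨h1, h2⟩ := hb (W k) (hW k) (hc k) (h k) _ (hs k) hk z hz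
  have h3 : C * (ε / (2 * C)) = ε / 2 := by field_simp
  rw [h3] at h1 h2
  set V := pushField c (W k) (hW k) (hc k) (h k)
  have h4 : HasFDerivAt (localRep (Y + V) c')
      (fderiv ℝ (localRep Y c') z + fderiv ℝ (localRep V c') z) z := by
    have := (hasFDerivAt_localRep Y (hKt hz)).add (hasFDerivAt_localRep V (hKt hz))
    refine this.congr_of_eventuallyEq (Eventually.of_forall fun w => localRep_add Y V c' w)
  rw [h4.fderiv, localRep_add, Prod.dist_eq, max_lt_iff, dist_eq_norm, dist_eq_norm,
    sub_add_cancel_left, sub_add_cancel_left, norm_neg, norm_neg]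
  exact ⟨by linarith, by linarith⟩

end C1Topology

/-! ### The flow of a `C¹` vector field on a compact manifold -/

section Flow

variable {n : ℕ} {M : Type*} [TopologicalSpace M] [ChartedSpace (EuclideanSpace ℝ (Fin n)) M]
  [IsManifold (𝓡 n) ∞ M]

/-- The flow of `X` read in the chart at `c`. -/
noncomputable def chartFlow (X : C1VectorField n M) (c : M) (t : ℝ)
    (z : EuclideanSpace ℝ (Fin n)) : EuclideanSpace ℝ (Fin n) :=
  extChartAt (𝓡 n) c (flow X t ((extChartAt (𝓡 n) c).symm z))

variable [T2Space M] [CompactSpace M]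

/-- On a compact manifold every `C¹` vector field is complete. -/
theorem exists_isMIntegralCurve (X : C1VectorField n M) (x : M) :
    ∃ γ : ℝ → M, γ 0 = x ∧ IsMIntegralCurve (I := 𝓡 n) γ (fun p => X p) := by
  have hloc : ∀ x₀ : M, ∃ ε > 0, ∀ᶠ x in 𝓝 x₀, ∃ γ : ℝ → M, γ 0 = x ∧
      IsMIntegralCurveOn (I := 𝓡 n) γ (fun p => X p) (Ioo (-ε) ε) := by
    intro x₀
    obtain ⟨ε, hε, ρ, hρ, φ, h1, -, -⟩ := exists_contDiffOn_localFlow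
      (isOpen_extChartAt_target x₀) (contDiffOn_localRep X x₀)
      (mem_extChartAt_target (I := 𝓡 n) x₀)
    refine ⟨ε, hε, ?_⟩
    filter_upwards [extChartAt_source_mem_nhds (I := 𝓡 n) x₀,
      (continuousAt_extChartAt (I := 𝓡 n) x₀).preimage_mem_nhds (Metric.ball_mem_nhds _ hρ)]
      with x hx hx'
    obtain ⟨h2, h3⟩ := h1 _ hx'
    refine ⟨fun t => (extChartAt (𝓡 n) x₀).symm (φ t (extChartAt (𝓡 n) x₀ x)), ?_, ?_⟩
    · change (extChartAt (𝓡 n) x₀).symm (φ 0 (extChartAt (𝓡 n) x₀ x)) = x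
      rw [h2, (extChartAt (𝓡 n) x₀).left_inv hx]
    · exact isMIntegralCurveOn_of_chart X fun t ht => h3 t ht
  choose ε hε hev using hloc
  obtain ⟨s, hs⟩ := isCompact_univ.elim_nhds_subcover
    (fun x₀ => {x | ∃ γ : ℝ → M, γ 0 = x ∧
      IsMIntegralCurveOn (I := 𝓡 n) γ (fun p => X p) (Ioo (-ε x₀) (ε x₀))}) fun x₀ _ => hev x₀
  obtain ⟨δ, hδ, hδs⟩ : ∃ δ > 0, ∀ x₀ ∈ s, δ ≤ ε x₀ := by
    rcases s.eq_empty_or_nonempty with h | h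
    · exact ⟨1, one_pos, by simp [h]⟩
    · obtain ⟨y, hy, hm⟩ := s.exists_min_image ε h
      exact ⟨ε y, hε y, hm⟩
  refine exists_isMIntegralCurve_of_isMIntegralCurveOn X.contMDiff hδ (fun x => ?_) x
  obtain ⟨x₀, hx₀, γ, h0, h1⟩ := mem_iUnion₂.1 (hs.2 (mem_univ x))
  exact ⟨γ, h0, h1.mono (Ioo_subset_Ioo (neg_le_neg (hδs x₀ hx₀)) (hδs x₀ hx₀))⟩

theorem flow_zero (X : C1VectorField n M) (x : M) : flow X 0 x = x := by
  rw [flow, dif_pos (exists_isMIntegralCurve X x)]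
  exact (exists_isMIntegralCurve X x).choose_spec.1

theorem isMIntegralCurve_flow (X : C1VectorField n M) (x : M) :
    IsMIntegralCurve (I := 𝓡 n) (fun t => flow X t x) (fun p => X p) := by
  have h : (fun t => flow X t x) = (exists_isMIntegralCurve X x).choose := by
    funext t
    rw [flow, dif_pos (exists_isMIntegralCurve X x)]
  rw [h]
  exact (exists_isMIntegralCurve X x).choose_spec.2

/-- A curve which solves the equation on an interval is the flow there, by uniqueness. -/
theorem flow_eqOn_Ioo (X : C1VectorField n M) {γ : ℝ → M} {a b : ℝ} (h0 : (0 : ℝ) ∈ Ioo a b)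
    (hγ : IsMIntegralCurveOn (I := 𝓡 n) γ (fun p => X p) (Ioo a b)) {t : ℝ} (ht : t ∈ Ioo a b) :
    flow X t (γ 0) = γ t :=
  isMIntegralCurveOn_Ioo_eqOn_of_contMDiff_boundaryless h0 X.contMDiff
    ((isMIntegralCurve_flow X (γ 0)).isMIntegralCurveOn _) hγ (flow_zero X _) ht

theorem flow_add (X : C1VectorField n M) (s t : ℝ) (x : M) :
    flow X (s + t) x = flow X s (flow X t x) := by
  have h := isMIntegralCurve_Ioo_eq_of_contMDiff_boundaryless (t₀ := 0) X.contMDiff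
    (isMIntegralCurve_flow X (flow X t x)) ((isMIntegralCurve_flow X x).comp_add t)
    (by simp [flow_zero])
  exact (congrFun h s).symm

theorem flow_neg_flow (X : C1VectorField n M) (t : ℝ) (x : M) :
    flow X (-t) (flow X t x) = x := by
  rw [← flow_add, neg_add_cancel, flow_zero]

theorem flow_flow_neg (X : C1VectorField n M) (t : ℝ) (x : M) :
    flow X t (flow X (-t) x) = x := by
  rw [← flow_add, add_neg_cancel, flow_zero]

/-- A solution in a chart is the flow, as long as it stays in the chart. -/
theorem flow_eq_chart_symm (X : C1VectorField n M) {c : M} {ζ : ℝ → EuclideanSpace ℝ (Fin n)}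
    {a b : ℝ} (h0 : (0 : ℝ) ∈ Ioo a b)
    (h : ∀ t ∈ Ioo a b, ζ t ∈ (extChartAt (𝓡 n) c).target ∧
      HasDerivAt ζ (localRep X c (ζ t)) t) {t : ℝ} (ht : t ∈ Ioo a b) :
    flow X t ((extChartAt (𝓡 n) c).symm (ζ 0)) = (extChartAt (𝓡 n) c).symm (ζ t) :=
  flow_eqOn_Ioo X (γ := fun t => (extChartAt (𝓡 n) c).symm (ζ t)) h0
    (isMIntegralCurveOn_of_chart X h) ht

/-- Near a point of a chart and for short times, the flow stays in the chart, solves the equation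
there, and is jointly `C¹`; at a zero of the field its derivative is the exponential of the linear
part. -/
theorem exists_chartFlow (X : C1VectorField n M) {c : M} {z₀ : EuclideanSpace ℝ (Fin n)}
    (hz₀ : z₀ ∈ (extChartAt (𝓡 n) c).target) :
    ∃ ε > 0, ∃ ρ > 0, Metric.ball z₀ ρ ⊆ (extChartAt (𝓡 n) c).target ∧
      (∀ z ∈ Metric.ball z₀ ρ, ∀ t ∈ Ioo (-ε) ε,
        flow X t ((extChartAt (𝓡 n) c).symm z) ∈ (extChartAt (𝓡 n) c).source ∧
        HasDerivAt (fun s => chartFlow X c s z) (localRep X c (chartFlow X c t z)) t) ∧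
      ContDiffOn ℝ 1 (fun q : ℝ × EuclideanSpace ℝ (Fin n) => chartFlow X c q.1 q.2)
        (Ioo (-ε) ε ×ˢ Metric.ball z₀ ρ) ∧
      (localRep X c z₀ = 0 → ∀ t ∈ Ioo (-ε) ε,
        HasFDerivAt (chartFlow X c t) (NormedSpace.exp (t • fderiv ℝ (localRep X c) z₀)) z₀) := by
  obtain ⟨ε, hε, ρ, hρ, φ, h1, h2, h3⟩ := exists_contDiffOn_localFlow
      (isOpen_extChartAt_target c) (contDiffOn_localRep X c) hz₀
  have h0ε : (0 : ℝ) ∈ Ioo (-ε) ε := by constructor <;> linarith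
  have hfl : ∀ z ∈ Metric.ball z₀ ρ, ∀ t ∈ Ioo (-ε) ε,
      flow X t ((extChartAt (𝓡 n) c).symm z) = (extChartAt (𝓡 n) c).symm (φ t z) := by
    intro z hz t ht
    have := flow_eq_chart_symm X (ζ := fun t => φ t z) h0ε (h1 z hz).2 ht
    simpa only [(h1 z hz).1] using this
  have hcf : ∀ z ∈ Metric.ball z₀ ρ, ∀ t ∈ Ioo (-ε) ε, chartFlow X c t z = φ t z := by
    intro z hz t ht
    rw [chartFlow, hfl z hz t ht, (extChartAt (𝓡 n) c).right_inv ((h1 z hz).2 t ht).1]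
  refine ⟨ε, hε, ρ, hρ, ?_, ?_, ?_, ?_⟩
  · intro z hz
    have := ((h1 z hz).2 0 h0ε).1
    rwa [(h1 z hz).1] at this
  · intro z hz t ht
    refine ⟨?_, ?_⟩
    · rw [hfl z hz t ht]
      exact (extChartAt (𝓡 n) c).map_target ((h1 z hz).2 t ht).1
    · rw [hcf z hz t ht]
      refine ((h1 z hz).2 t ht).2.congr_of_eventuallyEq ?_
      filter_upwards [isOpen_Ioo.mem_nhds ht] with s hs
      exact hcf z hz s hs
  · exact h2.congr fun q hq => hcf _ hq.2 _ hq.1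
  · intro hz t ht
    refine (h3 hz t ht).congr_of_eventuallyEq ?_
    filter_upwards [Metric.ball_mem_nhds z₀ hρ] with z hz
    exact hcf z hz t ht

/-- A property of points of `M` which holds near each point for all short times holds for a
uniform time. -/
theorem exists_uniform_time {P : ℝ → M → Prop}
    (h : ∀ x₀ : M, ∃ ε > 0, ∀ᶠ x in 𝓝 x₀, ∀ t ∈ Ioo (-ε) ε, P t x) :
    ∃ ε > 0, ∀ x, ∀ t ∈ Ioo (-ε) ε, P t x := by
  choose ε hε hev using h
  obtain ⟨s, hs⟩ := isCompact_univ.elim_nhds_subcover _ fun x₀ _ => hev x₀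
  obtain ⟨δ, hδ, hδs⟩ : ∃ δ > 0, ∀ x₀ ∈ s, δ ≤ ε x₀ := by
    rcases s.eq_empty_or_nonempty with h | h
    · exact ⟨1, one_pos, by simp [h]⟩
    · obtain ⟨y, hy, hm⟩ := s.exists_min_image ε h
      exact ⟨ε y, hε y, hm⟩
  refine ⟨δ, hδ, fun x t ht => ?_⟩
  obtain ⟨x₀, hx₀, h1⟩ := mem_iUnion₂.1 (hs.2 (mem_univ x))
  exact h1 t (Ioo_subset_Ioo (neg_le_neg (hδs x₀ hx₀)) (hδs x₀ hx₀) ht)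

/-- A property which holds for short times and for twice any admissible time holds for all
times. -/
theorem forall_time_of_doubling {P : ℝ → Prop} {ε : ℝ} (hε : 0 < ε)
    (h : ∀ t ∈ Ioo (-ε) ε, P t) (hd : ∀ t, P (t / 2) → P t) (t : ℝ) : P t := by
  have key : ∀ k : ℕ, ∀ t : ℝ, |t| < 2 ^ k * ε → P t := by
    intro k
    induction k with
    | zero => intro t ht; exact h t (by rw [pow_zero, one_mul, abs_lt] at ht; exact ht)
    | succ k ih =>
      intro t ht
      refine hd t (ih _ ?_)
      rw [abs_div, abs_two, div_lt_iff₀ two_pos]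
      rw [pow_succ] at ht
      linarith
  obtain ⟨k, hk⟩ := pow_unbounded_of_one_lt (|t| / ε) (one_lt_two : (1 : ℝ) < 2)
  exact key k t (by rwa [div_lt_iff₀ hε] at hk)

/-- The flow is `C¹` for short times; the time is locally uniform in the point. -/
theorem exists_contMDiffAt_flow (X : C1VectorField n M) (x₀ : M) :
    ∃ ε > 0, ∀ᶠ x in 𝓝 x₀, ∀ t ∈ Ioo (-ε) ε,
      ContMDiffAt (𝓘(ℝ, ℝ).prod (𝓡 n)) (𝓡 n) 1 (fun q : ℝ × M => flow X q.1 q.2) (t, x) := by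
  obtain ⟨ε, hε, ρ, hρ, h1, h2, h3, -⟩ := exists_chartFlow X
    (mem_extChartAt_target (I := 𝓡 n) x₀)
  refine ⟨ε, hε, ?_⟩
  have hev : ∀ᶠ x in 𝓝 x₀, x ∈ (extChartAt (𝓡 n) x₀).source ∧
      extChartAt (𝓡 n) x₀ x ∈ Metric.ball (extChartAt (𝓡 n) x₀ x₀) ρ :=
    Filter.Eventually.and (extChartAt_source_mem_nhds (I := 𝓡 n) x₀)
      ((continuousAt_extChartAt (I := 𝓡 n) x₀).preimage_mem_nhds (Metric.ball_mem_nhds _ hρ))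
  filter_upwards [hev.eventually_nhds] with x hx t ht
  have hxx := hx.self_of_nhds
  have e1 : ContMDiffAt (𝓘(ℝ, ℝ).prod (𝓡 n)) 𝓘(ℝ, ℝ × EuclideanSpace ℝ (Fin n)) 1
      (fun q : ℝ × M => (q.1, extChartAt (𝓡 n) x₀ q.2)) (t, x) := by
    have : ContMDiffAt (𝓡 n) 𝓘(ℝ, EuclideanSpace ℝ (Fin n)) 1 (extChartAt (𝓡 n) x₀) x :=
      contMDiffAt_extChartAt' (by rw [← extChartAt_source (I := 𝓡 n)]; exact hxx.1)
    exact contMDiffAt_fst.prodMk_space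
      (ContMDiffAt.comp (g := extChartAt (𝓡 n) x₀) (t, x) this contMDiffAt_snd)
  have hm : (Ioo (-ε) ε ×ˢ Metric.ball (extChartAt (𝓡 n) x₀ x₀) ρ) ∈
      𝓝 (t, extChartAt (𝓡 n) x₀ x) :=
    prod_mem_nhds (isOpen_Ioo.mem_nhds ht) (Metric.isOpen_ball.mem_nhds hxx.2)
  have e2' : ContDiffAt ℝ 1
      (fun q : ℝ × EuclideanSpace ℝ (Fin n) => chartFlow X x₀ q.1 q.2)
      (t, extChartAt (𝓡 n) x₀ x) := h3.contDiffAt hm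
  have e2 : ContMDiffAt 𝓘(ℝ, ℝ × EuclideanSpace ℝ (Fin n)) 𝓘(ℝ, EuclideanSpace ℝ (Fin n)) 1
      (fun q : ℝ × EuclideanSpace ℝ (Fin n) => chartFlow X x₀ q.1 q.2)
      (t, extChartAt (𝓡 n) x₀ x) :=
    e2'.contMDiffAt
  have e3 : ContMDiffAt 𝓘(ℝ, EuclideanSpace ℝ (Fin n)) (𝓡 n) 1 (extChartAt (𝓡 n) x₀).symm
      (chartFlow X x₀ t (extChartAt (𝓡 n) x₀ x)) :=
    (contMDiffOn_extChartAt_symm x₀).contMDiffAt ((isOpen_extChartAt_target x₀).mem_nhds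
      ((extChartAt (𝓡 n) x₀).map_source (h2 _ hxx.2 t ht).1))
  have e4 := e3.comp (t, x) (ContMDiffAt.comp
    (g := fun q : ℝ × EuclideanSpace ℝ (Fin n) => chartFlow X x₀ q.1 q.2) (t, x) e2 e1)
  refine e4.congr_of_eventuallyEq ?_
  filter_upwards [prod_mem_nhds (isOpen_Ioo.mem_nhds ht) hx] with q hq
  change _ = (extChartAt (𝓡 n) x₀).symm (chartFlow X x₀ q.1 (extChartAt (𝓡 n) x₀ q.2))
  have h4 := (h2 _ hq.2.2 _ hq.1).1
  rw [(extChartAt (𝓡 n) x₀).left_inv hq.2.1] at h4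
  rw [chartFlow, (extChartAt (𝓡 n) x₀).left_inv hq.2.1, (extChartAt (𝓡 n) x₀).left_inv h4]

/-- The flow of a `C¹` vector field is jointly `C¹` in time and space. -/
theorem contMDiff_flow (X : C1VectorField n M) :
    ContMDiff (𝓘(ℝ, ℝ).prod (𝓡 n)) (𝓡 n) 1 (fun q : ℝ × M => flow X q.1 q.2) := by
  obtain ⟨ε, hε, h⟩ := exists_uniform_time (exists_contMDiffAt_flow X)
  have hall := forall_time_of_doubling (P := fun t => ∀ x,
    ContMDiffAt (𝓘(ℝ, ℝ).prod (𝓡 n)) (𝓡 n) 1 (fun q : ℝ × M => flow X q.1 q.2) (t, x)) hε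
    (fun t ht x => h x t ht) (fun t ht x => by
      have e0 : ContMDiffAt (𝓘(ℝ, ℝ).prod (𝓡 n)) 𝓘(ℝ, ℝ) 1 (fun q : ℝ × M => q.1 / 2) (t, x) :=
        ContMDiffAt.comp (g := fun s : ℝ => s / 2) (t, x)
          (contDiff_id.div_const 2).contMDiff.contMDiffAt contMDiffAt_fst
      have e1 : ContMDiffAt (𝓘(ℝ, ℝ).prod (𝓡 n)) (𝓡 n) 1
          (fun q : ℝ × M => flow X (q.1 / 2) q.2) (t, x) :=
        ContMDiffAt.comp (g := fun q : ℝ × M => flow X q.1 q.2) (t, x) (ht x)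
          (e0.prodMk contMDiffAt_snd)
      have e2 := ContMDiffAt.comp (g := fun q : ℝ × M => flow X q.1 q.2) (t, x) (ht _)
          (e0.prodMk e1)
      refine e2.congr_of_eventuallyEq (Eventually.of_forall fun q => ?_)
      change flow X q.1 q.2 = flow X (q.1 / 2) (flow X (q.1 / 2) q.2)
      rw [← flow_add, add_halves])
  exact fun q => hall q.1 q.2

theorem continuous_flow (X : C1VectorField n M) :
    Continuous (fun q : ℝ × M => flow X q.1 q.2) := (contMDiff_flow X).continuous

theorem contMDiff_flow_time (X : C1VectorField n M) (t : ℝ) :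
    ContMDiff (𝓡 n) (𝓡 n) 1 (flow X t) :=
  (contMDiff_flow X).comp (contMDiff_const.prodMk contMDiff_id)

theorem continuous_flow_time (X : C1VectorField n M) (t : ℝ) : Continuous (flow X t) :=
  (contMDiff_flow_time X t).continuous

theorem continuous_flow_orbit (X : C1VectorField n M) (x : M) :
    Continuous (fun t => flow X t x) :=
  (continuous_flow X).comp (continuous_id.prodMk continuous_const)

end Flow

/-! ### Comparison of solutions of nearby differential equations -/

section Gronwall

variable {E : Type*} [NormedAddCommGroup E] [NormedSpace ℝ E]

theorem dist_solutions_le_of_nonneg {f g : E → E} {S : Set E} {K : NNReal} {η ε δ : ℝ}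
    (hf : LipschitzOnWith K f S) (hfg : ∀ z ∈ S, ‖g z - f z‖ ≤ η) {α β : ℝ → E}
    (hα : ∀ t ∈ Ioo (-ε) ε, α t ∈ S ∧ HasDerivAt α (f (α t)) t)
    (hβ : ∀ t ∈ Ioo (-ε) ε, β t ∈ S ∧ HasDerivAt β (g (β t)) t)
    (h0 : dist (α 0) (β 0) ≤ δ) {t : ℝ} (ht : t ∈ Ico 0 ε) :
    dist (α t) (β t) ≤ gronwallBound δ K η t := by
  have hsub : ∀ s ∈ Icc 0 t, s ∈ Ioo (-ε) ε := fun s hs =>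
    ⟨by linarith [hs.1, ht.1, ht.2], by linarith [hs.2, ht.2]⟩
  have hsub' : ∀ s ∈ Ico 0 t, s ∈ Ioo (-ε) ε := fun s hs => hsub s (Ico_subset_Icc_self hs)
  have h := dist_le_of_approx_trajectories_ODE_of_mem (v := fun _ => f) (s := fun _ => S)
    (εf := 0) (εg := η) (a := 0) (b := t) (K := K) (f := α) (g := β) (f' := fun t => f (α t))
    (g' := fun t => g (β t)) (fun _ _ => hf)
    (fun s hs => (hα s (hsub s hs)).2.continuousAt.continuousWithinAt)
    (fun s hs => (hα s (hsub' s hs)).2.hasDerivWithinAt) (fun s _ => by simp)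
    (fun s hs => (hα s (hsub' s hs)).1)
    (fun s hs => (hβ s (hsub s hs)).2.continuousAt.continuousWithinAt)
    (fun s hs => (hβ s (hsub' s hs)).2.hasDerivWithinAt)
    (fun s hs => by rw [dist_eq_norm]; exact hfg _ (hβ s (hsub' s hs)).1)
    (fun s hs => (hβ s (hsub' s hs)).1) h0 t ⟨ht.1, le_rfl⟩
  simpa using h

/-- Continuous dependence of solutions on the initial value and on the field, in both time
directions. -/
theorem dist_solutions_le {f g : E → E} {S : Set E} {K : NNReal} {η ε δ : ℝ}
    (hf : LipschitzOnWith K f S) (hfg : ∀ z ∈ S, ‖g z - f z‖ ≤ η) {α β : ℝ → E}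
    (hα : ∀ t ∈ Ioo (-ε) ε, α t ∈ S ∧ HasDerivAt α (f (α t)) t)
    (hβ : ∀ t ∈ Ioo (-ε) ε, β t ∈ S ∧ HasDerivAt β (g (β t)) t)
    (h0 : dist (α 0) (β 0) ≤ δ) {t : ℝ} (ht : t ∈ Ioo (-ε) ε) :
    dist (α t) (β t) ≤ gronwallBound δ K η |t| := by
  rcases le_or_gt 0 t with h | h
  · rw [abs_of_nonneg h]
    exact dist_solutions_le_of_nonneg hf hfg hα hβ h0 ⟨h, ht.2⟩
  · rw [abs_of_neg h]
    have hneg : ∀ s ∈ Ioo (-ε) ε, -s ∈ Ioo (-ε) ε := fun s hs =>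
      ⟨by linarith [hs.2], by linarith [hs.1]⟩
    have key := dist_solutions_le_of_nonneg (f := fun z => -f z) (g := fun z => -g z) (S := S)
      (K := K) (η := η) (ε := ε) (α := fun s => α (-s)) (β := fun s => β (-s)) (t := -t)
      (fun x hx y hy => by simpa only [edist_neg_neg] using hf hx hy)
      (fun z hz => by rw [neg_sub_neg, norm_sub_rev]; exact hfg z hz)
      (fun s hs => ⟨(hα _ (hneg s hs)).1, by
        have := (hα _ (hneg s hs)).2.scomp s (hasDerivAt_neg s)
        simpa [Function.comp_def] using this⟩)
      (fun s hs => ⟨(hβ _ (hneg s hs)).1, by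
        have := (hβ _ (hneg s hs)).2.scomp s (hasDerivAt_neg s)
        simpa [Function.comp_def] using this⟩) (by simpa using h0) ⟨by linarith, by linarith [ht.1]⟩
    simpa using key

end Gronwall

/-! ### Continuity of the flow in the vector field, and maximal invariant sets -/

section Dependence

variable {n : ℕ} {M : Type*} [TopologicalSpace M] [ChartedSpace (EuclideanSpace ℝ (Fin n)) M]
  [IsManifold (𝓡 n) ∞ M] [T2Space M] [CompactSpace M]

/-- Solutions in a chart of all fields near `X` exist on a common time interval and stay in a common
compact ball. -/
theorem exists_uniform_localSolution (X : C1VectorField n M) (c : M)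
    {z₀ : EuclideanSpace ℝ (Fin n)} (hz₀ : z₀ ∈ (extChartAt (𝓡 n) c).target) :
    ∃ ε > 0, ∃ R > 0, Metric.closedBall z₀ R ⊆ (extChartAt (𝓡 n) c).target ∧
      (∃ K : NNReal, LipschitzOnWith K (localRep X c) (Metric.closedBall z₀ R)) ∧
      ∀ᶠ Y in 𝓝 X, ∀ z ∈ Metric.ball z₀ (R / 2), ∃ α : ℝ → EuclideanSpace ℝ (Fin n), α 0 = z ∧
        ∀ t ∈ Ioo (-ε) ε, α t ∈ Metric.closedBall z₀ R ∧
          HasDerivAt α (localRep Y c (α t)) t := by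
  obtain ⟨R, hR0, hRΩ⟩ := Metric.nhds_basis_closedBall.mem_iff.1
    ((isOpen_extChartAt_target c).mem_nhds hz₀)
  have hKc : IsCompact (Metric.closedBall z₀ R) := isCompact_closedBall _ _
  have hf := contDiffOn_localRep X c
  obtain ⟨B₀, hB₀⟩ := hKc.exists_bound_of_continuousOn (hf.continuousOn.mono hRΩ)
  obtain ⟨k₀, hk₀⟩ := hKc.exists_bound_of_continuousOn
    ((hf.continuousOn_fderiv_of_isOpen (isOpen_extChartAt_target c) le_rfl).mono hRΩ)
  set B := max B₀ 0 + 1 with hBdef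
  set k := max k₀ 0 + 1 with hkdef
  have hB1 : 0 < B := by positivity
  have hk1 : 0 < k := by positivity
  have hlip : ∀ Y : C1VectorField n M, (∀ z ∈ Metric.closedBall z₀ R,
      ‖localRep Y c z - localRep X c z‖ < 1 ∧
      ‖fderiv ℝ (localRep Y c) z - fderiv ℝ (localRep X c) z‖ < 1) →
      LipschitzOnWith k.toNNReal (localRep Y c) (Metric.closedBall z₀ R) := fun Y hY =>
    (convex_closedBall z₀ R).lipschitzOnWith_of_nnnorm_hasFDerivWithin_le
      (fun z hz => (hasFDerivAt_localRep Y (hRΩ hz)).hasFDerivWithinAt) fun z hz => by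
        rw [← NNReal.coe_le_coe, coe_nnnorm, Real.coe_toNNReal _ hk1.le]
        have h1 := norm_le_insert' (fderiv ℝ (localRep Y c) z) (fderiv ℝ (localRep X c) z)
        have h2 := (hk₀ z hz).trans (le_max_left k₀ 0)
        linarith [(hY z hz).2]
  refine ⟨R / (2 * B), by positivity, R, hR0, hRΩ, ⟨_, hlip X (by simp)⟩, ?_⟩
  filter_upwards [eventually_localRep_near X c hKc hRΩ one_pos] with Y hY
  set ε := R / (2 * B) with hε
  have hε0 : 0 < ε := by positivity
  have hεB : B * ε = R / 2 := by rw [hε]; field_simp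
  have hPL : IsPicardLindelof (fun _ => localRep Y c) (tmin := -ε) (tmax := ε)
      ⟨0, by constructor <;> linarith⟩ z₀ R.toNNReal (R / 2).toNNReal B.toNNReal k.toNNReal := by
    refine IsPicardLindelof.of_time_independent ?_ ?_ ?_
    · intro x hx
      rw [Real.coe_toNNReal _ hR0.le] at hx
      rw [Real.coe_toNNReal _ hB1.le]
      have h1 := norm_le_insert' (localRep Y c x) (localRep X c x)
      have h2 := (hB₀ x hx).trans (le_max_left B₀ 0)
      linarith [(hY x hx).1]
    · rw [Real.coe_toNNReal _ hR0.le]; exact hlip Y hY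
    · rw [Real.coe_toNNReal _ hR0.le, Real.coe_toNNReal _ (by positivity),
        Real.coe_toNNReal _ (by positivity)]
      simp only [sub_zero, zero_sub, neg_neg, max_self]
      linarith
  intro z hz
  obtain ⟨α, h0, h1⟩ := exists_mem_closedBall_of_isPicardLindelof hPL (x := z) (by
      rw [Real.coe_toNNReal _ (by positivity)]; exact Metric.ball_subset_closedBall hz)
  rw [Real.coe_toNNReal _ hR0.le] at h1
  exact ⟨α, h0, fun t ht => ⟨(h1 t (Ioo_subset_Icc_self ht)).1,
    (h1 t (Ioo_subset_Icc_self ht)).2.hasDerivAt (Icc_mem_nhds ht.1 ht.2)⟩⟩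

/-- For short times the flow is continuous in the field and the point jointly; the time is locally
uniform in the point. -/
theorem exists_continuousAt_flow_field (X : C1VectorField n M) (x₀ : M) :
    ∃ ε > 0, ∀ᶠ x in 𝓝 x₀, ∀ t ∈ Ioo (-ε) ε,
      ContinuousAt (fun p : C1VectorField n M × M => flow p.1 t p.2) (X, x) := by
  obtain ⟨ε, hε, R, hR, hRt, ⟨K, hK⟩, hsol⟩ := exists_uniform_localSolution X x₀
    (mem_extChartAt_target (I := 𝓡 n) x₀)
  have h0ε : (0 : ℝ) ∈ Ioo (-ε) ε := by constructor <;> linarith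
  refine ⟨ε, hε, ?_⟩
  set φ := extChartAt (𝓡 n) x₀ with hφ
  have hev : ∀ᶠ x in 𝓝 x₀, x ∈ φ.source ∧ φ x ∈ Metric.ball (φ x₀) (R / 2) :=
    Filter.Eventually.and (extChartAt_source_mem_nhds (I := 𝓡 n) x₀)
      ((continuousAt_extChartAt (I := 𝓡 n) x₀).preimage_mem_nhds
        (Metric.ball_mem_nhds _ (by positivity)))
  filter_upwards [hev.eventually_nhds] with x hx t ht
  have hxx := hx.self_of_nhds
  obtain ⟨α, hα0, hα⟩ := hsol.self_of_nhds _ hxx.2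
  have hflow : ∀ (Y : C1VectorField n M) (β : ℝ → EuclideanSpace ℝ (Fin n)) (y : M),
      y ∈ φ.source → β 0 = φ y → (∀ t ∈ Ioo (-ε) ε, β t ∈ Metric.closedBall (φ x₀) R ∧
          HasDerivAt β (localRep Y x₀ (β t)) t) → flow Y t y = φ.symm (β t) := by
    intro Y β y hy hβ0 hβ
    have := flow_eq_chart_symm Y (c := x₀) (ζ := β) h0ε
      (fun s hs => ⟨hRt (hβ s hs).1, (hβ s hs).2⟩) ht
    rwa [hβ0, φ.left_inv hy] at this
  have hc : ContinuousAt φ.symm (α t) :=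
    (continuousOn_extChartAt_symm x₀).continuousAt
      ((isOpen_extChartAt_target x₀).mem_nhds (hRt (hα t ht).1))
  have hcx : ContinuousAt φ x := continuousAt_extChartAt' hxx.1
  -- the solutions in the chart depend continuously on the field and on the initial value
  have hlim : ∀ δ > 0, ∀ᶠ p : C1VectorField n M × M in 𝓝 (X, x),
      ∃ w ∈ Metric.ball (α t) δ, flow p.1 t p.2 = φ.symm w := by
    intro δ hδ
    have hg : Tendsto (fun η : ℝ => gronwallBound η K η |t|) (𝓝 0) (𝓝 0) := by
      have h1 : Continuous (fun η : ℝ => gronwallBound η K η |t|) := by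
        unfold gronwallBound
        split_ifs <;> fun_prop
      have h2 := h1.tendsto 0
      simpa [gronwallBound_ε0] using h2
    obtain ⟨η₀, hη₀, hη⟩ := Metric.eventually_nhds_iff.1 (hg.eventually (gt_mem_nhds hδ))
    have hη1 : gronwallBound (η₀ / 2) K (η₀ / 2) |t| < δ := hη (by
      rw [Real.dist_0_eq_abs, abs_of_pos (by positivity)]; linarith)
    have e1 := eventually_localRep_near X x₀ (isCompact_closedBall (φ x₀) R) hRt
      (ε := η₀ / 2) (by positivity)
    have e2 : ∀ᶠ y in 𝓝 x, dist (φ x) (φ y) < η₀ / 2 := by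
      have := hcx.eventually (Metric.ball_mem_nhds _ (half_pos hη₀))
      filter_upwards [this] with y hy
      rw [dist_comm]
      exact hy
    rw [nhds_prod_eq]
    filter_upwards [(hsol.and e1).prod_mk (hx.and e2)] with p hp
    obtain ⟨β, hβ0, hβ⟩ := hp.1.1 _ hp.2.1.2
    refine ⟨β t, ?_, hflow p.1 β p.2 hp.2.1.1 hβ0 hβ⟩
    rw [Metric.mem_ball, dist_comm]
    have h1 := dist_solutions_le hK (η := η₀ / 2) (δ := η₀ / 2) (g := localRep p.1 x₀)
      (fun z hz => (hp.1.2 z hz).1.le) hα hβ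
      (by rw [hα0, hβ0]; exact hp.2.2.le) ht
    exact h1.trans_lt hη1
  have hfx : flow X t x = φ.symm (α t) := hflow X α x hxx.1 hα0 hα
  rw [ContinuousAt]
  change Tendsto _ _ (𝓝 (flow X t x))
  rw [hfx]
  intro V hV
  obtain ⟨δ, hδ, hδV⟩ := Metric.mem_nhds_iff.1 (hc hV)
  rw [mem_map]
  filter_upwards [hlim δ hδ] with p hp
  obtain ⟨w, hw, hpw⟩ := hp
  rw [mem_preimage, hpw]
  exact hδV hw

/-- The time-`t` map depends continuously on the vector field and on the point. -/
theorem continuousAt_flow_field (X : C1VectorField n M) (t : ℝ) (x : M) :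
    ContinuousAt (fun p : C1VectorField n M × M => flow p.1 t p.2) (X, x) := by
  obtain ⟨ε, hε, h⟩ := exists_uniform_time (exists_continuousAt_flow_field X)
  refine forall_time_of_doubling (P := fun t => ∀ x,
    ContinuousAt (fun p : C1VectorField n M × M => flow p.1 t p.2) (X, x)) hε
    (fun t ht x => h x t ht) (fun t ht x => ?_) t x
  have h1 : ContinuousAt (fun p : C1VectorField n M × M => (p.1, flow p.1 (t / 2) p.2)) (X, x) :=
    continuousAt_fst.prodMk (ht x)
  have h2 := ContinuousAt.comp (g := fun p : C1VectorField n M × M => flow p.1 (t / 2) p.2)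
    (x := (X, x)) (ht _) h1
  refine h2.congr (Eventually.of_forall fun p => ?_)
  change flow p.1 (t / 2) (flow p.1 (t / 2) p.2) = _
  rw [← flow_add, add_halves]

/-- A point is in the maximal invariant set of `U` exactly when its whole orbit lies in `U`. -/
theorem mem_continuation {X : C1VectorField n M} {U : Set M} {x : M} :
    x ∈ continuation X U ↔ ∀ t, flow X t x ∈ U := by
  simp only [continuation, mem_iInter]
  constructor
  · intro h t
    obtain ⟨y, hy, hyx⟩ := h (-t)
    rw [← hyx, flow_flow_neg]
    exact hy
  · intro h t
    exact ⟨flow X (-t) x, h _, flow_flow_neg X t x⟩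

/-- If the maximal invariant set of `X` in a compact set `U` is interior to `U`, then the same is
true for all nearby fields. -/
theorem eventually_continuation_subset_interior {X : C1VectorField n M} {U : Set M}
    (hU : IsCompact U) (h : continuation X U ⊆ interior U) :
    ∀ᶠ Y in 𝓝 X, continuation Y U ⊆ interior U := by
  have hloc : ∀ x ∈ U \ interior U, ∀ᶠ p : C1VectorField n M × M in 𝓝 X ×ˢ 𝓝 x,
      p.2 ∉ continuation p.1 U := by
    intro x hx
    have h1 : x ∉ continuation X U := fun h1 => hx.2 (h h1)
    rw [mem_continuation] at h1
    push Not at h1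
    obtain ⟨t, ht⟩ := h1
    have h2 := (continuousAt_flow_field X t x).eventually
      (hU.isClosed.isOpen_compl.mem_nhds ht)
    rw [nhds_prod_eq] at h2
    filter_upwards [h2] with p hp hp'
    exact hp (mem_continuation.1 hp' t)
  have hc : IsCompact (U \ interior U) := hU.diff isOpen_interior
  have h3 : ∀ᶠ Y in 𝓝 X, ∀ x ∈ U \ interior U, x ∉ continuation Y U :=
    hc.eventually_forall_of_forall_eventually fun x hx => by
      rw [nhds_prod_eq]; exact hloc x hx
  filter_upwards [h3] with Y hY x hx
  by_contra hxi
  refine hY x ⟨?_, hxi⟩ hx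
  have := mem_continuation.1 hx 0
  rwa [flow_zero] at this

end Dependence

/-! ### Starting times in a chain of orbit segments -/

section ChainTime

theorem chainTime_zero (t : ℤ → ℝ) : chainTime t 0 = 0 := by simp [chainTime]

theorem chainTime_succ (t : ℤ → ℝ) (i : ℤ) : chainTime t (i + 1) = chainTime t i + t i := by
  simp only [chainTime]
  rcases le_or_gt 0 i with h | h
  · have h1 : Finset.Ico 0 (i + 1) = insert i (Finset.Ico 0 i) := by ext; simp; omega
    have h2 : Finset.Ico (i + 1) 0 = ∅ := by ext; simp; omega
    have h3 : Finset.Ico i 0 = ∅ := by ext; simp; omega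
    rw [h1, h2, h3, Finset.sum_insert (by simp)]
    simp [add_comm]
  · have h1 : Finset.Ico i 0 = insert i (Finset.Ico (i + 1) 0) := by ext; simp; omega
    have h2 : Finset.Ico 0 (i + 1) = ∅ := by ext; simp; omega
    have h3 : Finset.Ico 0 i = ∅ := by ext; simp; omega
    rw [h1, h2, h3, Finset.sum_insert (by simp)]
    simp

theorem chainTime_sub_le {t : ℤ → ℝ} (ht : ∀ i, 1 ≤ t i) (i : ℤ) (k : ℕ) :
    chainTime t i + k ≤ chainTime t (i + k) := by
  induction k with
  | zero => simp
  | succ k ih =>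
    push_cast
    rw [← add_assoc i, chainTime_succ]
    linarith [ht (i + k)]

theorem exists_mem_chainTime {t : ℤ → ℝ} (ht : ∀ i, 1 ≤ t i) (s : ℝ) :
    ∃ i : ℤ, s ∈ Icc (chainTime t i) (chainTime t (i + 1)) := by
  have hne : ∃ i : ℤ, chainTime t i ≤ s := by
    obtain ⟨k, hk⟩ := exists_nat_ge (-s)
    refine ⟨-k, ?_⟩
    have := chainTime_sub_le ht (-k) k
    rw [neg_add_cancel, chainTime_zero] at this
    linarith
  have hb : ∃ B : ℤ, ∀ i : ℤ, chainTime t i ≤ s → i ≤ B := by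
    obtain ⟨k, hk⟩ := exists_nat_gt s
    refine ⟨k, fun i hi => ?_⟩
    by_contra! h
    obtain ⟨j, hj⟩ := Int.eq_ofNat_of_zero_le (by omega : 0 ≤ i - k)
    have h1 := chainTime_sub_le ht 0 k
    have h2 := chainTime_sub_le ht (0 + k) j
    rw [show (0 + k + j : ℤ) = i by omega] at h2
    rw [chainTime_zero] at h1
    have : (0 : ℝ) ≤ j := Nat.cast_nonneg j
    linarith
  obtain ⟨i, hi, hm⟩ := Int.exists_greatest_of_bdd hb hne
  refine ⟨i, hi, ?_⟩
  by_contra! h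
  have := hm (i + 1) h.le
  omega

theorem nonpos_of_chainTime_le {t : ℤ → ℝ} (ht : ∀ i, 1 ≤ t i) {s : ℝ} (hs : s ≤ 0) {i : ℤ}
    (hi : chainTime t i ≤ s) : i ≤ 0 := by
  by_contra! h
  obtain ⟨j, hj⟩ := Int.eq_ofNat_of_zero_le h.le
  have h1 := chainTime_sub_le ht 0 j
  rw [chainTime_zero, show (0 + j : ℤ) = i by omega] at h1
  have : (1 : ℝ) ≤ j := by exact_mod_cast (by omega : 1 ≤ j)
  linarith

end ChainTime

/-! ### Sections with linear return map, and failure of shadowing -/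

section LinearSection

variable {n : ℕ} {M : Type*} [EMetricSpace M] [ChartedSpace (EuclideanSpace ℝ (Fin n)) M]
  [IsManifold (𝓡 n) ∞ M] [CompactSpace M]
  {F : Type*} [NormedAddCommGroup F] [NormedSpace ℝ F]

theorem one_equiv_apply (w : F) : (1 : F ≃L[ℝ] F) w = w := rfl

/-- The map `q` parametrizes, over the ball of radius `b` of `F`, a section at the closed orbit of
`q 0`, to which the flow of `Z` returns after the time `τ`, and in which the return map is the
linear map `L`. For a singularity, `q` is an inverse chart and `τ` is constant. -/
structure IsLinearSection (Z : C1VectorField n M) (q : F → M) (L : F ≃L[ℝ] F) (τ : F → ℝ)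
    (b τ₀ τ₁ : ℝ) : Prop where
  radius_pos : 0 < b
  time_pos : 0 < τ₀
  continuousOn : ContinuousOn q (Metric.closedBall 0 b)
  flow_eq : ∀ w, ‖w‖ ≤ b → flow Z (τ w) (q w) = q (L w)
  le_time : ∀ w, ‖w‖ ≤ b → τ₀ ≤ τ w
  time_le : ∀ w, ‖w‖ ≤ b → τ w ≤ τ₁
  eq_zero : ∀ w, ‖w‖ ≤ b → q w ∈ orbit Z (q 0) → w = 0

namespace IsLinearSection

variable {Z : C1VectorField n M} {q : F → M} {L : F ≃L[ℝ] F} {τ : F → ℝ} {b τ₀ τ₁ : ℝ}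

theorem isCompact_orbit (h : IsLinearSection Z q L τ b τ₀ τ₁) : IsCompact (orbit Z (q 0)) := by
  have h0 : flow Z (τ 0) (q 0) = q 0 := by
    have := h.flow_eq 0 (by simpa using h.radius_pos.le)
    rwa [map_zero] at this
  have hp : Function.Periodic (fun t => flow Z t (q 0)) (τ 0) := fun t => by
    change flow Z (t + τ 0) (q 0) = flow Z t (q 0)
    rw [flow_add, h0]
  have hτ : 0 < τ 0 := h.time_pos.trans_le (h.le_time 0 (by simpa using h.radius_pos.le))
  have : orbit Z (q 0) = (fun t => flow Z t (q 0)) '' Icc 0 (0 + τ 0) :=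
    (hp.image_Icc hτ 0).symm
  rw [this]
  exact isCompact_Icc.image (continuous_flow_orbit Z _)

/-- Points of the section which are close to the closed orbit have small parameters. -/
theorem exists_thickening (h : IsLinearSection Z q L τ b τ₀ τ₁) [FiniteDimensional ℝ F] {ρ : ℝ}
    (hρ : 0 < ρ) : ∃ δ > 0, ∀ w, ‖w‖ ≤ b → q w ∈ Metric.thickening δ (orbit Z (q 0)) → ‖w‖ < ρ := by
  have : ProperSpace F := FiniteDimensional.proper ℝ F
  have hc : IsCompact (Metric.closedBall (0 : F) b \ Metric.ball 0 ρ) :=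
    (isCompact_closedBall _ _).diff Metric.isOpen_ball
  have hA : IsCompact (q '' (Metric.closedBall (0 : F) b \ Metric.ball 0 ρ)) :=
    hc.image_of_continuousOn (h.continuousOn.mono sdiff_subset)
  have hd : Disjoint (q '' (Metric.closedBall (0 : F) b \ Metric.ball 0 ρ)) (orbit Z (q 0)) := by
    rw [Set.disjoint_left]
    rintro _ ⟨w, hw, rfl⟩ hw'
    have := h.eq_zero w (by simpa using hw.1) hw'
    exact hw.2 (by simpa [this] using hρ)
  obtain ⟨δ, hδ, hdis⟩ := hd.exists_thickenings hA h.isCompact_orbit.isClosed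
  refine ⟨δ, hδ, fun w hw hqw => ?_⟩
  by_contra! hρw
  exact Set.disjoint_left.1 hdis (Metric.self_subset_thickening hδ _
    ⟨w, ⟨by simpa using hw, by simpa using hρw⟩, rfl⟩) hqw

/-- After the sum of `m` successive return times, the flow has applied `L ^ m` to the parameter. -/
theorem flow_sum_time (h : IsLinearSection Z q L τ b τ₀ τ₁) {w : F} {m : ℕ}
    (hw : ∀ k : ℕ, ‖(L ^ k) w‖ ≤ b) :
    flow Z (∑ j ∈ Finset.range m, τ ((L ^ j) w)) (q w) = q ((L ^ m) w) := by
  induction m with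
  | zero => simp [flow_zero, one_equiv_apply]
  | succ m ih =>
    rw [Finset.sum_range_succ, add_comm, flow_add, ih, h.flow_eq _ (hw m), pow_succ']
    rfl

/-- Points of the section close to the closed orbit stay near it until their next return. -/
theorem exists_flow_mem (h : IsLinearSection Z q L τ b τ₀ τ₁) {G : Set M} (hG : IsOpen G)
    (hγ : orbit Z (q 0) ⊆ G) :
    ∃ β > 0, β ≤ b ∧ ∀ w, ‖w‖ ≤ β → ∀ t ∈ Icc 0 τ₁, flow Z t (q w) ∈ G := by
  have hq : ContinuousAt q 0 :=
    h.continuousOn.continuousAt (Metric.closedBall_mem_nhds _ h.radius_pos)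
  have h1 : ∀ᶠ w in 𝓝 (0 : F), ∀ t ∈ Icc 0 τ₁, flow Z t (q w) ∈ G := by
    refine isCompact_Icc.eventually_forall_of_forall_eventually fun t _ => ?_
    have hc : ContinuousAt (fun p : F × ℝ => flow Z p.2 (q p.1)) (0, t) := by
      have h2 : ContinuousAt (fun p : F × ℝ => (p.2, q p.1)) (0, t) :=
        continuousAt_snd.prodMk (ContinuousAt.comp (g := q) (x := ((0 : F), t)) hq continuousAt_fst)
      exact ContinuousAt.comp (g := fun q : ℝ × M => flow Z q.1 q.2) (x := ((0 : F), t))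
        (continuous_flow Z).continuousAt h2
    exact hc.eventually (hG.mem_nhds (hγ ⟨t, rfl⟩))
  obtain ⟨r, hr, hr'⟩ := Metric.nhds_basis_closedBall.eventually_iff.1 h1
  exact ⟨min r b, lt_min hr h.radius_pos, min_le_right _ _, fun w hw =>
    hr' (by simpa using hw.trans (min_le_left _ _))⟩

/-- A point of the section whose orbit under `L` stays small has its whole orbit near the closed
orbit. -/
theorem flow_mem (h : IsLinearSection Z q L τ b τ₀ τ₁) {G : Set M} {β : ℝ} (hβb : β ≤ b)
    (hβ : ∀ w, ‖w‖ ≤ β → ∀ t ∈ Icc 0 τ₁, flow Z t (q w) ∈ G) {w : F}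
    (hw : ∀ k : ℤ, ‖(L ^ k) w‖ ≤ β) (t : ℝ) : flow Z t (q w) ∈ G := by
  have key := forall_time_of_doubling (P := fun t => ∀ (w : F) (s : ℝ), (∀ k : ℤ, ‖(L ^ k) w‖ ≤ β) →
      s ∈ Icc 0 τ₁ → ∃ (w' : F) (s' : ℝ), (∀ k : ℤ, ‖(L ^ k) w'‖ ≤ β) ∧ s' ∈ Icc 0 τ₁ ∧
        flow Z (t + s) (q w) = flow Z s' (q w')) h.time_pos ?_ ?_ t
  · obtain ⟨w', s', h1, h2, h3⟩ := key w 0 hw ⟨le_rfl, by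
      have h4 := h.le_time 0 (by simpa using h.radius_pos.le)
      have h5 := h.time_le 0 (by simpa using h.radius_pos.le)
      linarith [h.time_pos]⟩
    rw [add_zero] at h3
    rw [h3]
    exact hβ w' (by simpa [one_equiv_apply] using h1 0) s' h2
  · intro t ht w s hw hs
    have hw0 : ‖w‖ ≤ b := by simpa [one_equiv_apply] using (hw 0).trans hβb
    rcases lt_or_ge (t + s) 0 with h1 | h1
    · have e : L ((L ^ (-1 : ℤ)) w) = w := by
        rw [zpow_neg_one]; exact L.apply_symm_apply w
      have hb : ‖(L ^ (-1 : ℤ)) w‖ ≤ b := (hw _).trans hβb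
      refine ⟨(L ^ (-1 : ℤ)) w, t + s + τ ((L ^ (-1 : ℤ)) w), fun k => ?_, ⟨?_, ?_⟩, ?_⟩
      · rw [← zpow_apply_add]; exact hw _
      · linarith [h.le_time _ hb, ht.1, hs.1]
      · linarith [h.time_le _ hb]
      · rw [flow_add Z (t + s), h.flow_eq _ hb, e]
    · rcases le_or_gt (t + s) τ₁ with h2 | h2
      · exact ⟨w, t + s, hw, ⟨h1, h2⟩, rfl⟩
      · refine ⟨L w, t + s - τ w, fun k => ?_, ⟨?_, ?_⟩, ?_⟩
        · have := zpow_apply_add L k 1 w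
          rw [zpow_one] at this
          rw [← this]; exact hw _
        · linarith [h.time_le _ hw0]
        · linarith [h.le_time _ hw0, ht.2, hs.2]
        · rw [← h.flow_eq _ hw0, ← flow_add, sub_add_cancel]
  · intro t ht w s hw hs
    obtain ⟨w1, s1, h1, h2, h3⟩ := ht w s hw hs
    obtain ⟨w2, s2, h4, h5, h6⟩ := ht w1 s1 h1 h2
    refine ⟨w2, s2, h4, h5, ?_⟩
    rw [← h6, flow_add Z _ s1, ← h3, ← flow_add]
    ring_nf

/-- If the whole orbit of a point of the section stays near the closed orbit, then the orbit of its
parameter under `L` is bounded. -/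
theorem zpow_norm_le (h : IsLinearSection Z q L τ b τ₀ τ₁) {b' : ℝ} (hb' : b' ≤ b)
    (hL : ∀ w, ‖w‖ ≤ b' → ‖L w‖ ≤ b ∧ ‖(L ^ (-1 : ℤ)) w‖ ≤ b) {O : Set M}
    (hOb : ∀ w, ‖w‖ ≤ b → q w ∈ O → ‖w‖ < b') (hO : ∀ x ∈ O, ∀ t, flow Z t x ∈ O) {w : F}
    (hw : ‖w‖ ≤ b') (hwO : q w ∈ O) (k : ℤ) : ‖(L ^ k) w‖ ≤ b' := by
  have key : ∀ k : ℤ, ‖(L ^ k) w‖ ≤ b' ∧ q ((L ^ k) w) ∈ O := by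
    intro k
    induction k using Int.induction_on with
    | zero => exact ⟨by simpa [one_equiv_apply] using hw,
        by simpa [one_equiv_apply] using hwO⟩
    | succ i ih =>
      have e : (L ^ ((i : ℤ) + 1)) w = L ((L ^ (i : ℤ)) w) := by
        have := zpow_apply_add L 1 i w
        rwa [zpow_one, add_comm] at this
      rw [e]
      have h1 : q (L ((L ^ (i : ℤ)) w)) ∈ O := by
        rw [← h.flow_eq _ (ih.1.trans hb')]
        exact hO _ ih.2 _
      exact ⟨(hOb _ (hL _ ih.1).1 h1).le, h1⟩
    | pred i ih =>
      have e : (L ^ (-(i : ℤ) - 1)) w = (L ^ (-1 : ℤ)) ((L ^ (-(i : ℤ))) w) := by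
        rw [← zpow_apply_add]; congr 2; ring
      rw [e]
      set u := (L ^ (-1 : ℤ)) ((L ^ (-(i : ℤ))) w)
      have hub : ‖u‖ ≤ b := (hL _ ih.1).2
      have e' : L u = (L ^ (-(i : ℤ))) w := by
        change L ((L ^ (-1 : ℤ)) _) = _
        rw [zpow_neg_one]; exact L.apply_symm_apply _
      have h1 : q u ∈ O := by
        have := hO _ ih.2 (-τ u)
        rwa [← e', ← h.flow_eq _ hub, flow_neg_flow] at this
      exact ⟨(hOb _ hub h1).le, h1⟩
  exact (key k).1

/-- A point `x` close to `q w` has `Pr x` close to `w`, uniformly in `w`. -/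
theorem exists_near_parameter (h : IsLinearSection Z q L τ b τ₀ τ₁) [FiniteDimensional ℝ F]
    {N : Set M} (hN : IsOpen N) {Pr : M → F} (hNq : ∀ w, ‖w‖ ≤ b → q w ∈ N)
    (hPr : ContinuousOn Pr N) (hPrq : ∀ w, ‖w‖ ≤ b → Pr (q w) = w) {ζ : ℝ} (hζ : 0 < ζ) :
    ∃ ε > 0, ∀ w, ‖w‖ ≤ b → ∀ x, edist x (q w) < ENNReal.ofReal ε → x ∈ N ∧ ‖Pr x - w‖ < ζ := by
  have : ProperSpace F := FiniteDimensional.proper ℝ F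
  have hK : IsCompact (q '' Metric.closedBall (0 : F) b) :=
    (isCompact_closedBall _ _).image_of_continuousOn h.continuousOn
  have hKN : q '' Metric.closedBall (0 : F) b ⊆ N := by
    rintro _ ⟨w, hw, rfl⟩
    exact hNq w (by simpa using hw)
  obtain ⟨ε₁, hε₁, h1⟩ := hK.exists_thickening_subset_open hN hKN
  have h2 := hK.uniformContinuousAt_of_continuousAt Pr
    (fun x hx => hPr.continuousAt (hN.mem_nhds (hKN hx))) (Metric.dist_mem_uniformity hζ)
  obtain ⟨ε₂, hε₂, h3⟩ := mem_uniformity_edist.1 h2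
  obtain ⟨ε₃, hε₃, h4⟩ : ∃ ε₃ : ℝ, 0 < ε₃ ∧ ENNReal.ofReal ε₃ ≤ ε₂ := by
    obtain ⟨r, hr, hr'⟩ := ENNReal.lt_iff_exists_nnreal_btwn.1 hε₂
    exact ⟨r, by exact_mod_cast hr, by rw [ENNReal.ofReal_coe_nnreal]; exact hr'.le⟩
  refine ⟨min ε₁ ε₃, lt_min hε₁ hε₃, fun w hw x hx => ?_⟩
  have hwK : q w ∈ q '' Metric.closedBall (0 : F) b := ⟨w, by simpa using hw, rfl⟩
  constructor
  · exact h1 ((Metric.mem_thickening_iff_exists_edist_lt _ _).2 ⟨q w, hwK,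
      hx.trans_le (ENNReal.ofReal_le_ofReal (min_le_left _ _))⟩)
  · have h5 : edist (q w) x < ε₂ := by
      rw [edist_comm]
      exact hx.trans_le ((ENNReal.ofReal_le_ofReal (min_le_right _ _)).trans h4)
    have h6 : dist (Pr (q w)) (Pr x) < ζ := h3 h5 hwK
    rwa [hPrq w hw, dist_comm, dist_eq_norm] at h6

/-- The parametrization of the section is uniformly continuous. -/
theorem exists_modulus (h : IsLinearSection Z q L τ b τ₀ τ₁) [FiniteDimensional ℝ F] {δ : ℝ}
    (hδ : 0 < δ) : ∃ η > 0, ∀ w w', ‖w‖ ≤ b → ‖w'‖ ≤ b → ‖w - w'‖ < η →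
      edist (q w) (q w') < ENNReal.ofReal δ := by
  have : ProperSpace F := FiniteDimensional.proper ℝ F
  have h1 := (isCompact_closedBall (0 : F) b).uniformContinuousOn_of_continuous h.continuousOn
  obtain ⟨ε₂, hε₂, h3⟩ := EMetric.uniformContinuousOn_iff.1 h1 _ (ENNReal.ofReal_pos.2 hδ)
  obtain ⟨r, hr, hr'⟩ := ENNReal.lt_iff_exists_nnreal_btwn.1 hε₂
  refine ⟨r, by exact_mod_cast hr, fun w w' hw hw' hww => h3 (by simpa using hw)
    (by simpa using hw') (lt_trans ?_ hr')⟩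
  rw [edist_dist, dist_eq_norm, ← ENNReal.ofReal_coe_nnreal]
  exact (ENNReal.ofReal_lt_ofReal_iff (by exact_mod_cast hr)).2 hww

/-- Parameters interpolating between the closed orbit and the orbit of `v` under `L ^ m`: the
jumps are small because the scaling factor increases slowly from `0` to `1`. -/
theorem _root_.RobustShadowing.exists_slow_interpolation (L : F ≃L[ℝ] F) {v : F} {β η : ℝ}
    (hβ : 0 < β) (hη : 0 < η) (hv : ∀ k : ℤ, ‖(L ^ k) v‖ ≤ β) (m : ℕ) :
    ∃ (w : ℤ → F) (N : ℕ), (∀ i k, ‖(L ^ (k : ℤ)) (w i)‖ ≤ β) ∧ (∀ i ≤ 0, w i = 0) ∧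
      w N = (L ^ ((m * N : ℕ) : ℤ)) v ∧ ∀ i, ‖(L ^ m) (w i) - w (i + 1)‖ < η := by
  obtain ⟨N, hN⟩ := exists_nat_gt (β / η)
  have hN0 : (0 : ℝ) < N := lt_of_le_of_lt (by positivity) hN
  have hNβ : (1 / N : ℝ) * β < η := by
    rw [div_lt_iff₀ hη] at hN
    rw [one_div_mul_eq_div, div_lt_iff₀ hN0]
    linarith
  let r : ℤ → ℝ := fun i => max 0 (min 1 (i / N))
  have hr0 : ∀ i, 0 ≤ r i := fun i => le_max_left _ _
  have hr1 : ∀ i, r i ≤ 1 := fun i => max_le zero_le_one (min_le_left _ _)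
  have hrd : ∀ i, |r i - r (i + 1)| ≤ 1 / N := by
    intro i
    have h1 := abs_max_sub_max_le_abs (min 1 ((i : ℝ) / N)) (min 1 (((i + 1 : ℤ) : ℝ) / N)) 0
    have h2 := abs_min_sub_min_le_max 1 ((i : ℝ) / N) 1 (((i + 1 : ℤ) : ℝ) / N)
    have h3 : (i : ℝ) / N - ((i + 1 : ℤ) : ℝ) / N = -(1 / N) := by push_cast; ring
    rw [h3, sub_self, abs_zero, abs_neg, abs_of_pos (one_div_pos.2 hN0),
      max_eq_right (one_div_pos.2 hN0).le] at h2
    calc |r i - r (i + 1)| = |max (min 1 ((i : ℝ) / N)) 0 - max (min 1 (((i + 1 : ℤ) : ℝ) / N)) 0| := by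
          simp only [r, max_comm]
      _ ≤ _ := h1.trans h2
  refine ⟨fun i => r i • (L ^ ((m : ℤ) * i)) v, N, fun i k => ?_, fun i hi => ?_, ?_, fun i => ?_⟩
  · rw [map_smul, ← zpow_apply_add, norm_smul, Real.norm_eq_abs, abs_of_nonneg (hr0 i)]
    exact (mul_le_mul (hr1 i) (hv _) (norm_nonneg _) zero_le_one).trans_eq (one_mul β)
  · have h1 : (i : ℝ) / N ≤ 0 :=
      div_nonpos_of_nonpos_of_nonneg (by exact_mod_cast hi) hN0.le
    have : r i = 0 := max_eq_left ((min_le_right _ _).trans h1)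
    change r i • _ = _
    rw [this, zero_smul]
  · have : r N = 1 := by
      simp [r, div_self hN0.ne']
    change r N • _ = _
    rw [this, one_smul]
    push_cast
    rfl
  · have e : (L ^ m) ((L ^ ((m : ℤ) * i)) v) = (L ^ ((m : ℤ) * (i + 1))) v := by
      rw [mul_add, mul_one, add_comm, zpow_apply_add, zpow_natCast]
    change ‖(L ^ m) (r i • _) - r (i + 1) • _‖ < η
    rw [map_smul, e, ← sub_smul, norm_smul, Real.norm_eq_abs]
    exact (mul_le_mul (hrd i) (hv _) (norm_nonneg _) (by positivity)).trans_lt hNβ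

/-- Near a closed orbit (or a singularity) which has a section with linear return map and a
nonzero vector with bounded orbit, shadowing fails: a pseudo orbit which stays at the closed orbit
for all negative times and then slowly moves away to the orbit of a vector of the bounded part
cannot be shadowed, since a point whose backward orbit stays close to the closed orbit and whose
forward orbit stays in the section must itself be close to the closed orbit. -/
theorem not_isShadowable (h : IsLinearSection Z q L τ b τ₀ τ₁) [FiniteDimensional ℝ F]
    {U : Set M} (hU : orbit Z (q 0) ⊆ interior U) {N : Set M} (hN : IsOpen N) {Pr : M → F}
    (hNq : ∀ w, ‖w‖ ≤ b → q w ∈ N) (hPr : ContinuousOn Pr N)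
    (hPrq : ∀ w, ‖w‖ ≤ b → Pr (q w) = w) (hPrf : ∀ x ∈ N, ∃ s, flow Z s x = q (Pr x))
    (hL : boundedOrbits L ≠ ⊥) : ¬ IsShadowable Z (continuation Z U) := by
  intro hsh
  obtain ⟨v₀, hv₀, hv₀0⟩ := (Submodule.ne_bot_iff _).1 hL
  obtain ⟨C, hC0, hC⟩ := boundedOrbits_uniform L
  have hb := h.radius_pos
  obtain ⟨b', hb'0, hb'b, hLb⟩ : ∃ b' > 0, b' ≤ b ∧ ∀ w, ‖w‖ ≤ b' →
      ‖L w‖ ≤ b ∧ ‖(L ^ (-1 : ℤ)) w‖ ≤ b := by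
    have h1 : ContinuousAt (fun w => (L w, (L ^ (-1 : ℤ)) w)) 0 := by fun_prop
    have h2 : ∀ᶠ w in 𝓝 (0 : F), ‖L w‖ < b ∧ ‖(L ^ (-1 : ℤ)) w‖ < b := by
      have h3 : ∀ᶠ p : F × F in 𝓝 (L 0, (L ^ (-1 : ℤ)) 0), ‖p.1‖ < b ∧ ‖p.2‖ < b := by
        simp only [map_zero]
        exact (IsOpen.and (isOpen_lt (by fun_prop) continuous_const)
          (isOpen_lt (by fun_prop) continuous_const)).mem_nhds (by simpa using hb)
      exact h1.eventually h3
    obtain ⟨r, hr, hr'⟩ := Metric.nhds_basis_closedBall.eventually_iff.1 h2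
    exact ⟨min r b, lt_min hr hb, min_le_right _ _, fun w hw => by
      have := hr' (x := w) (by simpa using hw.trans (min_le_left _ _))
      exact ⟨this.1.le, this.2.le⟩⟩
  -- Within `δ₁` of the closed orbit, points of the section have parameters smaller than `b'`, to
  -- which both `L` and its inverse can be applied inside the section. Parameters bounded by `β` stay
  -- within `δ₁ / 2`, which leaves room for the shadowing error.
  obtain ⟨δ₁, hδ₁, hδ₁'⟩ := h.exists_thickening hb'0
  obtain ⟨β, hβ0, hβb, hβ⟩ := h.exists_flow_mem (G := interior U ∩
      Metric.thickening (δ₁ / 2) (orbit Z (q 0)))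
    (isOpen_interior.inter Metric.isOpen_thickening)
    (subset_inter hU (Metric.self_subset_thickening (by positivity) _))
  obtain ⟨v, hvB, hv0, hvβ⟩ : ∃ v ∈ boundedOrbits L, v ≠ 0 ∧
      ∀ k : ℤ, ‖(L ^ k) v‖ ≤ min β (b' / 2) := by
    obtain ⟨C₀, hC₀⟩ := hv₀
    have hm : 0 < min β (b' / 2) := lt_min hβ0 (by positivity)
    refine ⟨(min β (b' / 2) / (|C₀| + 1)) • v₀, Submodule.smul_mem _ _ ⟨C₀, hC₀⟩,
      smul_ne_zero (by positivity) hv₀0, fun k => ?_⟩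
    rw [map_smul, norm_smul, Real.norm_of_nonneg (by positivity), div_mul_eq_mul_div]
    refine div_le_of_le_mul₀ (by positivity) hm.le ?_
    gcongr
    linarith [hC₀ k, le_abs_self C₀]
  have hvn : 0 < ‖v‖ := norm_pos_iff.2 hv0
  -- A vector in the orbit of `v` has norm at least `‖v‖ / C`, hence more than `2 ζ`.
  set ζ := min (b' / 2) (‖v‖ / (4 * C)) with hζdef
  have hζ0 : 0 < ζ := lt_min (by positivity) (by positivity)
  have hζC : C * (2 * ζ) < ‖v‖ := by
    have : ζ ≤ ‖v‖ / (4 * C) := min_le_right _ _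
    calc C * (2 * ζ) ≤ C * (2 * (‖v‖ / (4 * C))) := by gcongr
      _ = ‖v‖ / 2 := by field_simp; norm_num
      _ < ‖v‖ := by linarith
  obtain ⟨δ₂, hδ₂, hδ₂'⟩ := h.exists_thickening hζ0
  obtain ⟨ε₁, hε₁, hε₁'⟩ := h.exists_near_parameter hN hNq hPr hPrq hζ0
  set ε := min ε₁ (min (δ₁ / 2) δ₂) with hεdef
  have hε0 : 0 < ε := lt_min hε₁ (lt_min (by positivity) hδ₂)
  obtain ⟨δ, hδ, hshad⟩ := hsh ε hε0
  obtain ⟨η, hη, hηq⟩ := h.exists_modulus hδ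
  -- Each piece of the pseudo orbit consists of `m` returns, so that it lasts at least time `1`.
  obtain ⟨m, hm⟩ := exists_nat_gt (1 / τ₀)
  have hmτ : 1 ≤ m * τ₀ := by
    rw [div_lt_iff₀ h.time_pos] at hm
    exact hm.le
  obtain ⟨w, n₀, hwβ, hw0, hwn, hwη⟩ := exists_slow_interpolation L (m := m)
    (lt_min hβ0 (by positivity : 0 < b' / 2)) hη hvβ
  have hwβ' : ∀ i (k : ℤ), ‖(L ^ k) (w i)‖ ≤ β := fun i k => (hwβ i k).trans (min_le_left _ _)
  have hwb : ∀ i (k : ℕ), ‖(L ^ k) (w i)‖ ≤ b := fun i k => by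
    simpa using (hwβ' i k).trans hβb
  have hwb0 : ∀ i, ‖w i‖ ≤ b := fun i => by
    simpa [one_equiv_apply] using hwb i 0
  have hG : ∀ i t, flow Z t (q (w i)) ∈ interior U ∩ Metric.thickening (δ₁ / 2) (orbit Z (q 0)) :=
    fun i t => h.flow_mem hβb hβ (hwβ' i) t
  set t : ℤ → ℝ := fun i => ∑ j ∈ Finset.range m, τ ((L ^ j) (w i)) with ht
  have ht1 : ∀ i, 1 ≤ t i := by
    intro i
    have h1 : ∑ j ∈ Finset.range m, τ₀ ≤ t i :=
      Finset.sum_le_sum fun j _ => h.le_time _ (hwb i j)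
    rw [Finset.sum_const, Finset.card_range, nsmul_eq_mul] at h1
    linarith
  have hps : IsPseudoOrbitIn Z (continuation Z U) δ (fun i => q (w i)) t := by
    refine ⟨fun i => mem_continuation.2 fun s => interior_subset (hG i s).1, ht1, fun i => ?_⟩
    rw [h.flow_sum_time (hwb i)]
    exact hηq _ _ (hwb i m) (hwb0 _) (hwη i)
  obtain ⟨y, g, hgm, hg0, hgs⟩ := hshad _ t hps
  -- The shadowing orbit stays near the closed orbit, and even closer to it for negative times, when
  -- the pseudo orbit runs on the closed orbit itself.
  have hy1 : ∀ s, flow Z s y ∈ Metric.thickening δ₁ (orbit Z (q 0)) := by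
    intro s
    obtain ⟨s', rfl⟩ := g.surjective s
    obtain ⟨i, hi⟩ := exists_mem_chainTime ht1 s'
    have h1 := hgs i s' hi
    obtain ⟨p, hp, hp'⟩ := (Metric.mem_thickening_iff_exists_edist_lt _ _).1 (hG i (s' - chainTime t i)).2
    refine (Metric.mem_thickening_iff_exists_edist_lt _ _).2 ⟨p, hp, ?_⟩
    have h2 : ENNReal.ofReal ε ≤ ENNReal.ofReal (δ₁ / 2) :=
      ENNReal.ofReal_le_ofReal ((min_le_right _ _).trans (min_le_left _ _))
    calc edist (flow Z (g s') y) p ≤ _ := edist_triangle _ (flow Z (s' - chainTime t i) (q (w i))) _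
      _ < ENNReal.ofReal (δ₁ / 2) + ENNReal.ofReal (δ₁ / 2) :=
        ENNReal.add_lt_add (h1.trans_le h2) hp'
      _ = ENNReal.ofReal δ₁ := by
        rw [← ENNReal.ofReal_add (by positivity) (by positivity), add_halves]
  have hy2 : ∀ s ≤ 0, flow Z s y ∈ Metric.thickening δ₂ (orbit Z (q 0)) := by
    intro s hs
    obtain ⟨s', rfl⟩ := g.surjective s
    have hs' : s' ≤ 0 := by rwa [← hg0, hgm.le_iff_le] at hs
    obtain ⟨i, hi⟩ := exists_mem_chainTime ht1 s'
    have h1 := hgs i s' hi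
    beta_reduce at h1
    rw [hw0 i (nonpos_of_chainTime_le ht1 hs' hi.1)] at h1
    exact (Metric.mem_thickening_iff_exists_edist_lt _ _).2 ⟨_, ⟨_, rfl⟩, h1.trans_le
      (ENNReal.ofReal_le_ofReal ((min_le_right _ _).trans (min_le_right _ _)))⟩
  -- `y₀` is the parameter of the orbit of `y` at the time when the pseudo orbit has reached the orbit
  -- of `v`.
  have hx1 := hgs n₀ (chainTime t n₀) ⟨le_rfl, by rw [chainTime_succ]; linarith [ht1 n₀]⟩
  rw [sub_self, flow_zero] at hx1
  set x := flow Z (g (chainTime t n₀)) y with hx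
  obtain ⟨hxN, hxw⟩ := hε₁' (w n₀) (hwb0 _) x
    (hx1.trans_le (ENNReal.ofReal_le_ofReal (min_le_left _ _)))
  obtain ⟨s₀, hs₀⟩ := hPrf x hxN
  set y₀ := Pr x with hy₀
  rw [hx, ← flow_add] at hs₀
  set a := s₀ + g (chainTime t n₀) with ha
  have hO : ∀ u, ‖u‖ ≤ b → q u ∈ orbit Z y → ‖u‖ < b' := by
    rintro u hu ⟨s, hs⟩
    refine hδ₁' u hu ?_
    rw [← hs]
    exact hy1 s
  have hwn0 : ‖w n₀‖ ≤ b' / 2 := by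
    have := (hwβ n₀ 0).trans (min_le_right _ _)
    simpa [one_equiv_apply] using this
  have hy₀b : ‖y₀‖ ≤ b' := by
    have h1 := norm_le_insert' y₀ (w n₀)
    have h2 : ζ ≤ b' / 2 := min_le_left _ _
    linarith
  have hLy : ∀ k : ℤ, ‖(L ^ k) y₀‖ ≤ b' := h.zpow_norm_le hb'b hLb hO
    (by
      rintro _ ⟨s, rfl⟩ s'
      exact ⟨s' + s, flow_add Z s' s y⟩) hy₀b ⟨a, hs₀⟩
  have hbound : y₀ ∈ boundedOrbits L := ⟨b', hLy⟩
  -- After `k₀` returns back the orbit of `y` is at negative times; recurrence then bounds `y₀`.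
  obtain ⟨k₀, hk₀⟩ := exists_nat_gt (a / τ₀)
  have hyζ : ‖y₀‖ ≤ ζ := by
    refine norm_le_of_eventually_backward L hbound (k₀ := k₀) fun k hk => ?_
    set u := (L ^ (-(k : ℤ))) y₀ with hu
    have hub : ∀ j : ℕ, ‖(L ^ j) u‖ ≤ b := fun j => by
      have := (hLy (j + -k)).trans hb'b
      rwa [zpow_apply_add, zpow_natCast] at this
    have hub0 : ‖u‖ ≤ b := by simpa [one_equiv_apply] using hub 0
    have e : (L ^ k) u = y₀ := by
      rw [hu, ← zpow_natCast, ← zpow_apply_add, add_neg_cancel, zpow_zero,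
        one_equiv_apply]
    have h1 := h.flow_sum_time (m := k) hub
    rw [e, ← hs₀] at h1
    set T := ∑ j ∈ Finset.range k, τ ((L ^ j) u)
    have hT : k * τ₀ ≤ T := by
      have h1 : ∑ j ∈ Finset.range k, τ₀ ≤ T :=
        Finset.sum_le_sum fun j _ => h.le_time _ (hub j)
      rwa [Finset.sum_const, Finset.card_range, nsmul_eq_mul] at h1
    have h2 : q u = flow Z (-T + a) y := by
      rw [flow_add, ← h1, flow_neg_flow]
    refine (hδ₂' u hub0 ?_).le
    rw [h2]
    refine hy2 _ ?_
    have h3 : a < k * τ₀ := by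
      have h4 : a / τ₀ < k := hk₀.trans_le (by exact_mod_cast hk)
      rwa [div_lt_iff₀ h.time_pos] at h4
    linarith
  have h5 : ‖w n₀‖ < 2 * ζ := by
    have := norm_sub_norm_le (w n₀) y₀
    rw [norm_sub_rev] at this
    linarith
  -- Pulled back along its bounded orbit, `w n₀` is `v`, which is too large.
  have h6 := hC (w n₀) (by rw [hwn]; exact zpow_mem_boundedOrbits hvB _) (-((m * n₀ : ℕ) : ℤ))
  rw [hwn, ← zpow_apply_add, neg_add_cancel, zpow_zero, one_equiv_apply, ← hwn] at h6
  nlinarith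

end IsLinearSection

end LinearSection

/-! ### The tangent flow -/

section TangentFlow

variable {n : ℕ} {M : Type*} [TopologicalSpace M] [ChartedSpace (EuclideanSpace ℝ (Fin n)) M]
  [IsManifold (𝓡 n) ∞ M]

/-- The derivative of the time-`t` map at `x`. All tangent spaces of `M` are copies of the model
space, and reading the derivative as an endomorphism of it avoids transport between tangent
spaces at points which are equal, but not by definition. -/
noncomputable def tangentFlow (X : C1VectorField n M) (t : ℝ) (x : M) :
    EuclideanSpace ℝ (Fin n) →L[ℝ] EuclideanSpace ℝ (Fin n) :=
  mfderiv (𝓡 n) (𝓡 n) (flow X t) x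

/-- The value of a vector field at `x`, as an element of the model space. -/
noncomputable def fieldAt (X : C1VectorField n M) (x : M) : EuclideanSpace ℝ (Fin n) := X x

variable [T2Space M] [CompactSpace M]

theorem hasMFDerivAt_flow (X : C1VectorField n M) (t : ℝ) (x : M) :
    HasMFDerivAt (𝓡 n) (𝓡 n) (flow X t) x (tangentFlow X t x) :=
  ((contMDiff_flow_time X t).mdifferentiable one_ne_zero x).hasMFDerivAt

theorem tangentFlow_zero (X : C1VectorField n M) (x : M) :
    tangentFlow X 0 x = ContinuousLinearMap.id ℝ _ := by
  have h : flow X 0 = id := funext fun x => flow_zero X x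
  rw [tangentFlow, h]
  exact mfderiv_id

theorem tangentFlow_add (X : C1VectorField n M) (s t : ℝ) (x : M) :
    tangentFlow X (s + t) x = (tangentFlow X s (flow X t x)).comp (tangentFlow X t x) := by
  have h : flow X (s + t) = flow X s ∘ flow X t := funext fun x => flow_add X s t x
  have h1 := ((hasMFDerivAt_flow X s (flow X t x)).comp x (hasMFDerivAt_flow X t x)).mfderiv
  rw [tangentFlow, h]
  exact h1

theorem tangentFlow_add_apply (X : C1VectorField n M) (s t : ℝ) (x : M)
    (v : EuclideanSpace ℝ (Fin n)) :
    tangentFlow X (s + t) x v = tangentFlow X s (flow X t x) (tangentFlow X t x v) := by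
  rw [tangentFlow_add]; rfl

theorem tangentFlow_neg_apply (X : C1VectorField n M) (t : ℝ) (x : M)
    (v : EuclideanSpace ℝ (Fin n)) :
    tangentFlow X (-t) (flow X t x) (tangentFlow X t x v) = v := by
  rw [← tangentFlow_add_apply, neg_add_cancel, tangentFlow_zero]; rfl

theorem tangentFlow_apply_neg (X : C1VectorField n M) (t : ℝ) (x : M)
    (v : EuclideanSpace ℝ (Fin n)) :
    tangentFlow X t x (tangentFlow X (-t) (flow X t x) v) = v := by
  have := tangentFlow_neg_apply X (-t) (flow X t x) v
  rwa [neg_neg, flow_neg_flow] at this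

/-- The tangent flow preserves the vector field. -/
theorem tangentFlow_fieldAt (X : C1VectorField n M) (t : ℝ) (x : M) :
    tangentFlow X t x (fieldAt X x) = fieldAt X (flow X t x) := by
  have h1 := (hasMFDerivAt_flow X t (flow X 0 x)).comp (0 : ℝ) (isMIntegralCurve_flow X x 0)
  have h2 := isMIntegralCurve_flow X (flow X t x) 0
  have h3 : (flow X t ∘ fun s => flow X s x) = fun s => flow X s (flow X t x) := by
    funext s
    change flow X t (flow X s x) = flow X s (flow X t x)
    rw [← flow_add, ← flow_add, add_comm]
  rw [h3] at h1
  have h4 : tangentFlow X t (flow X 0 x) ((1 : ℝ) • fieldAt X (flow X 0 x)) =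
      (1 : ℝ) • fieldAt X (flow X 0 (flow X t x)) :=
    DFunLike.congr_fun (hasMFDerivAt_unique h1 h2) (1 : ℝ)
  rwa [one_smul, one_smul, flow_zero, flow_zero] at h4

/-- The time-`t` tangent map at a point, as an automorphism of the model space. -/
noncomputable def tangentFlowEquiv (X : C1VectorField n M) (t : ℝ) (x : M) :
    EuclideanSpace ℝ (Fin n) ≃L[ℝ] EuclideanSpace ℝ (Fin n) :=
  ContinuousLinearEquiv.equivOfInverse (tangentFlow X t x) (tangentFlow X (-t) (flow X t x))
    (tangentFlow_neg_apply X t x) (tangentFlow_apply_neg X t x)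

theorem continuous_tangentFlow (X : C1VectorField n M) (x : M) :
    Continuous (fun q : ℝ × EuclideanSpace ℝ (Fin n) =>
      (⟨flow X q.1 x, tangentFlow X q.1 x q.2⟩ : TangentBundle (𝓡 n) M)) := by
  have h1 := (contMDiff_flow X).continuous_tangentMap le_rfl
  have h2 : Continuous (equivTangentBundleProd 𝓘(ℝ, ℝ) ℝ (𝓡 n) M).symm :=
    (contMDiff_equivTangentBundleProd_symm (n := 0)).continuous
  have h3 : Continuous (fun s : ℝ => (⟨s, 0⟩ : TangentBundle 𝓘(ℝ, ℝ) ℝ)) :=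
    (contMDiff_zeroSection ℝ (TangentSpace 𝓘(ℝ, ℝ) : ℝ → Type _) (n := 0)
      (IB := 𝓘(ℝ, ℝ)) (F := ℝ)).continuous
  have h4 : Continuous (fun v : EuclideanSpace ℝ (Fin n) => (⟨x, v⟩ : TangentBundle (𝓡 n) M)) :=
    FiberBundle.continuous_totalSpaceMk (EuclideanSpace ℝ (Fin n))
      (TangentSpace (𝓡 n) : M → Type _) x
  have h5 := h1.comp (h2.comp ((h3.comp continuous_fst).prodMk (h4.comp continuous_snd)))
  refine h5.congr fun q => ?_
  have h6 : HasMFDerivAt (𝓘(ℝ, ℝ).prod (𝓡 n)) (𝓡 n) (fun q : ℝ × M => flow X q.1 q.2) (q.1, x)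
      (mfderiv (𝓘(ℝ, ℝ).prod (𝓡 n)) (𝓡 n) (fun q : ℝ × M => flow X q.1 q.2) (q.1, x)) :=
    ((contMDiff_flow X).mdifferentiable one_ne_zero _).hasMFDerivAt
  have h7 : HasMFDerivAt (𝓡 n) (𝓘(ℝ, ℝ).prod (𝓡 n)) (fun y : M => (q.1, y)) x
      (ContinuousLinearMap.inr ℝ ℝ (EuclideanSpace ℝ (Fin n))) :=
    (hasMFDerivAt_const (I := 𝓡 n) (I' := 𝓘(ℝ, ℝ)) q.1 x).prodMk (hasMFDerivAt_id x)
  have h8 := hasMFDerivAt_unique (HasMFDerivAt.comp x h6 h7) (hasMFDerivAt_flow X q.1 x)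
  have h9 := DFunLike.congr_fun h8 q.2
  exact congrArg (fun v : EuclideanSpace ℝ (Fin n) =>
    (⟨flow X q.1 x, v⟩ : TangentBundle (𝓡 n) M)) h9

variable [RiemannianBundle (fun x : M => TangentSpace (𝓡 n) x)]

/-- The Riemannian norm at `x` of a tangent vector given as an element of the model space. -/
noncomputable def fiberNorm (x : M) (v : EuclideanSpace ℝ (Fin n)) : ℝ :=
  ‖(show TangentSpace (𝓡 n) x from v)‖

theorem fiberNorm_smul (x : M) (c : ℝ) (v : EuclideanSpace ℝ (Fin n)) :
    fiberNorm x (c • v) = |c| * fiberNorm x v :=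
  norm_smul c (show TangentSpace (𝓡 n) x from v)

theorem fiberNorm_pos (x : M) {v : EuclideanSpace ℝ (Fin n)} (hv : v ≠ 0) : 0 < fiberNorm x v :=
  norm_pos_iff.2 (show (show TangentSpace (𝓡 n) x from v) ≠ 0 from hv)

theorem continuous_fiberNorm_tangentFlow [IsContMDiffRiemannianBundle (𝓡 n) ∞ (EuclideanSpace ℝ (Fin n))
      (fun x : M => TangentSpace (𝓡 n) x)] (X : C1VectorField n M) (x : M) :
    Continuous (fun q : ℝ × EuclideanSpace ℝ (Fin n) =>
      fiberNorm (flow X q.1 x) (tangentFlow X q.1 x q.2)) := by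
  have : IsContinuousRiemannianBundle (EuclideanSpace ℝ (Fin n))
      (TangentSpace (𝓡 n) : M → Type _) := by
    obtain ⟨g, hg, hg'⟩ := IsContMDiffRiemannianBundle.exists_contMDiff (IB := 𝓡 n) (n := ∞)
      (F := EuclideanSpace ℝ (Fin n)) (E := fun x : M => TangentSpace (𝓡 n) x)
    exact ⟨g, hg.continuous, hg'⟩
  have h1 := Continuous.inner_bundle (continuous_tangentFlow X x) (continuous_tangentFlow X x)
  have h2 := Real.continuous_sqrt.comp h1
  refine h2.congr fun q => ?_
  exact (norm_eq_sqrt_real_inner _).symm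

/-- Over a compact time interval the tangent flow distorts norms by bounded factors. -/
theorem exists_fiberNorm_tangentFlow_bounds [IsContMDiffRiemannianBundle (𝓡 n) ∞
      (EuclideanSpace ℝ (Fin n)) (fun x : M => TangentSpace (𝓡 n) x)]
    (X : C1VectorField n M) (x : M) (T : ℝ) :
    ∃ a A : ℝ, 0 < a ∧ 0 < A ∧ ∀ s ∈ Icc 0 T, ∀ v,
      a * ‖v‖ ≤ fiberNorm (flow X s x) (tangentFlow X s x v) ∧
      fiberNorm (flow X s x) (tangentFlow X s x v) ≤ A * ‖v‖ := by
  set g : ℝ × EuclideanSpace ℝ (Fin n) → ℝ :=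
    fun q => fiberNorm (flow X q.1 x) (tangentFlow X q.1 x q.2) with hg
  have hgc : Continuous g := continuous_fiberNorm_tangentFlow X x
  have hK : IsCompact (Icc 0 T ×ˢ Metric.sphere (0 : EuclideanSpace ℝ (Fin n)) 1) :=
    isCompact_Icc.prod (isCompact_sphere _ _)
  have hpos : ∀ q ∈ Icc 0 T ×ˢ Metric.sphere (0 : EuclideanSpace ℝ (Fin n)) 1, 0 < g q := by
    intro q hq
    refine fiberNorm_pos _ fun h0 => ?_
    have h1 := tangentFlow_neg_apply X q.1 x q.2
    rw [h0, map_zero] at h1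
    have h2 : ‖q.2‖ = 1 := by simpa using hq.2
    rw [← h1, norm_zero] at h2
    exact zero_ne_one h2
  obtain ⟨a, ha, haK⟩ : ∃ a > 0, ∀ q ∈ Icc 0 T ×ˢ Metric.sphere (0 : EuclideanSpace ℝ (Fin n)) 1,
      a ≤ g q := by
    rcases (Icc 0 T ×ˢ Metric.sphere (0 : EuclideanSpace ℝ (Fin n)) 1).eq_empty_or_nonempty
      with h | h
    · exact ⟨1, one_pos, by simp [h]⟩
    · obtain ⟨q, hq, hm⟩ := hK.exists_isMinOn h hgc.continuousOn
      exact ⟨g q, hpos q hq, fun q' hq' => hm hq'⟩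
  obtain ⟨A, hA⟩ := hK.exists_bound_of_continuousOn hgc.continuousOn
  refine ⟨a, |A| + 1, ha, by positivity, fun s hs v => ?_⟩
  rcases eq_or_ne v 0 with rfl | hv
  · have : fiberNorm (flow X s x) (tangentFlow X s x 0) = 0 := by
      rw [map_zero]
      exact norm_zero (E := TangentSpace (𝓡 n) (flow X s x))
    rw [this]; simp
  · have hv0 : 0 < ‖v‖ := norm_pos_iff.2 hv
    have hmem : (s, ‖v‖⁻¹ • v) ∈ Icc 0 T ×ˢ Metric.sphere (0 : EuclideanSpace ℝ (Fin n)) 1 :=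
      ⟨hs, by simp [norm_smul, hv0.ne']⟩
    have e : fiberNorm (flow X s x) (tangentFlow X s x v) = ‖v‖ * g (s, ‖v‖⁻¹ • v) := by
      rw [hg]
      beta_reduce
      rw [map_smul, fiberNorm_smul, abs_of_pos (by positivity), ← mul_assoc,
        mul_inv_cancel₀ hv0.ne', one_mul]
    rw [e, mul_comm a, mul_comm (|A| + 1)]
    have h1 := haK _ hmem
    have h2 := (le_abs_self _).trans (hA _ hmem)
    have h3 := le_abs_self A
    exact ⟨by gcongr, by gcongr; linarith⟩

end TangentFlow

/-! ### Hyperbolicity of closed orbits from the linear return map -/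

section Hyperbolicity

variable {n : ℕ} {M : Type*} [TopologicalSpace M] [ChartedSpace (EuclideanSpace ℝ (Fin n)) M]
  [IsManifold (𝓡 n) ∞ M]

/-- The tangent vectors at `x` which are contracted to `0` by the iterates of the time-`T` tangent
map. For a point of period `T > 0` this is the stable space; the unstable space is obtained by
taking `-T` for `T`. -/
noncomputable def contractedSpace (X : C1VectorField n M) (T : ℝ) (x : M) :
    Submodule ℝ (EuclideanSpace ℝ (Fin n)) where
  carrier := {v | Tendsto (fun k : ℕ => tangentFlow X (k * T) x v) atTop (𝓝 0)}
  zero_mem' := by simp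
  add_mem' := by
    intro v w hv hw
    simpa using Tendsto.add hv hw
  smul_mem' := by
    intro c v hv
    simpa using Tendsto.const_smul hv c

theorem mem_contractedSpace {X : C1VectorField n M} {T : ℝ} {x : M}
    {v : EuclideanSpace ℝ (Fin n)} : v ∈ contractedSpace X T x ↔
      Tendsto (fun k : ℕ => tangentFlow X (k * T) x v) atTop (𝓝 0) := Iff.rfl

variable [T2Space M] [CompactSpace M] {X : C1VectorField n M} {T : ℝ} {x p : M}

theorem flow_nat_mul_period (hx : flow X T x = x) (k : ℕ) : flow X (k * T) x = x := by
  induction k with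
  | zero => simp [flow_zero]
  | succ k ih =>
    push_cast
    rw [add_mul, one_mul, flow_add, hx, ih]

theorem flow_neg_period (hx : flow X T x = x) : flow X (-T) x = x := by
  conv_lhs => rw [← hx]
  exact flow_neg_flow X T x

theorem flow_period_flow (hx : flow X T x = x) (s : ℝ) : flow X T (flow X s x) = flow X s x := by
  rw [← flow_add, add_comm, flow_add, hx]

theorem tangentFlow_mem_contractedSpace (hx : flow X T x = x) (s : ℝ)
    {v : EuclideanSpace ℝ (Fin n)} (hv : v ∈ contractedSpace X T x) :
    tangentFlow X s x v ∈ contractedSpace X T (flow X s x) := by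
  rw [mem_contractedSpace] at hv ⊢
  have h1 := ((tangentFlow X s x).continuous.tendsto 0).comp hv
  rw [map_zero] at h1
  refine h1.congr fun k => ?_
  change tangentFlow X s x (tangentFlow X (k * T) x v) = _
  rw [← tangentFlow_add_apply, add_comm, tangentFlow_add_apply, flow_nat_mul_period hx]

theorem tangentFlowEquiv_apply (v : EuclideanSpace ℝ (Fin n)) :
    tangentFlowEquiv X T x v = tangentFlow X T x v := rfl

theorem tangentFlowEquiv_pow_apply (hx : flow X T x = x) (k : ℕ)
    (v : EuclideanSpace ℝ (Fin n)) :
    (tangentFlowEquiv X T x ^ k) v = tangentFlow X (k * T) x v := by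
  induction k with
  | zero => rw [pow_zero, Nat.cast_zero, zero_mul, tangentFlow_zero]; rfl
  | succ k ih =>
    rw [add_comm, pow_apply_add, pow_one, ih, tangentFlowEquiv_apply]
    push_cast
    rw [add_mul, one_mul, tangentFlow_add_apply, flow_nat_mul_period hx]

theorem tangentFlowEquiv_inv (hx : flow X T x = x) :
    (tangentFlowEquiv X T x)⁻¹ = tangentFlowEquiv X (-T) x := by
  ext1
  funext v
  change tangentFlow X (-T) (flow X T x) v = tangentFlow X (-T) x v
  rw [hx]

theorem stableSpace_tangentFlowEquiv (hx : flow X T x = x) :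
    stableSpace (tangentFlowEquiv X T x) = contractedSpace X T x := by
  ext v
  rw [mem_stableSpace, mem_contractedSpace]
  simp only [tangentFlowEquiv_pow_apply hx]

theorem map_tangentFlow_contractedSpace (hx : flow X T x = x) (s : ℝ) :
    (contractedSpace X T x).map (tangentFlow X s x).toLinearMap =
      contractedSpace X T (flow X s x) := by
  ext w
  rw [Submodule.mem_map]
  constructor
  · rintro ⟨v, hv, rfl⟩
    exact tangentFlow_mem_contractedSpace hx s hv
  · intro hw
    refine ⟨tangentFlow X (-s) (flow X s x) w, ?_, tangentFlow_apply_neg X s x w⟩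
    have := tangentFlow_mem_contractedSpace (flow_period_flow hx s) (-s) hw
    rwa [flow_neg_flow] at this

/-- Along a closed orbit, whose transverse return map is conjugate to a linear map `L` without
nonzero bounded orbits, the tangent spaces split. -/
theorem isInternal_contractedSpace {F : Type*} [NormedAddCommGroup F] [NormedSpace ℝ F]
    [FiniteDimensional ℝ F] (hp : flow X T p = p) (L : F ≃L[ℝ] F) (P : EuclideanSpace ℝ (Fin n) →L[ℝ] F)
    (hP : Function.Surjective P) (hker : ∀ v, P v = 0 ↔ v ∈ Submodule.span ℝ {fieldAt X p})
    (hPD : ∀ v, P (tangentFlow X T p v) = L (P v)) (hL : boundedOrbits L = ⊥)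
    (hx : x ∈ orbit X p) :
    DirectSum.IsInternal ![contractedSpace X T x, Submodule.span ℝ {fieldAt X x},
      contractedSpace X (-T) x] := by
  obtain ⟨s, rfl⟩ := hx
  change DirectSum.IsInternal ![contractedSpace X T (flow X s p),
    Submodule.span ℝ {fieldAt X (flow X s p)}, contractedSpace X (-T) (flow X s p)]
  have hps := flow_period_flow hp s
  rw [← stableSpace_tangentFlowEquiv hps, ← stableSpace_tangentFlowEquiv (flow_neg_period hps),
    ← tangentFlowEquiv_inv hps]
  refine isInternal_stable_fixed_unstable _ L (P.comp (tangentFlow X (-s) (flow X s p)))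
    (fieldAt X (flow X s p)) ?_ ?_ ?_ ?_ hL
  · intro w
    obtain ⟨v, rfl⟩ := hP w
    exact ⟨tangentFlow X s p v, by
      change P (tangentFlow X (-s) (flow X s p) (tangentFlow X s p v)) = P v
      rw [tangentFlow_neg_apply]⟩
  · intro v
    change P (tangentFlow X (-s) (flow X s p) v) = 0 ↔ _
    rw [hker, Submodule.mem_span_singleton, Submodule.mem_span_singleton]
    constructor
    · rintro ⟨c, hc⟩
      refine ⟨c, ?_⟩
      rw [← tangentFlow_fieldAt, ← map_smul, hc, tangentFlow_apply_neg]
    · rintro ⟨c, rfl⟩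
      refine ⟨c, ?_⟩
      rw [map_smul, tangentFlow_fieldAt, flow_neg_flow]
  · rw [tangentFlowEquiv_apply, tangentFlow_fieldAt, hps]
  · intro v
    change P (tangentFlow X (-s) (flow X s p) (tangentFlow X T (flow X s p) v)) = _
    refine Eq.trans ?_ (hPD (tangentFlow X (-s) (flow X s p) v))
    have h1 := tangentFlow_add_apply X (-s) T (flow X s p) v
    have h2 := tangentFlow_add_apply X T (-s) (flow X s p) v
    rw [hps] at h1
    rw [flow_neg_flow] at h2
    rw [← h1, ← h2, add_comm]

theorem orbit_subset_image_Icc (hT : 0 < T) (hp : flow X T p = p) (hx : x ∈ orbit X p) :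
    ∃ s ∈ Icc 0 T, flow X s p = x := by
  have hper : Function.Periodic (fun t => flow X t p) T := fun t => by
    change flow X (t + T) p = flow X t p
    rw [flow_add, hp]
  have h := hper.image_Icc hT 0
  rw [zero_add] at h
  change x ∈ range (fun t => flow X t p) at hx
  rw [← h] at hx
  exact hx

theorem isInvariant_orbit (X : C1VectorField n M) (p : M) : IsInvariant X (orbit X p) := by
  intro t
  apply Set.Subset.antisymm
  · rintro _ ⟨_, ⟨s, rfl⟩, rfl⟩
    exact ⟨t + s, flow_add X t s p⟩
  · rintro _ ⟨s, rfl⟩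
    exact ⟨flow X (s - t) p, ⟨s - t, rfl⟩, by rw [← flow_add, add_sub_cancel]⟩

/-- The contracted spaces have a continuous frame near each point of a closed orbit, obtained by
moving a basis with the tangent flow. -/
theorem isContinuousSubbundleOn_contractedSpace {T' : ℝ} (hp : flow X T' p = p)
    (harc : ∀ x₀ ∈ orbit X p, ∃ t : M → ℝ, ∀ᶠ x in 𝓝[orbit X p] x₀,
      ContinuousWithinAt t (orbit X p) x ∧ flow X (t x) x₀ = x) :
    IsContinuousSubbundleOn (orbit X p) (fun x => contractedSpace X T' x) := by
  intro x₀ hx₀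
  obtain ⟨t, ht⟩ := harc x₀ hx₀
  have hx₀p : flow X T' x₀ = x₀ := by
    obtain ⟨s, rfl⟩ := hx₀
    exact flow_period_flow hp s
  let b := Module.finBasis ℝ (contractedSpace X T' x₀)
  refine ⟨_, fun i x => tangentFlow X (t x) x₀ (b i), ?_⟩
  filter_upwards [ht, eventually_eventually_nhdsWithin.2 ht, self_mem_nhdsWithin]
    with x hx hx' hxΛ
  have hinj : Function.Injective (tangentFlow X (t x) x₀) := fun v w hvw => by
    rw [← tangentFlow_neg_apply X (t x) x₀ v, hvw, tangentFlow_neg_apply]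
  refine ⟨fun i => ?_, ?_, ?_⟩
  · have h1 : ContinuousWithinAt (fun y => (t y, ((b i : contractedSpace X T' x₀) :
        EuclideanSpace ℝ (Fin n)))) (orbit X p) x := hx.1.prodMk continuousWithinAt_const
    have h2 := (continuous_tangentFlow X x₀).continuousAt.comp_continuousWithinAt h1
    refine h2.congr_of_eventuallyEq ?_ ?_
    · filter_upwards [hx'] with y hy
      change (⟨y, _⟩ : TangentBundle (𝓡 n) M) = ⟨flow X (t y) x₀, _⟩
      rw [hy.2]
    · change (⟨x, _⟩ : TangentBundle (𝓡 n) M) = ⟨flow X (t x) x₀, _⟩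
      rw [hx.2]
  · have h1 : LinearIndependent ℝ (fun i => ((b i : contractedSpace X T' x₀) :
        EuclideanSpace ℝ (Fin n))) :=
      b.linearIndependent.map' (contractedSpace X T' x₀).subtype (Submodule.ker_subtype _)
    exact h1.map' (tangentFlow X (t x) x₀).toLinearMap (LinearMap.ker_eq_bot.2 hinj)
  · have h1 : Submodule.span ℝ (range fun i => ((b i : contractedSpace X T' x₀) :
        EuclideanSpace ℝ (Fin n))) = contractedSpace X T' x₀ := by
      have := congrArg (Submodule.map (contractedSpace X T' x₀).subtype) b.span_eq
      rw [Submodule.map_span, Submodule.map_subtype_top, ← range_comp] at this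
      exact this
    have h2 := congrArg (Submodule.map (tangentFlow X (t x) x₀).toLinearMap) h1
    rw [map_tangentFlow_contractedSpace hx₀p, hx.2, Submodule.map_span, ← range_comp] at h2
    exact h2

variable [RiemannianBundle (fun x : M => TangentSpace (𝓡 n) x)]
  [IsContMDiffRiemannianBundle (𝓡 n) ∞ (EuclideanSpace ℝ (Fin n))
      (fun x : M => TangentSpace (𝓡 n) x)]

/-- Uniform exponential contraction of the contracted space; `T'` is `T` or `-T`. -/
theorem exists_contraction_rate (hT : 0 < T) {T' : ℝ} (hp : flow X T' p = p) :
    ∃ C lam : ℝ, 0 < C ∧ 0 < lam ∧ ∀ v ∈ contractedSpace X T' p, ∀ (k : ℕ) (r t : ℝ),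
      r ∈ Icc 0 T → t / T - 1 ≤ k →
      fiberNorm (flow X (r + k * T') p) (tangentFlow X (r + k * T') p v) ≤
        C * Real.exp (-lam * t) * ‖v‖ := by
  obtain ⟨a, A, -, hA, hbd⟩ := exists_fiberNorm_tangentFlow_bounds X p T
  obtain ⟨C, θ, hC, hθ, hθ1, hst⟩ := stableSpace_uniform (tangentFlowEquiv X T' p)
  have hlog : 0 < -Real.log θ := neg_pos.2 (Real.log_neg hθ hθ1)
  refine ⟨A * (C * θ⁻¹), -Real.log θ / T, by positivity, by positivity, ?_⟩
  intro v hv k r t hr hk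
  rw [tangentFlow_add_apply, flow_add, flow_nat_mul_period hp]
  refine ((hbd r hr _).2).trans ?_
  rw [← stableSpace_tangentFlowEquiv hp] at hv
  have h1 := hst v hv k
  rw [tangentFlowEquiv_pow_apply hp] at h1
  have h2 : θ ^ k ≤ θ⁻¹ * Real.exp (-(-Real.log θ / T) * t) := by
    have e1 : θ ^ k = Real.exp (k * Real.log θ) := by
      rw [Real.exp_nat_mul, Real.exp_log hθ]
    have e2 : θ⁻¹ = Real.exp (-Real.log θ) := by rw [Real.exp_neg, Real.exp_log hθ]
    rw [e1, e2, ← Real.exp_add]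
    refine Real.exp_le_exp.2 ?_
    have e3 : -Real.log θ + -(-Real.log θ / T) * t = (t / T - 1) * Real.log θ := by
      field_simp; ring
    rw [e3]
    nlinarith
  calc A * ‖tangentFlow X (k * T') p v‖ ≤ A * (C * θ ^ k * ‖v‖) := by gcongr
    _ ≤ A * (C * (θ⁻¹ * Real.exp (-(-Real.log θ / T) * t)) * ‖v‖) := by gcongr
    _ = _ := by ring

/-- A closed orbit (or a singularity) whose transverse return map is conjugate to a linear map
without nonzero bounded orbits is hyperbolic. -/
theorem isHyperbolic_orbit {F : Type*} [NormedAddCommGroup F] [NormedSpace ℝ F]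
    [FiniteDimensional ℝ F] (hT : 0 < T) (hp : flow X T p = p)
    (harc : ∀ x₀ ∈ orbit X p, ∃ t : M → ℝ, ∀ᶠ x in 𝓝[orbit X p] x₀,
      ContinuousWithinAt t (orbit X p) x ∧ flow X (t x) x₀ = x)
    (L : F ≃L[ℝ] F) (P : EuclideanSpace ℝ (Fin n) →L[ℝ] F)
    (hP : Function.Surjective P) (hker : ∀ v, P v = 0 ↔ v ∈ Submodule.span ℝ {fieldAt X p})
    (hPD : ∀ v, P (tangentFlow X T p v) = L (P v)) (hL : boundedOrbits L = ⊥) :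
    IsHyperbolic X (orbit X p) := by
  have hper : ∀ x ∈ orbit X p, flow X T x = x := by
    rintro _ ⟨s, rfl⟩
    exact flow_period_flow hp s
  have hc : IsCompact (orbit X p) := by
    have : orbit X p = (fun s => flow X s p) '' Icc 0 T := by
      refine Set.Subset.antisymm (fun x hx => orbit_subset_image_Icc hT hp hx) ?_
      rintro _ ⟨s, -, rfl⟩
      exact ⟨s, rfl⟩
    rw [this]
    exact isCompact_Icc.image (continuous_flow_orbit X p)
  refine ⟨hc, isInvariant_orbit X p, fun x => contractedSpace X T x,
    fun x => contractedSpace X (-T) x, isContinuousSubbundleOn_contractedSpace hp harc,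
    isContinuousSubbundleOn_contractedSpace (flow_neg_period hp) harc,
    fun x hx t => map_tangentFlow_contractedSpace (hper x hx) t,
    fun x hx t => map_tangentFlow_contractedSpace (flow_neg_period (hper x hx)) t,
    fun x hx => isInternal_contractedSpace hp L P hP hker hPD hL hx, ?_⟩
  obtain ⟨a, A, ha, -, hbd⟩ := exists_fiberNorm_tangentFlow_bounds X p T
  obtain ⟨C₁, l₁, hC₁, hl₁, h1⟩ := exists_contraction_rate hT hp
  obtain ⟨C₂, l₂, hC₂, hl₂, h2⟩ := exists_contraction_rate hT (flow_neg_period hp)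
  refine ⟨max C₁ C₂ / a, by positivity, min l₁ l₂, lt_min hl₁ hl₂, fun x hx t ht => ?_⟩
  obtain ⟨s, hs, rfl⟩ := orbit_subset_image_Icc hT hp hx
  have hnorm : ∀ w, ‖tangentFlow X (-s) (flow X s p) w‖ ≤ fiberNorm (flow X s p) w / a := by
    intro w
    have := (hbd s hs (tangentFlow X (-s) (flow X s p) w)).1
    rw [tangentFlow_apply_neg] at this
    rw [le_div_iff₀ ha, mul_comm]
    exact this
  have hfin : ∀ (C l : ℝ) (w : EuclideanSpace ℝ (Fin n)), 0 < C → C ≤ max C₁ C₂ → min l₁ l₂ ≤ l →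
      C * Real.exp (-l * t) * ‖tangentFlow X (-s) (flow X s p) w‖ ≤
        max C₁ C₂ / a * Real.exp (-min l₁ l₂ * t) * fiberNorm (flow X s p) w := by
    intro C l w hC0 hC hl
    calc C * Real.exp (-l * t) * ‖tangentFlow X (-s) (flow X s p) w‖
        ≤ max C₁ C₂ * Real.exp (-min l₁ l₂ * t) * (fiberNorm (flow X s p) w / a) := by
          gcongr
          exact hnorm w
      _ = _ := by ring
  have hmem : ∀ T', flow X T' p = p → ∀ w ∈ contractedSpace X T' (flow X s p),
      tangentFlow X (-s) (flow X s p) w ∈ contractedSpace X T' p := by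
    intro T' hT' w hw
    have := tangentFlow_mem_contractedSpace (flow_period_flow hT' s) (-s) hw
    rwa [flow_neg_flow] at this
  have hmove : ∀ (u : ℝ) (w : EuclideanSpace ℝ (Fin n)),
      fiberNorm (flow X u (flow X s p)) (tangentFlow X u (flow X s p) w) =
      fiberNorm (flow X (u + s) p)
        (tangentFlow X (u + s) p (tangentFlow X (-s) (flow X s p) w)) := by
    intro u w
    rw [tangentFlow_add_apply, tangentFlow_apply_neg, flow_add]
  constructor
  · intro (w : EuclideanSpace ℝ (Fin n)) hw
    have hk1 := Nat.floor_le (a := (t + s) / T) (by have := hs.1; positivity)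
    have hk2 := Nat.lt_floor_add_one ((t + s) / T)
    set k := ⌊(t + s) / T⌋₊
    rw [le_div_iff₀ hT] at hk1
    have hst : t / T ≤ (t + s) / T := by have := hs.1; gcongr; linarith
    have hk3 := (div_lt_iff₀ hT).1 hk2
    have key := h1 _ (hmem T hp w hw) k (t + s - k * T) t ⟨by linarith, by linarith⟩ (by linarith)
    rw [sub_add_cancel] at key
    exact ((hmove t w).le.trans key).trans (hfin C₁ l₁ w hC₁ (le_max_left _ _) (min_le_left _ _))
  · intro (w : EuclideanSpace ℝ (Fin n)) hw
    have hk1 := Nat.le_ceil ((t - s) / T)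
    have hk2 : (⌈(t - s) / T⌉₊ : ℝ) * T ≤ T + max 0 (t - s) - s + s := by
      rcases le_or_gt t s with h | h
      · have : ⌈(t - s) / T⌉₊ = 0 :=
          Nat.ceil_eq_zero.2 (div_nonpos_of_nonpos_of_nonneg (by linarith) hT.le)
        rw [this, max_eq_left (by linarith)]
        simp [hT.le]
      · have h3 := Nat.ceil_lt_add_one (a := (t - s) / T) (by
          have : 0 < t - s := by linarith
          positivity)
        rw [max_eq_right (by linarith)]
        have h4 : (⌈(t - s) / T⌉₊ : ℝ) * T ≤ ((t - s) / T + 1) * T := by gcongr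
        rw [add_mul, div_mul_cancel₀ _ hT.ne'] at h4
        linarith
    have hk4 : (t - s) ≤ (⌈(t - s) / T⌉₊ : ℝ) * T := by rwa [div_le_iff₀ hT] at hk1
    have hk5 : s - t + (⌈(t - s) / T⌉₊ : ℝ) * T ≤ T := by
      rcases le_or_gt t s with h | h
      · have : ⌈(t - s) / T⌉₊ = 0 :=
          Nat.ceil_eq_zero.2 (div_nonpos_of_nonpos_of_nonneg (by linarith) hT.le)
        rw [this]
        simp only [Nat.cast_zero, zero_mul, add_zero]
        linarith [hs.2]
      · rw [max_eq_right (by linarith)] at hk2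
        linarith
    set k := ⌈(t - s) / T⌉₊
    have hst : t / T - 1 ≤ (t - s) / T := by
      rw [sub_div]
      have : s / T ≤ 1 := (div_le_one hT).2 hs.2
      linarith
    have key := h2 _ (hmem (-T) (flow_neg_period hp) w hw) k (s - t + k * T) t
      ⟨by linarith, hk5⟩ (by linarith)
    rw [show s - t + k * T + k * -T = -t + s by ring] at key
    exact ((hmove (-t) w).le.trans key).trans (hfin C₂ l₂ w hC₂ (le_max_right _ _) (min_le_right _ _))

end Hyperbolicity

/-! ### Cutting off maps tangent to zero -/

section Cutoff

variable {F : Type*} [NormedAddCommGroup F] [NormedSpace ℝ F] [FiniteDimensional ℝ F]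
  {E : Type*} [NormedAddCommGroup E] [NormedSpace ℝ E]

variable (F) in
/-- A smooth bump function on `F`, equal to `1` on the ball of radius `1 / 2` and supported in the
unit ball. -/
noncomputable def unitBump : ContDiffBump (0 : F) := ⟨1 / 2, 1, by norm_num, by norm_num⟩

/-- The map `h`, cut off outside the ball of radius `r`. -/
noncomputable def cutoff (r : ℝ) (h : F → E) (y : F) : E := unitBump F (r⁻¹ • y) • h y

variable {h : F → E} {r R : ℝ}

theorem cutoff_of_le (hr : 0 < r) {y : F} (hy : ‖y‖ ≤ r / 2) : cutoff r h y = h y := by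
  have : unitBump F (r⁻¹ • y) = 1 := by
    refine (unitBump F).one_of_mem_closedBall ?_
    rw [mem_closedBall_zero_iff, norm_smul, norm_inv, Real.norm_of_nonneg hr.le,
      inv_mul_le_iff₀ hr]
    change ‖y‖ ≤ r * (1 / 2)
    linarith
  rw [cutoff, this, one_smul]

theorem cutoff_of_ge (hr : 0 < r) {y : F} (hy : r ≤ ‖y‖) : cutoff r h y = 0 := by
  have : unitBump F (r⁻¹ • y) = 0 := by
    refine (unitBump F).zero_of_le_dist ?_
    rw [dist_zero_right, norm_smul, norm_inv, Real.norm_of_nonneg hr.le, inv_mul_eq_div,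
      le_div_iff₀ hr]
    change 1 * r ≤ ‖y‖
    linarith
  rw [cutoff, this, zero_smul]

theorem contDiff_cutoff (hh : ContDiffOn ℝ 1 h (Metric.ball 0 R)) (hr : 0 < r) (hrR : r < R) :
    ContDiff ℝ 1 (cutoff r h) := by
  rw [contDiff_iff_contDiffAt]
  intro y
  rcases lt_or_ge ‖y‖ R with hy | hy
  · have h1 : ContDiffAt ℝ 1 h y := hh.contDiffAt (Metric.isOpen_ball.mem_nhds (by simpa using hy))
    have h2 : ContDiffAt ℝ 1 (fun y : F => unitBump F (r⁻¹ • y)) y :=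
      ((unitBump F).contDiff.comp (contDiff_const_smul r⁻¹)).contDiffAt
    exact h2.smul h1
  · have : cutoff r h =ᶠ[𝓝 y] fun _ => 0 := by
      filter_upwards [(isOpen_lt continuous_const continuous_norm).mem_nhds
        (show r < ‖y‖ from hrR.trans_le hy)] with z hz
      exact cutoff_of_ge hr (le_of_lt hz)
    exact contDiffAt_const.congr_of_eventuallyEq this

/-- A map with vanishing value and derivative at `0`, cut off outside small balls, is `C¹`
small: the derivative of the cutoff is of size `1 / r`, where the map is of size `o(r)`. -/
theorem eventually_cutoff_small (hR : 0 < R) (hh : ContDiffOn ℝ 1 h (Metric.ball 0 R))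
    (h0 : h 0 = 0) (hd0 : fderiv ℝ h 0 = 0) {η : ℝ} (hη : 0 < η) :
    ∀ᶠ r in 𝓝[>] (0 : ℝ), ∀ y, ‖cutoff r h y‖ ≤ η ∧ ‖fderiv ℝ (cutoff r h) y‖ ≤ η := by
  have hbd : ∃ C > 0, ∀ y, ‖fderiv ℝ (unitBump F : F → ℝ) y‖ ≤ C := by
    have h1 : HasCompactSupport (fderiv ℝ (unitBump F : F → ℝ)) :=
      (unitBump F).hasCompactSupport.fderiv ℝ
    obtain ⟨C, hC⟩ := h1.exists_bound_of_continuous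
      ((unitBump F).contDiff.continuous_fderiv (n := 1) one_ne_zero)
    exact ⟨|C| + 1, by positivity, fun y => (hC y).trans (by linarith [le_abs_self C])⟩
  obtain ⟨C, hC, hbC⟩ := hbd
  set η' := η / (1 + C) with hη'
  have hη'0 : 0 < η' := by positivity
  have hder : ∀ y ∈ Metric.ball (0 : F) R, HasFDerivAt h (fderiv ℝ h y) y := fun y hy =>
    ((hh.differentiableOn one_ne_zero).differentiableAt
      (Metric.isOpen_ball.mem_nhds hy)).hasFDerivAt
  have hcd : ContinuousAt (fderiv ℝ h) 0 :=
    (hh.continuousOn_fderiv_of_isOpen Metric.isOpen_ball le_rfl).continuousAt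
      (Metric.ball_mem_nhds _ hR)
  have hsm : ∀ᶠ y in 𝓝 (0 : F), ‖fderiv ℝ h y‖ < η' := by
    have := hcd.norm.eventually (gt_mem_nhds (show ‖fderiv ℝ h 0‖ < η' by simpa [hd0] using hη'0))
    exact this
  obtain ⟨δ, hδ, hδ'⟩ := Metric.eventually_nhds_iff_ball.1 hsm
  filter_upwards [Ioo_mem_nhdsGT (show 0 < min (min δ R) 1 by positivity)] with r hr y
  obtain ⟨hr0, hr1⟩ := hr
  have hrδ : r < δ := hr1.trans_le ((min_le_left _ _).trans (min_le_left _ _))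
  have hrR : r < R := hr1.trans_le ((min_le_left _ _).trans (min_le_right _ _))
  have hr1 : r < 1 := hr1.trans_le (min_le_right _ _)
  rcases lt_or_ge r ‖y‖ with hy | hy
  · have : cutoff r h =ᶠ[𝓝 y] fun _ => 0 := by
      filter_upwards [(isOpen_lt continuous_const continuous_norm).mem_nhds hy] with z hz
      exact cutoff_of_ge hr0 (le_of_lt hz)
    rw [this.fderiv_eq, this.eq_of_nhds]
    simp [hη.le]
  · have hyR : y ∈ Metric.ball (0 : F) R := by simpa using hy.trans_lt hrR
    have hhy : ‖h y‖ ≤ η' * ‖y‖ := by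
      have h1 := (convex_ball (0 : F) (min δ R)).norm_image_sub_le_of_norm_hasFDerivWithin_le
        (f := h) (f' := fderiv ℝ h) (C := η') (x := 0) (y := y)
        (fun z hz => (hder z (Metric.ball_subset_ball (min_le_right _ _) hz)).hasFDerivWithinAt)
        (fun z hz => (hδ' z (Metric.ball_subset_ball (min_le_left _ _) hz)).le)
        (Metric.mem_ball_self (by positivity))
        (by simpa using hy.trans_lt (lt_min hrδ hrR))
      simpa [h0] using h1
    have hu0 : 0 ≤ unitBump F (r⁻¹ • y) := (unitBump F).nonneg
    have hu1 : unitBump F (r⁻¹ • y) ≤ 1 := (unitBump F).le_one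
    have hle : η' ≤ η := div_le_self hη.le (by linarith)
    constructor
    · rw [cutoff, norm_smul, Real.norm_of_nonneg hu0]
      calc unitBump F (r⁻¹ • y) * ‖h y‖ ≤ 1 * (η' * ‖y‖) := by gcongr
        _ ≤ 1 * (η * 1) := by gcongr; linarith
        _ = η := by ring
    · have h2 : HasFDerivAt (fun y : F => unitBump F (r⁻¹ • y))
          ((fderiv ℝ (unitBump F : F → ℝ) (r⁻¹ • y)).comp (r⁻¹ • ContinuousLinearMap.id ℝ F)) y :=
        HasFDerivAt.comp (g := (unitBump F : F → ℝ)) y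
          (((unitBump F).contDiff (n := 1)).differentiable one_ne_zero _).hasFDerivAt
          ((hasFDerivAt_id y).const_smul r⁻¹)
      have h3 := h2.smul (hder y hyR)
      rw [show fderiv ℝ (cutoff r h) y = _ from h3.fderiv]
      refine ContinuousLinearMap.opNorm_le_bound _ hη.le fun v => ?_
      have e1 : ‖unitBump F (r⁻¹ • y) • fderiv ℝ h y v‖ ≤ η' * ‖v‖ := by
        rw [norm_smul, Real.norm_of_nonneg hu0]
        calc unitBump F (r⁻¹ • y) * ‖fderiv ℝ h y v‖ ≤ 1 * (‖fderiv ℝ h y‖ * ‖v‖) := by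
              gcongr; exact (fderiv ℝ h y).le_opNorm v
          _ ≤ 1 * (η' * ‖v‖) := by
              gcongr
              exact (hδ' y (by simpa using hy.trans_lt hrδ)).le
          _ = η' * ‖v‖ := one_mul _
      have e2 : ‖(fderiv ℝ (unitBump F : F → ℝ) (r⁻¹ • y)) (r⁻¹ • v) • h y‖ ≤ C * η' * ‖v‖ := by
        rw [norm_smul]
        calc ‖(fderiv ℝ (unitBump F : F → ℝ) (r⁻¹ • y)) (r⁻¹ • v)‖ * ‖h y‖
            ≤ (C * (r⁻¹ * ‖v‖)) * (η' * r) := by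
              gcongr
              · refine ((fderiv ℝ (unitBump F : F → ℝ) (r⁻¹ • y)).le_opNorm _).trans ?_
                rw [norm_smul, norm_inv, Real.norm_of_nonneg hr0.le]
                gcongr
                exact hbC _
              · exact hhy.trans (by gcongr)
          _ = C * η' * ‖v‖ := by field_simp
      calc _ = ‖unitBump F (r⁻¹ • y) • fderiv ℝ h y v +
            (fderiv ℝ (unitBump F : F → ℝ) (r⁻¹ • y)) (r⁻¹ • v) • h y‖ := rfl
        _ ≤ η' * ‖v‖ + C * η' * ‖v‖ := (norm_add_le _ _).trans (add_le_add e1 e2)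
        _ = (1 + C) * η' * ‖v‖ := by ring
        _ = η * ‖v‖ := by rw [hη']; field_simp

end Cutoff

/-! ### Maps vanishing on a graph -/

section Substitution

variable {P F E : Type*} [NormedAddCommGroup P] [NormedSpace ℝ P] [NormedAddCommGroup F]
  [NormedSpace ℝ F] [NormedAddCommGroup E] [NormedSpace ℝ E]

theorem hasFDerivAt_substitution {K : P × F → E} {ℓ : P →L[ℝ] F} {g : F → F} {p : P}
    (hK : DifferentiableAt ℝ K (p, ℓ p + g (ℓ p))) (hg : DifferentiableAt ℝ g (ℓ p)) :
    HasFDerivAt (fun p => K (p, ℓ p + g (ℓ p)))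
      ((fderiv ℝ K (p, ℓ p + g (ℓ p))).comp ((ContinuousLinearMap.id ℝ P).prod
        (ℓ + (fderiv ℝ g (ℓ p)).comp ℓ))) p :=
  HasFDerivAt.comp (g := K) p hK.hasFDerivAt ((hasFDerivAt_id p).prodMk
    (ℓ.hasFDerivAt.add (hg.hasFDerivAt.comp p ℓ.hasFDerivAt)))

/-- If `K (p, w)` vanishes for `w = ℓ p`, then its value at `w = ℓ p + g (ℓ p)`, as a function of
`p`, is `C¹` small when `g` is. Only one derivative of `K` is needed. -/
theorem eventually_substitution_small {ι : Type*} {l : Filter ι} {K : P × F → E} {O : Set (P × F)}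
    (hO : IsOpen O) (hK : ContDiffOn ℝ 1 K O) (ℓ : P →L[ℝ] F)
    (h0 : ∀ p, (p, ℓ p) ∈ O → K (p, ℓ p) = 0) {g : ι → F → F}
    (hg : ∀ᶠ i in l, Differentiable ℝ (g i))
    (hgs : ∀ η > 0, ∀ᶠ i in l, ∀ y, ‖g i y‖ ≤ η ∧ ‖fderiv ℝ (g i) y‖ ≤ η) {C : Set P}
    (hC : IsCompact C) (hCO : ∀ p ∈ C, (p, ℓ p) ∈ O) {η : ℝ} (hη : 0 < η) :
    ∀ᶠ i in l, ∀ p ∈ C, (p, ℓ p + g i (ℓ p)) ∈ O ∧ ‖K (p, ℓ p + g i (ℓ p))‖ ≤ η ∧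
      ‖fderiv ℝ (fun p => K (p, ℓ p + g i (ℓ p))) p‖ ≤ η := by
  set D : Set (P × F) := (fun p => (p, ℓ p)) '' C with hD
  have hDc : IsCompact D := hC.image (by fun_prop)
  have hDO : D ⊆ O := by rintro _ ⟨p, hp, rfl⟩; exact hCO p hp
  have hdK : ContinuousOn (fderiv ℝ K) O := hK.continuousOn_fderiv_of_isOpen hO le_rfl
  obtain ⟨B, hB⟩ := hDc.exists_bound_of_continuousOn (hdK.mono hDO)
  obtain ⟨δ₁, hδ₁, hsub⟩ := hDc.exists_thickening_subset_open hO hDO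
  set N := ‖ℓ‖ + 2 with hN
  have hN0 : 0 < N := by positivity
  have hN1 : 1 ≤ N := by have := norm_nonneg ℓ; linarith
  set η' := min η (η / (2 * N)) with hη'
  have hη'0 : 0 < η' := by positivity
  have hunif : ∃ δ > 0, ∀ x ∈ D, ∀ x', dist x x' < δ →
      dist (K x) (K x') < η ∧ dist (fderiv ℝ K x) (fderiv ℝ K x') < η' := by
    have h1 := hDc.uniformContinuousAt_of_continuousAt K
      (fun x hx => hK.continuousOn.continuousAt (hO.mem_nhds (hDO hx))) (Metric.dist_mem_uniformity hη)
    have h2 := hDc.uniformContinuousAt_of_continuousAt (fderiv ℝ K)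
      (fun x hx => hdK.continuousAt (hO.mem_nhds (hDO hx))) (Metric.dist_mem_uniformity hη'0)
    obtain ⟨ε₁, hε₁, h3⟩ := Metric.mem_uniformity_dist.1 h1
    obtain ⟨ε₂, hε₂, h4⟩ := Metric.mem_uniformity_dist.1 h2
    exact ⟨min ε₁ ε₂, lt_min hε₁ hε₂, fun x hx x' hxx =>
      ⟨h3 (hxx.trans_le (min_le_left _ _)) hx, h4 (hxx.trans_le (min_le_right _ _)) hx⟩⟩
  obtain ⟨δ₂, hδ₂, hun⟩ := hunif
  set ζ := min (min (δ₁ / 2) (δ₂ / 2)) (min 1 (η / (2 * (|B| + η') * N))) with hζ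
  have hζ0 : 0 < ζ := by positivity
  filter_upwards [hg, hgs ζ hζ0] with i hgi hi p hp
  have hpD : (p, ℓ p) ∈ D := ⟨p, hp, rfl⟩
  set w := ℓ p + g i (ℓ p) with hw
  have hdist : dist (p, ℓ p) (p, w) ≤ ζ := by
    rw [Prod.dist_eq, dist_self, hw, dist_self_add_right]
    exact max_le hζ0.le (hi (ℓ p)).1
  have hζ1 : ζ ≤ δ₁ / 2 := (min_le_left _ _).trans (min_le_left _ _)
  have hζ2 : ζ ≤ δ₂ / 2 := (min_le_left _ _).trans (min_le_right _ _)
  have hζ3 : ζ ≤ 1 := (min_le_right _ _).trans (min_le_left _ _)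
  have hζ4 : ζ ≤ η / (2 * (|B| + η') * N) := (min_le_right _ _).trans (min_le_right _ _)
  have hwO : (p, w) ∈ O := hsub (Metric.mem_thickening_iff.2 ⟨_, hpD, by
    rw [dist_comm]; linarith⟩)
  obtain ⟨u1, u2⟩ := hun _ hpD (p, w) (by linarith)
  refine ⟨hwO, ?_, ?_⟩
  · rw [h0 p (hCO p hp), dist_zero_left] at u1
    exact u1.le
  · have hdiff : ∀ x ∈ O, DifferentiableAt ℝ K x := fun x hx =>
      (hK.differentiableOn one_ne_zero).differentiableAt (hO.mem_nhds hx)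
    rw [(hasFDerivAt_substitution (hdiff _ hwO) (hgi _)).fderiv]
    -- the derivative of `K` along the diagonal vanishes
    have hdiag : ∀ v, fderiv ℝ K (p, ℓ p) (v, ℓ v) = 0 := by
      have h1 : HasFDerivAt (fun p => K (p, ℓ p)) ((fderiv ℝ K (p, ℓ p)).comp
          ((ContinuousLinearMap.id ℝ P).prod ℓ)) p :=
        HasFDerivAt.comp (g := K) p (hdiff _ (hCO p hp)).hasFDerivAt
          ((hasFDerivAt_id p).prodMk ℓ.hasFDerivAt)
      have h2 : (fun p => K (p, ℓ p)) =ᶠ[𝓝 p] fun _ => 0 := by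
        have hc : ContinuousAt (fun p => (p, ℓ p)) p := by fun_prop
        filter_upwards [hc.preimage_mem_nhds (hO.mem_nhds (hCO p hp))] with x hx
        exact h0 x hx
      have h3 := h1.fderiv
      rw [h2.fderiv_eq] at h3
      intro v
      have h4 := DFunLike.congr_fun h3 v
      simpa using h4.symm
    refine ContinuousLinearMap.opNorm_le_bound _ hη.le fun v => ?_
    have hvN : ‖((v, ℓ v) : P × F)‖ ≤ N * ‖v‖ := by
      rw [Prod.norm_def]
      refine max_le (le_mul_of_one_le_left (norm_nonneg _) hN1) ?_
      exact (ℓ.le_opNorm v).trans (by gcongr; linarith)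
    have e1 : ‖fderiv ℝ K (p, w) (v, ℓ v)‖ ≤ η / 2 * ‖v‖ := by
      have : fderiv ℝ K (p, w) (v, ℓ v) = (fderiv ℝ K (p, w) - fderiv ℝ K (p, ℓ p)) (v, ℓ v) := by
        rw [_root_.sub_apply, hdiag, sub_zero]
      rw [this]
      refine (ContinuousLinearMap.le_opNorm _ _).trans ?_
      rw [dist_comm, dist_eq_norm] at u2
      calc _ ≤ η' * (N * ‖v‖) := by gcongr
        _ ≤ η / (2 * N) * (N * ‖v‖) := by gcongr; exact min_le_right _ _
        _ = _ := by field_simp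
    have e2 : ‖fderiv ℝ K (p, w) (0, fderiv ℝ (g i) (ℓ p) (ℓ v))‖ ≤ η / 2 * ‖v‖ := by
      refine (ContinuousLinearMap.le_opNorm _ _).trans ?_
      have b1 : ‖fderiv ℝ K (p, w)‖ ≤ |B| + η' := by
        have h1 := norm_le_insert' (fderiv ℝ K (p, w)) (fderiv ℝ K (p, ℓ p))
        rw [dist_comm, dist_eq_norm] at u2
        linarith [hB _ hpD, le_abs_self B]
      have b2 : ‖((0, fderiv ℝ (g i) (ℓ p) (ℓ v)) : P × F)‖ ≤ ζ * (N * ‖v‖) := by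
        rw [Prod.norm_def, norm_zero]
        refine max_le (by positivity) ?_
        refine (ContinuousLinearMap.le_opNorm _ _).trans ?_
        gcongr
        · exact (hi _).2
        · exact (ℓ.le_opNorm v).trans (by gcongr; linarith)
      have hB0 : 0 < |B| + η' := by positivity
      calc _ ≤ (|B| + η') * (ζ * (N * ‖v‖)) := by gcongr
        _ ≤ (|B| + η') * (η / (2 * (|B| + η') * N) * (N * ‖v‖)) := by gcongr
        _ = _ := by
          generalize |B| + η' = b at hB0
          field_simp
    calc _ = ‖fderiv ℝ K (p, w) (v, ℓ v) +
          fderiv ℝ K (p, w) (0, fderiv ℝ (g i) (ℓ p) (ℓ v))‖ := by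
          rw [← map_add, Prod.mk_add_mk, add_zero]
          rfl
      _ ≤ η / 2 * ‖v‖ + η / 2 * ‖v‖ := (norm_add_le _ _).trans (add_le_add e1 e2)
      _ = η * ‖v‖ := by ring

end Substitution

/-! ### Vector fields prescribed along a diffeomorphism -/

section PushForward

variable {V E : Type*} [NormedAddCommGroup V] [NormedSpace ℝ V] [FiniteDimensional ℝ V]
  [NormedAddCommGroup E] [NormedSpace ℝ E]

/-- A map which is close to a linear isomorphism has invertible derivatives. -/
theorem exists_hasFDerivAt_equiv {θ : V → E} {ℒ : V ≃L[ℝ] E} {c : NNReal} {B : Set V}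
    (hB : IsOpen B) (hθ : ContDiffOn ℝ 1 θ B)
    (hA : ApproximatesLinearOn θ (ℒ : V →L[ℝ] E) B c)
    (hc : c < ‖(ℒ.symm : E →L[ℝ] V)‖₊⁻¹) {p : V} (hp : p ∈ B) :
    ∃ D : V ≃L[ℝ] E, HasFDerivAt θ (D : V →L[ℝ] E) p := by
  have hd : HasFDerivAt θ (fderiv ℝ θ p) p :=
    ((hθ.differentiableOn one_ne_zero).differentiableAt (hB.mem_nhds hp)).hasFDerivAt
  have hle : ‖fderiv ℝ θ p - (ℒ : V →L[ℝ] E)‖ ≤ c :=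
    (hd.sub (ℒ : V →L[ℝ] E).hasFDerivAt).le_of_lipschitzOn (hB.mem_nhds hp) hA.lipschitzOnWith
  have hinj : Function.Injective (fderiv ℝ θ p) := by
    rw [injective_iff_map_eq_zero]
    intro v hv
    by_contra hv0
    have hv0' : 0 < ‖v‖ := norm_pos_iff.2 hv0
    have h1 : ‖ℒ v‖ ≤ c * ‖v‖ := by
      have := (fderiv ℝ θ p - (ℒ : V →L[ℝ] E)).le_of_opNorm_le hle v
      rw [_root_.sub_apply, hv, zero_sub, norm_neg] at this
      exact this
    have h2 : ‖v‖ ≤ ‖(ℒ.symm : E →L[ℝ] V)‖ * ‖ℒ v‖ := by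
      have := (ℒ.symm : E →L[ℝ] V).le_opNorm (ℒ v)
      rwa [ContinuousLinearEquiv.coe_coe, ContinuousLinearEquiv.symm_apply_apply] at this
    have hN : 0 < ‖(ℒ.symm : E →L[ℝ] V)‖ := by
      by_contra! hN
      nlinarith [norm_nonneg (ℒ v), norm_nonneg (ℒ.symm : E →L[ℝ] V)]
    have h3 : (c : ℝ) < ‖(ℒ.symm : E →L[ℝ] V)‖⁻¹ := by exact_mod_cast hc
    have h4 : ‖v‖ ≤ ‖(ℒ.symm : E →L[ℝ] V)‖ * (c * ‖v‖) := h2.trans (by gcongr)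
    have h5 : ‖(ℒ.symm : E →L[ℝ] V)‖ * c < 1 := by
      rwa [lt_inv_comm₀ (by
        rcases eq_or_lt_of_le c.coe_nonneg with h | h
        · exfalso
          rw [← h] at h4
          simp at h4
          exact hv0 h4
        · exact h) hN, ← one_div, lt_div_iff₀ (by
        rcases eq_or_lt_of_le c.coe_nonneg with h | h
        · exfalso
          rw [← h] at h4
          simp at h4
          exact hv0 h4
        · exact h)] at h3
    nlinarith
  have : FiniteDimensional ℝ E := ℒ.toLinearEquiv.finiteDimensional
  let D := (LinearEquiv.ofInjectiveOfFinrankEq (fderiv ℝ θ p).toLinearMap hinj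
    ℒ.toLinearEquiv.finrank_eq).toContinuousLinearEquiv
  refine ⟨D, ?_⟩
  have : (D : V →L[ℝ] E) = fderiv ℝ θ p := by ext; rfl
  rwa [this]

/-- A `C¹` small map `H` on the source of a `C¹` diffeomorphism `θ` between open sets, vanishing
off a compact set, gives a `C¹` small vector field `W` on the target with `W ∘ θ = H`. -/
theorem exists_contDiff_along {θ H : V → E} {ℒ : V ≃L[ℝ] E} {c : NNReal} {B S : Set V}
    (hB : IsOpen B) (hBc : Convex ℝ B) (hS : IsCompact S) (hSB : S ⊆ B)
    (hθ : ContDiffOn ℝ 1 θ B) (hA : ApproximatesLinearOn θ (ℒ : V →L[ℝ] E) B c)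
    (hc : c < ‖(ℒ.symm : E →L[ℝ] V)‖₊⁻¹) (hH : ContDiffOn ℝ 1 H B)
    (hH0 : ∀ p ∈ B, p ∉ S → H p = 0) {η : NNReal}
    (hη : ∀ p ∈ B, ‖H p‖ ≤ η ∧ ‖fderiv ℝ H p‖ ≤ η) :
    ∃ W : E → E, ContDiff ℝ 1 W ∧ (∀ p ∈ B, W (θ p) = H p) ∧ tsupport W ⊆ θ '' S ∧
      ∀ z, ‖W z‖ ≤ η ∧
        ‖fderiv ℝ W z‖ ≤ η * (‖(ℒ.symm : E →L[ℝ] V)‖₊⁻¹ - c)⁻¹ := by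
  classical
  have : CompleteSpace V := FiniteDimensional.complete ℝ V
  have hc' : Subsingleton V ∨ c < ‖(ℒ.symm : E →L[ℝ] V)‖₊⁻¹ := Or.inr hc
  set e := hA.toOpenPartialHomeomorph θ B hc' hB with he
  have het : e.target = θ '' B := rfl
  have hes : e.source = B := rfl
  have heθ : ∀ p, e p = θ p := fun p => rfl
  have hsymm : ∀ p ∈ B, e.symm (θ p) = p := fun p hp => e.left_inv hp
  have hmem : ∀ z ∈ e.target, e.symm z ∈ B := fun z hz => e.map_target hz
  have hSim : IsCompact (θ '' S) := hS.image_of_continuousOn (hθ.continuousOn.mono hSB)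
  let W : E → E := fun z => if z ∈ e.target then H (e.symm z) else 0
  have hW1 : ∀ z ∈ e.target, W z = H (e.symm z) := fun z hz => if_pos hz
  have hWθ : ∀ p ∈ B, W (θ p) = H p := fun p hp => by
    rw [hW1 _ ⟨p, hp, rfl⟩, hsymm p hp]
  have hW0 : ∀ z, z ∉ θ '' S → W z = 0 := by
    intro z hz
    by_cases hzt : z ∈ e.target
    · rw [hW1 z hzt]
      refine hH0 _ (hmem z hzt) fun h => hz ⟨_, h, ?_⟩
      exact e.right_inv hzt
    · exact if_neg hzt
  have hWev : ∀ z, z ∉ θ '' S → W =ᶠ[𝓝 z] fun _ => 0 := by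
    intro z hz
    filter_upwards [hSim.isClosed.isOpen_compl.mem_nhds hz] with y hy
    exact hW0 y hy
  have hST : θ '' S ⊆ e.target := image_mono hSB
  have hlipH : LipschitzOnWith η H B := hBc.lipschitzOnWith_of_nnnorm_hasFDerivWithin_le
    (fun p hp => ((hH.differentiableOn one_ne_zero).differentiableAt
      (hB.mem_nhds hp)).hasFDerivAt.hasFDerivWithinAt) fun p hp => (hη p hp).2
  have hlipe : LipschitzOnWith (‖(ℒ.symm : E →L[ℝ] V)‖₊⁻¹ - c)⁻¹ e.symm e.target := by
    refine LipschitzOnWith.of_dist_le_mul fun z hz z' hz' => ?_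
    have h1 := (hA.antilipschitz hc').le_mul_dist ⟨_, hmem z hz⟩ ⟨_, hmem z' hz'⟩
    have h2 : θ (e.symm z) = z := e.right_inv hz
    have h3 : θ (e.symm z') = z' := e.right_inv hz'
    change dist (e.symm z) (e.symm z') ≤ _ * dist (θ (e.symm z)) (θ (e.symm z')) at h1
    rwa [h2, h3] at h1
  have hlipW : LipschitzOnWith (η * (‖(ℒ.symm : E →L[ℝ] V)‖₊⁻¹ - c)⁻¹) W e.target := by
    have h1 := hlipH.comp hlipe hmem
    intro z hz z' hz'
    rw [hW1 z hz, hW1 z' hz']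
    exact h1 hz hz'
  refine ⟨W, ?_, hWθ, ?_, fun z => ?_⟩
  · rw [contDiff_iff_contDiffAt]
    intro z
    by_cases hz : z ∈ θ '' S
    · have hzt := hST hz
      obtain ⟨D, hD⟩ := exists_hasFDerivAt_equiv hB hθ hA hc (hmem z hzt)
      have h1 : ContDiffAt ℝ 1 e.symm z := e.contDiffAt_symm hzt hD
        (hθ.contDiffAt (hB.mem_nhds (hmem z hzt)))
      have h2 : ContDiffAt ℝ 1 H (e.symm z) := hH.contDiffAt (hB.mem_nhds (hmem z hzt))
      refine (h2.comp z h1).congr_of_eventuallyEq ?_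
      filter_upwards [e.open_target.mem_nhds hzt] with y hy
      exact hW1 y hy
    · exact contDiffAt_const.congr_of_eventuallyEq (hWev z hz)
  · refine closure_minimal (fun z hz => ?_) hSim.isClosed
    by_contra h
    exact hz (hW0 z h)
  · by_cases hz : z ∈ θ '' S
    · have hzt := hST hz
      refine ⟨?_, ?_⟩
      · rw [hW1 z hzt]; exact (hη _ (hmem z hzt)).1
      · have := norm_fderiv_le_of_lipschitzOn ℝ (e.open_target.mem_nhds hzt) hlipW
        exact_mod_cast this
    · rw [(hWev z hz).fderiv_eq, hW0 z hz, norm_zero, fderiv_fun_const, Pi.zero_apply, norm_zero]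
      exact ⟨η.coe_nonneg, mul_nonneg η.coe_nonneg (NNReal.coe_nonneg _)⟩

end PushForward

/-! ### Perturbations in a flow box -/

section FlowBox

variable {E F : Type*} [NormedAddCommGroup E] [NormedSpace ℝ E] [NormedAddCommGroup F]
  [NormedSpace ℝ F] [FiniteDimensional ℝ F]

/-- A step function of class `C²`, in the form used here: it and its derivative are `C¹`. -/
theorem exists_smooth_step {a b : ℝ} (hab : a < b) :
    ∃ ψ : ℝ → ℝ, ContDiff ℝ 1 ψ ∧ ContDiff ℝ 1 (deriv ψ) ∧
      (∀ s ≤ a, ψ s = 0 ∧ deriv ψ s = 0) ∧ ∀ s, b ≤ s → ψ s = 1 ∧ deriv ψ s = 0 := by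
  have hab' : 0 < b - a := sub_pos.2 hab
  let ψ : ℝ → ℝ := fun s => Real.smoothTransition ((s - a) / (b - a))
  have h2 : ContDiff ℝ 2 ψ := by
    refine Real.smoothTransition.contDiff.comp ?_
    fun_prop
  have hd : ContDiff ℝ 1 (deriv ψ) := by
    have : ContDiff ℝ (1 + 1) ψ := by rw [one_add_one_eq_two]; exact h2
    exact this.deriv'
  have h0 : ∀ s ≤ a, ψ s = 0 := fun s hs =>
    Real.smoothTransition.zero_of_nonpos (div_nonpos_of_nonpos_of_nonneg (by linarith) hab'.le)
  have h1 : ∀ s, b ≤ s → ψ s = 1 := fun s hs =>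
    Real.smoothTransition.one_of_one_le ((one_le_div hab').2 (by linarith))
  refine ⟨ψ, h2.of_le (by norm_num), hd, fun s hs => ⟨h0 s hs, ?_⟩, fun s hs => ⟨h1 s hs, ?_⟩⟩
  · -- at the end point too, by continuity of the derivative
    have hlt : ∀ t ∈ Iio a, deriv ψ t = 0 := fun t ht => by
      have : ψ =ᶠ[𝓝 t] fun _ => 0 := by
        filter_upwards [Iio_mem_nhds ht] with u hu
        exact h0 u (le_of_lt hu)
      rw [this.deriv_eq, deriv_const]
    have : EqOn (deriv ψ) (fun _ => 0) (closure (Iio a)) :=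
      EqOn.closure hlt hd.continuous continuous_const
    exact this (by rw [closure_Iio]; exact hs)
  · have hlt : ∀ t ∈ Ioi b, deriv ψ t = 0 := fun t ht => by
      have : ψ =ᶠ[𝓝 t] fun _ => 1 := by
        filter_upwards [Ioi_mem_nhds ht] with u hu
        exact h1 u (le_of_lt hu)
      rw [this.deriv_eq, deriv_const]
    have : EqOn (deriv ψ) (fun _ => 0) (closure (Ioi b)) :=
      EqOn.closure hlt hd.continuous continuous_const
    exact this (by rw [closure_Ioi]; exact hs)

/-- The flow-box perturbation: inside a flow box `Θ` of the vector field `f`, a `C¹` small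
perturbation `W` of `f`, supported near a compact piece of the central orbit, makes orbits which
enter at height `y` leave at height `G y`, for all small `y`; here `G` is any `C¹` map tangent to
the identity at the origin. -/
theorem exists_flowBox_perturbation {f : E → E} {Ω : Set E} (hΩ : IsOpen Ω)
    (hf : ContDiffOn ℝ 1 f Ω) {Θ : ℝ × F → E} {ε ρ₀ : ℝ} (hε : 0 < ε) (hρ₀ : 0 < ρ₀)
    (hΘ : ContDiffOn ℝ 1 Θ (Ioo (-ε) ε ×ˢ Metric.ball 0 ρ₀))
    (hΘΩ : ∀ p ∈ Ioo (-ε) ε ×ˢ Metric.ball (0 : F) ρ₀, Θ p ∈ Ω ∧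
      HasDerivAt (fun s => Θ (s, p.2)) (f (Θ p)) p.1)
    {ℒ : (ℝ × F) ≃L[ℝ] E} (hℒ : HasFDerivAt Θ (ℒ : (ℝ × F) →L[ℝ] E) 0)
    {G : F → F} {R : ℝ} (hR : 0 < R) (hG : ContDiffOn ℝ 1 G (Metric.ball 0 R)) (hG0 : G 0 = 0)
    (hGd : HasFDerivAt G (ContinuousLinearMap.id ℝ F) 0) :
    ∃ a₁ > 0, ∃ ρ > 0, ∀ a ∈ Ioc 0 a₁, ∀ O : Set E, IsOpen O →
      (∀ s ∈ Icc (a / 3) (2 * a / 3), Θ (s, 0) ∈ O) → ∀ η > 0,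
      ∃ W : E → E, ContDiff ℝ 1 W ∧ tsupport W ⊆ O ∧ (∀ z, ‖W z‖ ≤ η ∧ ‖fderiv ℝ W z‖ ≤ η) ∧
        ∃ r > 0, ∃ Θ' : ℝ × F → E, ∀ p ∈ Ioo (-a) a ×ˢ Metric.ball (0 : F) ρ,
          Θ' p ∈ Ω ∧ HasDerivAt (fun s => Θ' (s, p.2)) (f (Θ' p) + W (Θ' p)) p.1 ∧
          (p.1 ≤ a / 3 → Θ' p = Θ p) ∧ (p.2 = 0 → Θ' p = Θ p) ∧
          (‖p.2‖ ≤ r → 2 * a / 3 ≤ p.1 → Θ' p = Θ (p.1, G p.2)) := by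
  set Q : Set (ℝ × F) := Ioo (-ε) ε ×ˢ Metric.ball 0 ρ₀ with hQ
  have hQo : IsOpen Q := isOpen_Ioo.prod Metric.isOpen_ball
  have h0Q : (0 : ℝ × F) ∈ Q := ⟨⟨by simpa using hε, by simpa using hε⟩, by simpa using hρ₀⟩
  have hNpos : 0 < ‖(ℒ.symm : E →L[ℝ] ℝ × F)‖₊ := by
    have : Nontrivial E := ℒ.symm.toEquiv.nontrivial
    exact ℒ.nnnorm_symm_pos
  set N : NNReal := ‖(ℒ.symm : E →L[ℝ] ℝ × F)‖₊⁻¹ with hN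
  have hN0 : 0 < N := inv_pos.2 hNpos
  -- `Θ` and its displacement each use up `c`, and `c + c < N` keeps the displaced map `Θ'` injective.
  set c : NNReal := N / 3 with hc
  have hc0 : 0 < c := by positivity
  have hcN : c + c < N := by
    have : N = c + c + c := by rw [hc]; ext; push_cast; ring
    rw [this]
    exact lt_add_of_pos_right _ hc0
  -- the box on which `Θ` is close to `ℒ`
  obtain ⟨ρ₁, hρ₁, happ⟩ : ∃ ρ₁ > 0, ApproximatesLinearOn Θ (ℒ : (ℝ × F) →L[ℝ] E)
      (Metric.ball 0 ρ₁) c := by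
    have h1 : HasStrictFDerivAt Θ (ℒ : (ℝ × F) →L[ℝ] E) 0 :=
      (hΘ.contDiffAt (hQo.mem_nhds h0Q)).hasStrictFDerivAt' hℒ one_ne_zero
    obtain ⟨s, hs, h2⟩ := h1.approximates_deriv_on_nhds (Or.inr hc0)
    obtain ⟨ρ₁, hρ₁, h3⟩ := Metric.mem_nhds_iff.1 hs
    exact ⟨ρ₁, hρ₁, h2.mono_set h3⟩
  set a₁ := min ε ρ₁ / 2 with ha₁
  set ρ := min ρ₀ ρ₁ / 2 with hρ
  have ha₁0 : 0 < a₁ := by positivity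
  have hρ0 : 0 < ρ := by positivity
  have ha₁ε : a₁ < ε := (half_lt_self (by positivity)).trans_le (min_le_left _ _)
  have ha₁ρ : a₁ < ρ₁ := (half_lt_self (by positivity)).trans_le (min_le_right _ _)
  have hρρ₀ : ρ < ρ₀ := (half_lt_self (by positivity)).trans_le (min_le_left _ _)
  have hρρ₁ : ρ < ρ₁ := (half_lt_self (by positivity)).trans_le (min_le_right _ _)
  refine ⟨a₁, ha₁0, ρ, hρ0, fun a ha O hO hsegO η hη => ?_⟩
  obtain ⟨ha0, haa₁⟩ := ha
  obtain ⟨ψ, hψ, hψ', hψ0, hψ1⟩ := exists_smooth_step (show a / 3 < 2 * a / 3 by linarith)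
  set h : F → F := fun y => G y - y with hh
  have hhC : ContDiffOn ℝ 1 h (Metric.ball 0 R) := hG.sub contDiffOn_id
  have hh0 : h 0 = 0 := by simp [hh, hG0]
  have hhd : fderiv ℝ h 0 = 0 := by
    have : HasFDerivAt h (ContinuousLinearMap.id ℝ F - ContinuousLinearMap.id ℝ F) 0 :=
      hGd.sub (hasFDerivAt_id 0)
    rw [this.fderiv, sub_self]
  set g : ℝ → F → F := fun r => cutoff r h with hg
  have hgC : ∀ᶠ r in 𝓝[>] (0 : ℝ), ContDiff ℝ 1 (g r) := by
    filter_upwards [Ioo_mem_nhdsGT hR] with r hr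
    exact contDiff_cutoff hhC hr.1 hr.2
  -- `K₂` is the displacement, `K` the defect of the displaced curves as solutions for `f`
  let A : (ℝ × F) × F → E := fun q => Θ (q.1.1, q.2)
  let K₂ : (ℝ × F) × F → E := fun q => ψ q.1.1 • (A q - Θ q.1)
  let K : (ℝ × F) × F → E := fun q => f (Θ q.1) + deriv ψ q.1.1 • (A q - Θ q.1) +
    ψ q.1.1 • (f (A q) - f (Θ q.1)) - f (Θ q.1 + K₂ q)
  set D₀ : Set ((ℝ × F) × F) := Q ×ˢ Metric.ball 0 ρ₀ with hD₀
  have hD₀o : IsOpen D₀ := hQo.prod Metric.isOpen_ball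
  have hAQ : ∀ q ∈ D₀, (q.1.1, q.2) ∈ Q := fun q hq => ⟨hq.1.1, hq.2⟩
  have hAC : ContDiffOn ℝ 1 A D₀ :=
    hΘ.comp (g := Θ) (f := fun q : (ℝ × F) × F => (q.1.1, q.2)) (by fun_prop) hAQ
  have hΘC : ContDiffOn ℝ 1 (fun q : (ℝ × F) × F => Θ q.1) D₀ :=
    hΘ.comp (g := Θ) (f := fun q : (ℝ × F) × F => q.1) (by fun_prop) fun q hq => hq.1
  have hψC : ContDiffOn ℝ 1 (fun q : (ℝ × F) × F => ψ q.1.1) D₀ :=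
    (hψ.comp (f := fun q : (ℝ × F) × F => q.1.1) (by fun_prop)).contDiffOn
  have hψC' : ContDiffOn ℝ 1 (fun q : (ℝ × F) × F => deriv ψ q.1.1) D₀ :=
    (hψ'.comp (f := fun q : (ℝ × F) × F => q.1.1) (by fun_prop)).contDiffOn
  have hK₂C : ContDiffOn ℝ 1 K₂ D₀ := hψC.smul (hAC.sub hΘC)
  have hΘK₂ : ContDiffOn ℝ 1 (fun q => Θ q.1 + K₂ q) D₀ := hΘC.add hK₂C
  set D : Set ((ℝ × F) × F) := D₀ ∩ (fun q => Θ q.1 + K₂ q) ⁻¹' Ω with hD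
  have hDo : IsOpen D := hΘK₂.continuousOn.isOpen_inter_preimage hD₀o hΩ
  have hDD₀ : D ⊆ D₀ := inter_subset_left
  have hKC : ContDiffOn ℝ 1 K D := by
    have f1 : ContDiffOn ℝ 1 (fun q : (ℝ × F) × F => f (Θ q.1)) D :=
      hf.comp (hΘC.mono hDD₀) fun q hq => (hΘΩ _ hq.1.1).1
    have f2 : ContDiffOn ℝ 1 (fun q : (ℝ × F) × F => f (A q)) D :=
      hf.comp (hAC.mono hDD₀) fun q hq => (hΘΩ _ (hAQ q hq.1)).1
    have f3 : ContDiffOn ℝ 1 (fun q : (ℝ × F) × F => f (Θ q.1 + K₂ q)) D :=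
      hf.comp (hΘK₂.mono hDD₀) fun q hq => hq.2
    exact ((f1.add ((hψC'.mono hDD₀).smul ((hAC.sub hΘC).mono hDD₀))).add
      ((hψC.mono hDD₀).smul (f2.sub f1))).sub f3
  let ℓ : ℝ × F →L[ℝ] F := ContinuousLinearMap.snd ℝ ℝ F
  have hK₂0 : ∀ p : ℝ × F, K₂ (p, ℓ p) = 0 := fun p => by
    change ψ p.1 • (Θ (p.1, p.2) - Θ p) = 0
    rw [sub_self, smul_zero]
  have hK0 : ∀ p : ℝ × F, K (p, ℓ p) = 0 := fun p => by
    change f (Θ p) + deriv ψ p.1 • (Θ (p.1, p.2) - Θ p) +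
      ψ p.1 • (f (Θ (p.1, p.2)) - f (Θ p)) - f (Θ p + K₂ (p, ℓ p)) = 0
    rw [hK₂0]
    simp
  set B : Set (ℝ × F) := Ioo (-a) a ×ˢ Metric.ball 0 ρ with hB
  set C : Set (ℝ × F) := Icc (-a) a ×ˢ Metric.closedBall 0 ρ with hC
  have hCc : IsCompact C := isCompact_Icc.prod (isCompact_closedBall _ _)
  have hBC : B ⊆ C := prod_mono Ioo_subset_Icc_self Metric.ball_subset_closedBall
  have hBo : IsOpen B := isOpen_Ioo.prod Metric.isOpen_ball
  have hBconv : Convex ℝ B := (convex_Ioo _ _).prod (convex_ball _ _)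
  have hCQ : C ⊆ Q := by
    rintro ⟨s, y⟩ ⟨hs, hy⟩
    exact ⟨⟨by linarith [hs.1], by linarith [hs.2]⟩, Metric.closedBall_subset_ball hρρ₀ hy⟩
  have hCρ₁ : C ⊆ Metric.ball 0 ρ₁ := by
    rintro ⟨s, y⟩ ⟨hs, hy⟩
    rw [mem_ball_zero_iff, Prod.norm_def]
    refine max_lt ?_ ?_
    · rw [Real.norm_eq_abs]
      exact (abs_le.2 hs).trans_lt (by linarith)
    · exact (mem_closedBall_zero_iff.1 hy).trans_lt hρρ₁
  have hCD : ∀ p ∈ C, (p, ℓ p) ∈ D := fun p hp => by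
    refine ⟨⟨hCQ hp, (hCQ hp).2⟩, ?_⟩
    change Θ p + K₂ (p, ℓ p) ∈ Ω
    rw [hK₂0, add_zero]
    exact (hΘΩ p (hCQ hp)).1
  have hgd : ∀ᶠ r in 𝓝[>] (0 : ℝ), Differentiable ℝ (g r) :=
    hgC.mono fun r hr => hr.differentiable one_ne_zero
  have hgs : ∀ η > 0, ∀ᶠ r in 𝓝[>] (0 : ℝ), ∀ y, ‖g r y‖ ≤ η ∧ ‖fderiv ℝ (g r) y‖ ≤ η :=
    fun η hη => eventually_cutoff_small hR hhC hh0 hhd hη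
  -- `η'` is the size required of the defect; `κ` is a Lipschitz constant of the inverse of the
  -- displaced map.
  set κ : NNReal := (N - (c + c))⁻¹ with hκ
  set η' : NNReal := ⟨η, hη.le⟩ / (1 + κ) with hη'
  have hη'0 : 0 < η' := div_pos (show (0 : NNReal) < ⟨η, hη.le⟩ from hη) (by positivity)
  have hη'1 : (η' : ℝ) ≤ η := by
    change ((⟨η, hη.le⟩ / (1 + κ) : NNReal) : ℝ) ≤ η
    exact div_le_self hη.le (by simp)
  have hη'κ : ((η' * κ : NNReal) : ℝ) ≤ η := by
    change ((⟨η, hη.le⟩ / (1 + κ) * κ : NNReal) : ℝ) ≤ η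
    push_cast
    change η / (1 + (κ : ℝ)) * κ ≤ η
    have hκ0 := κ.coe_nonneg
    rw [div_mul_eq_mul_div, div_le_iff₀ (by positivity)]
    nlinarith
  -- the neighbourhood of the central segment
  obtain ⟨δ, hδ, hδO⟩ : ∃ δ > 0, Metric.thickening δ
      ((fun s : ℝ => Θ (s, 0)) '' Icc (a / 3) (2 * a / 3)) ⊆ O := by
    refine IsCompact.exists_thickening_subset_open ?_ hO ?_
    · refine isCompact_Icc.image_of_continuousOn ?_
      refine hΘ.continuousOn.comp (f := fun s : ℝ => (s, (0 : F))) (by fun_prop) fun s hs => ?_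
      exact hCQ ⟨⟨by linarith [hs.1], by linarith [hs.2]⟩, by simpa using hρ0.le⟩
    · rintro _ ⟨s, hs, rfl⟩
      exact hsegO s hs
  set Lip : ℝ := ‖(ℒ : (ℝ × F) →L[ℝ] E)‖ + (c + c : NNReal) with hLip
  have hLip0 : 0 < Lip := by
    have : (0 : ℝ) < (c + c : NNReal) := by exact_mod_cast add_pos hc0 hc0
    positivity
  obtain ⟨r, hrK, hrK₂, hrg, hr⟩ :=
    ((eventually_substitution_small hDo hKC ℓ (fun p _ => hK0 p) hgd hgs hCc hCD
      (NNReal.coe_pos.2 hη'0)).and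
    ((eventually_substitution_small hDo (hK₂C.mono hDD₀) ℓ (fun p _ => hK₂0 p) hgd hgs hCc hCD
      (NNReal.coe_pos.2 hc0)).and
    (hgC.and (Ioo_mem_nhdsGT (show 0 < min ρ (δ / Lip) by positivity))))).exists
  obtain ⟨hr0, hr1⟩ := hr
  have hrρ : r < ρ := hr1.trans_le (min_le_left _ _)
  have hrδ : Lip * r < δ := by
    rw [mul_comm]
    exact (lt_div_iff₀ hLip0).1 (hr1.trans_le (min_le_right _ _))
  have hg0 : g r 0 = 0 := by
    rw [hg]
    change cutoff r h 0 = 0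
    rw [cutoff_of_le hr0 (by rw [norm_zero]; exact (half_pos hr0).le), hh0]
  have hsub : ContDiffOn ℝ 1 (fun p : ℝ × F => (p, ℓ p + g r (ℓ p))) B :=
    (contDiff_id.prodMk (ℓ.contDiff.add (hrg.comp ℓ.contDiff))).contDiffOn
  set k₂ : ℝ × F → E := fun p => K₂ (p, ℓ p + g r (ℓ p)) with hk₂
  set H : ℝ × F → E := fun p => K (p, ℓ p + g r (ℓ p)) with hH
  have hk₂C : ContDiffOn ℝ 1 k₂ B := hK₂C.comp hsub fun p hp => hDD₀ (hrK₂ p (hBC hp)).1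
  have hHC : ContDiffOn ℝ 1 H B := hKC.comp hsub fun p hp => (hrK p (hBC hp)).1
  set Θ' : ℝ × F → E := fun p => Θ p + k₂ p with hΘ'
  have hΘ'C : ContDiffOn ℝ 1 Θ' B := (hΘ.mono (hBC.trans hCQ)).add hk₂C
  have happ' : ApproximatesLinearOn Θ' (ℒ : (ℝ × F) →L[ℝ] E) B (c + c) := by
    rw [ApproximatesLinearOn.approximatesLinearOn_iff_lipschitzOnWith]
    have e1 : LipschitzOnWith c k₂ B := hBconv.lipschitzOnWith_of_nnnorm_hasFDerivWithin_le
      (fun p hp => ((hk₂C.differentiableOn one_ne_zero).differentiableAt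
        (hBo.mem_nhds hp)).hasFDerivAt.hasFDerivWithinAt) fun p hp => (hrK₂ p (hBC hp)).2.2
    have e2 := (happ.mono_set (hBC.trans hCρ₁)).lipschitzOnWith.add e1
    have e3 : (Θ' - ⇑(ℒ : (ℝ × F) →L[ℝ] E)) = fun p => (Θ - ⇑(ℒ : (ℝ × F) →L[ℝ] E)) p + k₂ p := by
      funext p
      exact add_sub_right_comm _ _ _
    rw [e3]
    exact e2
  set S : Set (ℝ × F) := Icc (a / 3) (2 * a / 3) ×ˢ Metric.closedBall 0 r with hS
  have hSB : S ⊆ B := by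
    rintro ⟨s, y⟩ ⟨hs, hy⟩
    exact ⟨⟨by linarith [hs.1], by linarith [hs.2]⟩, Metric.closedBall_subset_ball hrρ hy⟩
  have hk₂le : ∀ p : ℝ × F, p.1 ≤ a / 3 → k₂ p = 0 := fun p hp => by
    change ψ p.1 • (_ - _) = 0
    rw [(hψ0 _ hp).1, zero_smul]
  have hHS : ∀ p ∈ B, p ∉ S → H p = 0 := by
    rintro ⟨s, y⟩ - hpS
    by_cases hy : r ≤ ‖y‖
    · have : ℓ (s, y) + g r (ℓ (s, y)) = ℓ (s, y) := by
        change y + cutoff r h y = y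
        rw [cutoff_of_ge hr0 hy, add_zero]
      change K ((s, y), ℓ (s, y) + g r (ℓ (s, y))) = 0
      rw [this, hK0]
    · push Not at hy
      have hs : s < a / 3 ∨ 2 * a / 3 < s := by
        by_contra! hs
        exact hpS ⟨⟨hs.1, hs.2⟩, by simpa using hy.le⟩
      set w := ℓ (s, y) + g r (ℓ (s, y)) with hw
      change f (Θ (s, y)) + deriv ψ s • (Θ (s, w) - Θ (s, y)) +
        ψ s • (f (Θ (s, w)) - f (Θ (s, y))) -
          f (Θ (s, y) + ψ s • (Θ (s, w) - Θ (s, y))) = 0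
      rcases hs with hs | hs
      · rw [(hψ0 s hs.le).1, (hψ0 s hs.le).2]; simp
      · rw [(hψ1 s hs.le).1, (hψ1 s hs.le).2]; simp
  obtain ⟨W, hW, hWΘ, hWs, hWη⟩ := exists_contDiff_along hBo hBconv
    (isCompact_Icc.prod (isCompact_closedBall _ _)) hSB hΘ'C happ' hcN hHC hHS
    fun p hp => (hrK p (hBC hp)).2
  refine ⟨W, hW, hWs.trans ?_, fun z => ⟨(hWη z).1.trans hη'1, (hWη z).2.trans ?_⟩, r / 2,
    half_pos hr0, Θ', ?_⟩
  · rintro _ ⟨⟨s, y⟩, hp, rfl⟩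
    have hp0 : (s, (0 : F)) ∈ S := ⟨hp.1, by simpa using hr0.le⟩
    refine hδO (Metric.mem_thickening_iff.2 ⟨Θ (s, 0), ⟨s, hp.1, rfl⟩, ?_⟩)
    have e1 : Θ' (s, 0) = Θ (s, 0) := by
      change Θ (s, 0) + ψ s • (Θ (s, 0 + g r 0) - Θ (s, 0)) = Θ (s, 0)
      rw [hg0, add_zero, sub_self, smul_zero, add_zero]
    have e2 := happ' _ (hSB hp) _ (hSB hp0)
    have e3 : ‖((s, y) - (s, 0) : ℝ × F)‖ ≤ r := by
      rw [Prod.mk_sub_mk, sub_self, sub_zero, Prod.norm_def, norm_zero]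
      exact max_le hr0.le (mem_closedBall_zero_iff.1 hp.2)
    rw [← e1, dist_eq_norm]
    calc ‖Θ' (s, y) - Θ' (s, 0)‖
        = ‖(Θ' (s, y) - Θ' (s, 0) - ℒ ((s, y) - (s, 0))) + ℒ ((s, y) - (s, 0))‖ := by
          rw [sub_add_cancel]
      _ ≤ (c + c : NNReal) * ‖((s, y) - (s, 0) : ℝ × F)‖ +
          ‖(ℒ : (ℝ × F) →L[ℝ] E)‖ * ‖((s, y) - (s, 0) : ℝ × F)‖ :=
          (norm_add_le _ _).trans (add_le_add e2 ((ℒ : (ℝ × F) →L[ℝ] E).le_opNorm _))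
      _ = Lip * ‖((s, y) - (s, 0) : ℝ × F)‖ := by rw [hLip]; ring
      _ ≤ Lip * r := by gcongr
      _ < δ := hrδ
  · have := hη'κ
    rw [hκ, hN] at this
    exact this
  · rintro ⟨s, y⟩ hp
    have hmem := hrK₂ _ (hBC hp)
    set w := ℓ (s, y) + g r (ℓ (s, y)) with hw
    have hsy : (s, y) ∈ Q := hCQ (hBC hp)
    have hsw : (s, w) ∈ Q := ⟨hsy.1, hmem.1.1.2⟩
    refine ⟨hmem.1.2, ?_, fun hs => ?_, fun hy => ?_, fun hy hs => ?_⟩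
    · have d1 := (hΘΩ _ hsy).2
      have d2 := (hΘΩ _ hsw).2
      have d3 : HasDerivAt ψ (deriv ψ s) s :=
        (hψ.differentiable one_ne_zero s).hasDerivAt
      have d4 := d1.add (d3.smul (d2.sub d1))
      refine d4.congr_deriv ?_
      rw [hWΘ _ hp]
      change f (Θ (s, y)) + (ψ s • (f (Θ (s, w)) - f (Θ (s, y))) +
        deriv ψ s • (Θ (s, w) - Θ (s, y))) = f (Θ (s, y) + K₂ ((s, y), w)) +
          (f (Θ (s, y)) + deriv ψ s • (Θ (s, w) - Θ (s, y)) +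
        ψ s • (f (Θ (s, w)) - f (Θ (s, y))) - f (Θ (s, y) + K₂ ((s, y), w)))
      abel
    · change Θ (s, y) + k₂ (s, y) = Θ (s, y)
      rw [hk₂le _ hs, add_zero]
    · change y = 0 at hy
      have hw0 : w = y := by
        change y + g r y = y
        rw [hy, hg0, add_zero]
      change Θ (s, y) + ψ s • (Θ (s, w) - Θ (s, y)) = Θ (s, y)
      rw [hw0, sub_self, smul_zero, add_zero]
    · have hwG : w = G y := by
        change y + cutoff r h y = G y
        rw [cutoff_of_le hr0 hy, hh]
        exact add_sub_cancel _ _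
      change Θ (s, y) + ψ s • (Θ (s, w) - Θ (s, y)) = Θ (s, G y)
      rw [(hψ1 s hs).1, one_smul, add_sub_cancel, hwG]

end FlowBox

/-! ### One-parameter groups of linear automorphisms -/

section ExponentialMap

variable {E : Type*} [NormedAddCommGroup E] [NormedSpace ℝ E] [CompleteSpace E]

theorem exp_add_smul (A : E →L[ℝ] E) (s t : ℝ) (v : E) :
    NormedSpace.exp ((s + t) • A) v = NormedSpace.exp (s • A) (NormedSpace.exp (t • A) v) := by
  have h : Commute (s • A) (t • A) := ((Commute.refl A).smul_left s).smul_right t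
  have h1 : ∀ B : E →L[ℝ] E,
      B ∈ Metric.eball (0 : E →L[ℝ] E) (NormedSpace.expSeries ℝ (E →L[ℝ] E)).radius := fun B =>
    (NormedSpace.expSeries_radius_eq_top ℝ (E →L[ℝ] E)).symm ▸ edist_lt_top _ _
  rw [add_smul, NormedSpace.exp_add_of_commute_of_mem_ball h (h1 _) (h1 _)]
  rfl

/-- The exponential of an endomorphism, as an automorphism. -/
noncomputable def expEquiv (A : E →L[ℝ] E) : E ≃L[ℝ] E :=
  ContinuousLinearEquiv.equivOfInverse (NormedSpace.exp ((1 : ℝ) • A))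
    (NormedSpace.exp ((-1 : ℝ) • A))
    (fun v => by
      rw [← exp_add_smul, neg_add_cancel, zero_smul ℝ A, NormedSpace.exp_zero]; rfl)
    (fun v => by
      rw [← exp_add_smul, add_neg_cancel, zero_smul ℝ A, NormedSpace.exp_zero]; rfl)

theorem hasDerivAt_exp_smul_apply (A : E →L[ℝ] E) (v : E) (t : ℝ) :
    HasDerivAt (fun t : ℝ => NormedSpace.exp (t • A) v) (A (NormedSpace.exp (t • A) v)) t :=
  (ContinuousLinearMap.apply ℝ E v).hasFDerivAt.comp_hasDerivAt t
    (hasDerivAt_exp_smul_const' (𝕂 := ℝ) A t)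

theorem exists_norm_exp_smul_le (A : E →L[ℝ] E) :
    ∃ B ≥ 1, ∀ t ∈ Ioo (-2 : ℝ) 2, ‖NormedSpace.exp (t • A)‖ ≤ B := by
  have h : Continuous fun t : ℝ => NormedSpace.exp (t • A) :=
    continuous_iff_continuousAt.2 fun t => (hasDerivAt_exp_smul_const' (𝕂 := ℝ) A t).continuousAt
  obtain ⟨B, hB⟩ := (isCompact_Icc (a := (-2 : ℝ)) (b := 2)).exists_bound_of_continuousOn
    h.continuousOn
  exact ⟨max B 1, le_max_right _ _, fun t ht =>
    (hB t (Ioo_subset_Icc_self ht)).trans (le_max_left _ _)⟩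

end ExponentialMap

/-! ### Hyperbolicity of singularities -/

section Singularity

variable {n : ℕ} {M : Type*} [TopologicalSpace M] [ChartedSpace (EuclideanSpace ℝ (Fin n)) M]
  [IsManifold (𝓡 n) ∞ M]

/-- Vector fields supported in a fixed compact subset of a chart, and `C¹` small there, are small
perturbations. -/
theorem exists_add_pushField_mem [T2Space M] (Y : C1VectorField n M) {𝒱 : Set (C1VectorField n M)}
    (h𝒱 : 𝒱 ∈ 𝓝 Y) {c : M} {K₀ : Set (EuclideanSpace ℝ (Fin n))} (hK₀ : IsCompact K₀)
    (hK₀t : K₀ ⊆ (extChartAt (𝓡 n) c).target) :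
    ∃ η > 0, ∀ (W : EuclideanSpace ℝ (Fin n) → EuclideanSpace ℝ (Fin n)) (hW : ContDiff ℝ 1 W)
      (hc : HasCompactSupport W) (h : tsupport W ⊆ (extChartAt (𝓡 n) c).target), tsupport W ⊆ K₀ →
      (∀ z, ‖W z‖ ≤ η ∧ ‖fderiv ℝ W z‖ ≤ η) → Y + pushField c W hW hc h ∈ 𝒱 := by
  by_contra! hcon
  choose W hW hc h hs hη hn using fun k : ℕ => hcon (1 / ((k : ℝ) + 1)) (by positivity)
  have hlim := tendsto_add_pushField (l := atTop) Y hW hc h hK₀ hK₀t hs fun ε hε => by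
    filter_upwards [tendsto_one_div_add_atTop_nhds_zero_nat.eventually (gt_mem_nhds hε)] with k hk z
    exact ⟨(hη k z).1.trans hk.le, (hη k z).2.trans hk.le⟩
  obtain ⟨k, hk⟩ := (hlim.eventually_mem h𝒱).exists
  exact hn k hk

theorem localRep_eq_zero {X : C1VectorField n M} {c : M} {z : EuclideanSpace ℝ (Fin n)}
    (h : IsSingularity X ((extChartAt (𝓡 n) c).symm z)) : localRep X c z = 0 := by
  rw [localRep, show X ((extChartAt (𝓡 n) c).symm z) = 0 from h]
  exact map_zero _

theorem isSingularity_of_localRep_eq_zero {X : C1VectorField n M} {c : M}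
    {z : EuclideanSpace ℝ (Fin n)} (hz : z ∈ (extChartAt (𝓡 n) c).target)
    (h : localRep X c z = 0) : IsSingularity X ((extChartAt (𝓡 n) c).symm z) := by
  have := chart_symm_deriv_localRep X hz
  rw [h] at this
  exact this.symm.trans (map_zero _)

variable [T2Space M] [CompactSpace M]

theorem flow_singularity {X : C1VectorField n M} {σ : M} (hσ : IsSingularity X σ) (t : ℝ) :
    flow X t σ = σ := by
  set z₀ := extChartAt (𝓡 n) σ σ with hz₀
  have hs : (extChartAt (𝓡 n) σ).symm z₀ = σ := extChartAt_to_inv σ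
  have h0 : localRep X σ z₀ = 0 := localRep_eq_zero (by rw [hs]; exact hσ)
  have := flow_eq_chart_symm X (c := σ) (ζ := fun _ => z₀) (a := -(|t| + 1)) (b := |t| + 1)
    ⟨by linarith [abs_nonneg t], by linarith [abs_nonneg t]⟩
    (fun s _ => ⟨mem_extChartAt_target σ, by rw [h0]; exact hasDerivAt_const _ _⟩)
    (t := t) ⟨by linarith [neg_abs_le t], by linarith [le_abs_self t]⟩
  rwa [hs] at this

/-- At a point fixed by the time-`t` map, the tangent flow is the derivative of the time-`t` map
in the chart at the point. -/
theorem hasFDerivAt_chartFlow {X : C1VectorField n M} {p : M} {t : ℝ} (hp : flow X t p = p) :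
    HasFDerivAt (chartFlow X p t) (tangentFlow X t p) (extChartAt (𝓡 n) p p) := by
  have h : HasFDerivWithinAt (fun z => extChartAt (𝓡 n) (flow X t p)
      (flow X t ((extChartAt (𝓡 n) p).symm z))) (tangentFlow X t p) (range (𝓡 n))
      (extChartAt (𝓡 n) p p) := (hasMFDerivAt_flow X t p).2
  rw [modelWithCornersSelf_coe, range_id, hasFDerivWithinAt_univ, hp] at h
  exact h

theorem contDiffAt_chartFlow {X : C1VectorField n M} {p : M} {t : ℝ} (hp : flow X t p = p) :
    ContDiffAt ℝ 1 (chartFlow X p t) (extChartAt (𝓡 n) p p) := by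
  have h : ContDiffWithinAt ℝ 1 (fun z => extChartAt (𝓡 n) (flow X t p)
      (flow X t ((extChartAt (𝓡 n) p).symm z))) (range (𝓡 n)) (extChartAt (𝓡 n) p p) :=
    (contMDiffAt_iff.1 (contMDiff_flow_time X t p)).2
  rw [modelWithCornersSelf_coe, range_id, contDiffWithinAt_univ, hp] at h
  exact h

theorem orbit_singularity {X : C1VectorField n M} {σ : M} (hσ : IsSingularity X σ) :
    orbit X σ = {σ} := by
  rw [orbit, funext fun t => flow_singularity hσ t, range_const]

/-- At a singularity, the tangent flow is the exponential of the linear part of the field. -/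
theorem tangentFlow_singularity {X : C1VectorField n M} {σ : M} (hσ : IsSingularity X σ) (t : ℝ) :
    tangentFlow X t σ =
      NormedSpace.exp (t • fderiv ℝ (localRep X σ) (extChartAt (𝓡 n) σ σ)) := by
  set z₀ := extChartAt (𝓡 n) σ σ with hz₀
  have hs : (extChartAt (𝓡 n) σ).symm z₀ = σ := extChartAt_to_inv σ
  have h0 : localRep X σ z₀ = 0 := localRep_eq_zero (by rw [hs]; exact hσ)
  obtain ⟨ε, hε, ρ, hρ, -, -, -, h⟩ := exists_chartFlow X (mem_extChartAt_target (I := 𝓡 n) σ)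
  refine forall_time_of_doubling (P := fun t => tangentFlow X t σ =
    NormedSpace.exp (t • fderiv ℝ (localRep X σ) z₀)) hε (fun s hs' => ?_) (fun s hs' => ?_) t
  · exact (hasFDerivAt_chartFlow (flow_singularity hσ s)).unique (h h0 s hs')
  · have h2 : s = s / 2 + s / 2 := (add_halves s).symm
    ext1 v
    rw [h2, tangentFlow_add_apply, flow_singularity hσ, hs', exp_add_smul]

/-- A singularity in a robustly shadowable maximal invariant set is hyperbolic: otherwise an
arbitrarily small perturbation makes the field linear near it, with a nonzero bounded orbit, which
is not compatible with shadowing. -/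
theorem isHyperbolic_singleton {n : ℕ} {M : Type*} [EMetricSpace M] [CompactSpace M]
    [ChartedSpace (EuclideanSpace ℝ (Fin n)) M] [IsManifold (𝓡 n) ∞ M]
    [RiemannianBundle (fun x : M => TangentSpace (𝓡 n) x)]
    [IsContMDiffRiemannianBundle (𝓡 n) ∞ (EuclideanSpace ℝ (Fin n))
      (fun x : M => TangentSpace (𝓡 n) x)]
    {Y : C1VectorField n M} {U : Set M} {𝒱 : Set (C1VectorField n M)} (h𝒱 : 𝒱 ∈ 𝓝 Y)
    (hsh : ∀ Z ∈ 𝒱, IsShadowable Z (continuation Z U)) {σ : M} (hσ : IsSingularity Y σ)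
    (hσU : σ ∈ interior U) : IsHyperbolic Y {σ} := by
  set z₀ := extChartAt (𝓡 n) σ σ with hz₀
  have hz₀t : z₀ ∈ (extChartAt (𝓡 n) σ).target := mem_extChartAt_target σ
  have hs : (extChartAt (𝓡 n) σ).symm z₀ = σ := extChartAt_to_inv σ
  set f := localRep Y σ with hf
  have h0 : f z₀ = 0 := localRep_eq_zero (by rw [hs]; exact hσ)
  set A := fderiv ℝ f z₀ with hA
  set L := expEquiv A with hLdef
  have horb := orbit_singularity hσ
  have hL : boundedOrbits L = ⊥ := by
    by_contra hL
    obtain ⟨R, hR, hRt⟩ := Metric.isOpen_iff.1 (isOpen_extChartAt_target (I := 𝓡 n) σ) z₀ hz₀t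
    have hK₀t : Metric.closedBall z₀ (R / 2) ⊆ (extChartAt (𝓡 n) σ).target :=
      (Metric.closedBall_subset_ball (by linarith)).trans hRt
    obtain ⟨η, hη, hpert⟩ := exists_add_pushField_mem Y h𝒱 (isCompact_closedBall z₀ (R / 2)) hK₀t
    -- the nonlinear part of the field, with the opposite sign
    let h : EuclideanSpace ℝ (Fin n) → EuclideanSpace ℝ (Fin n) := fun u => A u - f (z₀ + u)
    have hhC : ContDiffOn ℝ 1 h (Metric.ball 0 R) := by
      refine A.contDiff.contDiffOn.sub ((contDiffOn_localRep Y σ).comp (by fun_prop) fun u hu => ?_)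
      refine hRt ?_
      simpa using hu
    have hh0 : h 0 = 0 := by
      change A 0 - f (z₀ + 0) = 0
      rw [map_zero, add_zero, h0, sub_zero]
    have hhd : fderiv ℝ h 0 = 0 := by
      have h1 : HasFDerivAt f A (z₀ + 0) := by
        rw [add_zero]
        exact hasFDerivAt_localRep Y hz₀t
      have h2 : HasFDerivAt h (A - A) 0 := by
        refine A.hasFDerivAt.sub ?_
        exact (hasFDerivAt_comp_add_left z₀).2 h1
      rw [h2.fderiv, sub_self]
    obtain ⟨r, hrη, hr0, hrR⟩ := ((eventually_cutoff_small hR hhC hh0 hhd hη).and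
      (Ioo_mem_nhdsGT (show 0 < R / 2 by linarith))).exists
    let W : EuclideanSpace ℝ (Fin n) → EuclideanSpace ℝ (Fin n) := fun z => cutoff r h (z - z₀)
    have hW : ContDiff ℝ 1 W :=
      (contDiff_cutoff hhC hr0 (by linarith)).comp (contDiff_id.sub contDiff_const)
    have hWs : tsupport W ⊆ Metric.closedBall z₀ (R / 2) := by
      refine closure_minimal (fun z hz => ?_) Metric.isClosed_closedBall
      by_contra hz'
      refine hz (cutoff_of_ge hr0 ?_)
      rw [Metric.mem_closedBall, dist_eq_norm] at hz'
      linarith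
    have hWc : HasCompactSupport W := (isCompact_closedBall z₀ (R / 2)).of_isClosed_subset
      (isClosed_tsupport _) hWs
    have hWt : tsupport W ⊆ (extChartAt (𝓡 n) σ).target := hWs.trans hK₀t
    set Z := Y + pushField σ W hW hWc hWt with hZ
    have hZ𝒱 : Z ∈ 𝒱 := hpert W hW hWc hWt hWs fun z => by
      refine ⟨(hrη _).1, ?_⟩
      have : fderiv ℝ W z = fderiv ℝ (cutoff r h) (z - z₀) := fderiv_comp_sub z₀
      rw [this]
      exact (hrη _).2
    have hZlin : ∀ u, ‖u‖ ≤ r / 2 → localRep Z σ (z₀ + u) = A u := fun u hu => by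
      have hu' : z₀ + u ∈ (extChartAt (𝓡 n) σ).target := hRt (by
        rw [Metric.mem_ball, dist_self_add_left]; linarith)
      rw [hZ, localRep_add, localRep_pushField_self hu']
      change f (z₀ + u) + cutoff r h (z₀ + u - z₀) = A u
      rw [add_sub_cancel_left, cutoff_of_le hr0 hu]
      exact add_sub_cancel _ _
    have hZσ : IsSingularity Z σ := by
      have := hZlin 0 (by rw [norm_zero]; exact (half_pos hr0).le)
      rw [add_zero, map_zero] at this
      have := isSingularity_of_localRep_eq_zero hz₀t this
      rwa [hs] at this
    obtain ⟨B, hB1, hB⟩ := exists_norm_exp_smul_le A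
    set b := r / 2 / B with hb
    have hb0 : 0 < b := by positivity
    have hbr : b ≤ r / 2 := div_le_self (half_pos hr0).le hB1
    let q : EuclideanSpace ℝ (Fin n) → M := fun w => (extChartAt (𝓡 n) σ).symm (z₀ + w)
    have hq0 : q 0 = σ := by change (extChartAt (𝓡 n) σ).symm (z₀ + 0) = σ; rw [add_zero, hs]
    have hqt : ∀ w, ‖w‖ ≤ r / 2 → z₀ + w ∈ (extChartAt (𝓡 n) σ).target := fun w hw => hRt (by
      rw [Metric.mem_ball, dist_self_add_left]; linarith)
    have hφq : ∀ w, ‖w‖ ≤ b → extChartAt (𝓡 n) σ (q w) = z₀ + w := fun w hw =>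
      (extChartAt (𝓡 n) σ).right_inv (hqt w (hw.trans hbr))
    have hsec : IsLinearSection Z q L (fun _ => 1) b 1 1 := by
      refine ⟨hb0, one_pos, ?_, fun w hw => ?_, fun _ _ => le_rfl, fun _ _ => le_rfl,
        fun w hw hwo => ?_⟩
      · refine (continuousOn_extChartAt_symm σ).comp (by fun_prop) fun w hw => hqt w ?_
        exact (mem_closedBall_zero_iff.1 hw).trans hbr
      · -- the solution in the chart is `z₀ + exp (t A) w`, which does not leave the ball
        let ζ : ℝ → EuclideanSpace ℝ (Fin n) := fun t => z₀ + NormedSpace.exp (t • A) w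
        have hζ : ∀ t ∈ Ioo (-2 : ℝ) 2, ‖NormedSpace.exp (t • A) w‖ ≤ r / 2 := fun t ht => by
          refine ((NormedSpace.exp (t • A)).le_of_opNorm_le (hB t ht) w).trans ?_
          calc B * ‖w‖ ≤ B * b := by gcongr
            _ = r / 2 := by rw [hb]; field_simp
        have hζd : ∀ t, HasDerivAt ζ (A (NormedSpace.exp (t • A) w)) t := fun t =>
          (hasDerivAt_exp_smul_apply A w t).const_add z₀
        have := flow_eq_chart_symm Z (c := σ) (ζ := ζ) (a := -2) (b := 2) (by norm_num)
          (fun t ht => ⟨hqt _ (hζ t ht), by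
            change HasDerivAt ζ (localRep Z σ (z₀ + NormedSpace.exp (t • A) w)) t
            rw [hZlin _ (hζ t ht)]
            exact hζd t⟩) (t := 1) (by norm_num)
        have e0 : ζ 0 = z₀ + w := by
          change z₀ + NormedSpace.exp ((0 : ℝ) • A) w = z₀ + w
          rw [zero_smul ℝ A, NormedSpace.exp_zero]
          rfl
        have e1 : ζ 1 = z₀ + L w := rfl
        rw [e0, e1] at this
        exact this
      · rw [hq0, orbit_singularity hZσ, mem_singleton_iff] at hwo
        have h1 := hφq w hw
        rw [hwo] at h1
        exact left_eq_add.1 h1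
    refine hsec.not_isShadowable ?_ (isOpen_extChartAt_source (I := 𝓡 n) σ)
      (fun w hw => (extChartAt (𝓡 n) σ).map_target (hqt w (hw.trans hbr)))
      (Pr := fun x => extChartAt (𝓡 n) σ x - z₀) ?_ (fun w hw => ?_) (fun x hx => ⟨0, ?_⟩) hL
      (hsh Z hZ𝒱)
    · rw [hq0, orbit_singularity hZσ]
      exact singleton_subset_iff.2 hσU
    · exact (continuousOn_extChartAt σ).sub continuousOn_const
    · rw [hφq w hw, add_sub_cancel_left]
    · change flow Z 0 x = (extChartAt (𝓡 n) σ).symm (z₀ + (extChartAt (𝓡 n) σ x - z₀))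
      rw [flow_zero, add_sub_cancel, (extChartAt (𝓡 n) σ).left_inv hx]
  rw [← horb]
  refine isHyperbolic_orbit one_pos (flow_singularity hσ 1) ?_ L (ContinuousLinearMap.id ℝ _)
    Function.surjective_id (fun v => ?_) (fun v => ?_) hL
  · intro x₀ hx₀
    rw [horb] at hx₀ ⊢
    refine ⟨fun _ => 0, ?_⟩
    filter_upwards [eventually_mem_nhdsWithin] with x hx
    refine ⟨continuousWithinAt_const, ?_⟩
    rw [mem_singleton_iff] at hx₀ hx
    rw [hx, hx₀, flow_zero]
  · have : fieldAt Y σ = 0 := hσ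
    rw [this, Submodule.span_zero_singleton, Submodule.mem_bot]
    rfl
  · rw [tangentFlow_singularity hσ]
    rfl

end Singularity

/-! ### Least periods of closed orbits -/

section ClosedOrbit

/-- On the image of a compact set, a left inverse of a continuous map is continuous. -/
theorem continuousOn_image_of_leftInvOn {α β : Type*} [TopologicalSpace α] [TopologicalSpace β]
    [T2Space β] {K : Set α} (hK : IsCompact K) {g : α → β} (hg : ContinuousOn g K) {t : β → α}
    (ht : LeftInvOn t g K) : ContinuousOn t (g '' K) := by
  rw [continuousOn_iff_isClosed]
  intro C hC
  refine ⟨g '' (K ∩ C), ((hK.inter_right hC).image_of_continuousOn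
    (hg.mono inter_subset_left)).isClosed, ?_⟩
  ext x
  constructor
  · rintro ⟨hx, s, hs, rfl⟩
    rw [mem_preimage, ht hs] at hx
    exact ⟨⟨s, ⟨hs, hx⟩, rfl⟩, s, hs, rfl⟩
  · rintro ⟨⟨s, ⟨hs, hsC⟩, rfl⟩, h⟩
    exact ⟨by rw [mem_preimage, ht hs]; exact hsC, h⟩

variable {n : ℕ} {M : Type*} [TopologicalSpace M] [ChartedSpace (EuclideanSpace ℝ (Fin n)) M]
  [IsManifold (𝓡 n) ∞ M] [T2Space M] [CompactSpace M] {X : C1VectorField n M} {p : M} {T : ℝ}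

theorem isSingularity_of_flow_eq (h : ∀ t, flow X t p = p) : IsSingularity X p := by
  have h1 := isMIntegralCurve_flow X p 0
  rw [show (fun t => flow X t p) = fun _ => p from funext h] at h1
  have h2 : (1 : ℝ) • fieldAt X p = 0 :=
    DFunLike.congr_fun (hasMFDerivAt_unique h1 (hasMFDerivAt_const p (0 : ℝ))) (1 : ℝ)
  rwa [one_smul] at h2

/-- `T` is the least period of the closed orbit of `p`: two times at which the orbit is at the
same point differ by a multiple of `T`. -/
def IsLeastPeriod (X : C1VectorField n M) (p : M) (T : ℝ) : Prop :=
  0 < T ∧ flow X T p = p ∧ ∀ s t, flow X s p = flow X t p → ∃ k : ℤ, s - t = k * T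

/-- A closed orbit has a least period: the periods form a closed subgroup of `ℝ`, which is cyclic unless
the point is a singularity. -/
theorem exists_isLeastPeriod (hp : ¬ IsSingularity X p) (hT : 0 < T) (hTp : flow X T p = p) :
    ∃ T, IsLeastPeriod X p T := by
  let S : AddSubgroup ℝ :=
    { carrier := {t | flow X t p = p}
      zero_mem' := flow_zero X p
      add_mem' := fun {s t} hs ht => by
        change flow X (s + t) p = p
        rw [flow_add, show flow X t p = p from ht, show flow X s p = p from hs]
      neg_mem' := fun {t} ht => by
        change flow X (-t) p = p
        have := flow_neg_flow X t p
        rwa [show flow X t p = p from ht] at this }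
  have hS : ∀ t, t ∈ S ↔ flow X t p = p := fun t => Iff.rfl
  have hSc : IsClosed (S : Set ℝ) := isClosed_eq (continuous_flow_orbit X p) continuous_const
  rcases S.dense_or_cyclic with hd | ⟨a, ha⟩
  · refine absurd (isSingularity_of_flow_eq fun t => ?_) hp
    have : t ∈ (S : Set ℝ) := by rw [hSc.closure_eq.symm.trans hd.closure_eq]; trivial
    exact this
  · have ha0 : a ≠ 0 := by
      rintro rfl
      have : T ∈ S := hTp
      rw [ha, AddSubgroup.mem_closure_singleton] at this
      obtain ⟨k, hk⟩ := this
      rw [smul_zero] at hk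
      exact hT.ne hk
    have hmem : ∀ t, flow X t p = p → ∃ k : ℤ, t = k * |a| := fun t ht => by
      have : t ∈ S := ht
      rw [ha, AddSubgroup.mem_closure_singleton] at this
      obtain ⟨k, hk⟩ := this
      rw [zsmul_eq_mul] at hk
      rcases abs_choice a with h | h
      · exact ⟨k, by rw [h, hk]⟩
      · exact ⟨-k, by rw [h, ← hk]; push_cast; ring⟩
    refine ⟨|a|, abs_pos.2 ha0, ?_, fun s t hst => hmem _ ?_⟩
    · have haS : a ∈ S := by rw [ha]; exact AddSubgroup.mem_closure_singleton_self a
      have : |a| ∈ S := by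
        rcases abs_choice a with h | h <;> rw [h]
        · exact haS
        · exact S.neg_mem haS
      exact this
    · rw [sub_eq_neg_add, flow_add, hst, flow_neg_flow]

namespace IsLeastPeriod

theorem flow_ne (h : IsLeastPeriod X p T) {s t : ℝ} (h0 : 0 < t - s) (hT : t - s < T) :
    flow X t p ≠ flow X s p := by
  intro he
  obtain ⟨k, hk⟩ := h.2.2 t s he
  have hT0 := h.1
  rw [hk] at h0 hT
  have h1 : (0 : ℝ) < k := pos_of_mul_pos_left h0 hT0.le
  have h2 : (k : ℝ) < 1 := by
    by_contra! h3
    nlinarith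
  have h3 : (0 : ℤ) < k := by exact_mod_cast h1
  have h4 : k < (1 : ℤ) := by exact_mod_cast h2
  omega

theorem flow_base (h : IsLeastPeriod X p T) (s : ℝ) : IsLeastPeriod X (flow X s p) T := by
  refine ⟨h.1, flow_period_flow h.2.1 s, fun t u htu => ?_⟩
  rw [← flow_add, ← flow_add] at htu
  obtain ⟨k, hk⟩ := h.2.2 _ _ htu
  exact ⟨k, by rw [← hk]; ring⟩

/-- Points of a closed orbit near `p` are reached from `p` in short times. -/
theorem eventually_exists_time (h : IsLeastPeriod X p T) {δ : ℝ} (hδ : 0 < δ) :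
    ∀ᶠ x in 𝓝 p, x ∈ orbit X p → ∃ s, |s| < δ ∧ flow X s p = x := by
  have hT := h.1
  set δ' := min δ (T / 2) with hδ'
  have hδ'0 : 0 < δ' := lt_min hδ (by linarith)
  have hK : IsCompact ((fun s => flow X s p) '' Icc δ' (T - δ')) :=
    isCompact_Icc.image (continuous_flow_orbit X p)
  have hp : p ∉ (fun s => flow X s p) '' Icc δ' (T - δ') := by
    rintro ⟨s, hs, he⟩
    refine h.flow_ne (t := s) (s := 0) (by linarith [hs.1]) (by linarith [hs.2]) ?_
    rw [flow_zero]
    exact he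
  filter_upwards [hK.isClosed.isOpen_compl.mem_nhds hp] with x hx hxo
  obtain ⟨s, hs, rfl⟩ := orbit_subset_image_Icc hT h.2.1 hxo
  rcases lt_or_ge s δ' with h1 | h1
  · exact ⟨s, by rw [abs_of_nonneg hs.1]; exact h1.trans_le (min_le_left _ _), rfl⟩
  · have h2 : T - δ' < s := by
      by_contra! h2
      exact hx ⟨s, ⟨h1, h2⟩, rfl⟩
    refine ⟨s - T, ?_, ?_⟩
    · rw [abs_of_nonpos (by linarith [hs.2])]
      linarith [min_le_left δ (T / 2)]
    · rw [sub_eq_add_neg, flow_add, flow_neg_period h.2.1]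

/-- The time along a closed orbit is a continuous coordinate near each of its points. -/
theorem exists_continuous_time (h : IsLeastPeriod X p T) {x₀ : M} (hx₀ : x₀ ∈ orbit X p) :
    ∃ t : M → ℝ, ∀ᶠ x in 𝓝[orbit X p] x₀,
      ContinuousWithinAt t (orbit X p) x ∧ flow X (t x) x₀ = x := by
  classical
  obtain ⟨s₀, rfl⟩ := hx₀
  have h' := h.flow_base s₀
  have hT := h.1
  set x₀ := flow X s₀ p with hx₀
  have horb : orbit X p = orbit X x₀ := by
    refine Set.Subset.antisymm ?_ ?_
    · rintro _ ⟨s, rfl⟩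
      exact ⟨s - s₀, by change flow X (s - s₀) (flow X s₀ p) = _; rw [← flow_add, sub_add_cancel]⟩
    · rintro _ ⟨s, rfl⟩
      exact ⟨s + s₀, flow_add X s s₀ p⟩
  set K : Set ℝ := Icc (-(T / 3)) (T / 3) with hK
  set g : ℝ → M := fun s => flow X s x₀ with hg
  have hinj : InjOn g K := by
    intro s hs t ht hst
    by_contra hne
    rcases lt_or_gt_of_ne hne with hlt | hlt
    · exact h'.flow_ne (t := t) (s := s) (by linarith) (by linarith [hs.1, ht.2]) hst.symm
    · exact h'.flow_ne (t := s) (s := t) (by linarith) (by linarith [hs.2, ht.1]) hst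
  have hleft : LeftInvOn (Function.invFunOn g K) g K := hinj.leftInvOn_invFunOn
  have hcont := continuousOn_image_of_leftInvOn isCompact_Icc
    (continuous_flow_orbit X x₀).continuousOn hleft
  refine ⟨Function.invFunOn g K, ?_⟩
  rw [horb]
  have hnear : ∀ᶠ x in 𝓝 x₀, x ∈ orbit X x₀ → x ∈ g '' K := by
    filter_upwards [h'.eventually_exists_time (show 0 < T / 3 by linarith)] with x hx hxo
    obtain ⟨s, hs, he⟩ := hx hxo
    exact ⟨s, ⟨by linarith [(abs_lt.1 hs).1], (abs_lt.1 hs).2.le⟩, he⟩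
  filter_upwards [eventually_mem_nhdsWithin, (hnear.eventually_nhds).filter_mono
    nhdsWithin_le_nhds] with x hx hxn
  have hxK := hxn.self_of_nhds hx
  refine ⟨?_, ?_⟩
  · refine (hcont x hxK).mono_of_mem_nhdsWithin ?_
    filter_upwards [eventually_mem_nhdsWithin, hxn.filter_mono nhdsWithin_le_nhds] with y hy hy'
    exact hy' hy
  · obtain ⟨s, hs, rfl⟩ := hxK
    rw [hleft hs]

end IsLeastPeriod

end ClosedOrbit

/-! ### Flow boxes over affine sections, and return maps -/

section Section

variable {n : ℕ} {M : Type*} [TopologicalSpace M] [ChartedSpace (EuclideanSpace ℝ (Fin n)) M]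
  [IsManifold (𝓡 n) ∞ M] {F : Type*} [NormedAddCommGroup F] [NormedSpace ℝ F]

theorem localRep_base (X : C1VectorField n M) (p : M) :
    localRep X p (extChartAt (𝓡 n) p p) = fieldAt X p := by
  have h : ∀ x, x = p → (mfderiv (𝓡 n) 𝓘(ℝ, EuclideanSpace ℝ (Fin n)) (extChartAt (𝓡 n) p) x
      (X x) : EuclideanSpace ℝ (Fin n)) = fieldAt X p := by
    rintro _ rfl
    rw [mfderiv_extChartAt_self]
    rfl
  exact h _ (extChartAt_to_inv p)

/-- The section through `p` which is affine in the chart at `p`, in the directions `ℒ (0, y)`. -/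
noncomputable def affineSection (p : M) (ℒ : (ℝ × F) ≃L[ℝ] EuclideanSpace ℝ (Fin n)) (y : F) : M :=
  (extChartAt (𝓡 n) p).symm (extChartAt (𝓡 n) p p + ℒ (0, y))

/-- The flow box over `affineSection p ℒ`, read in the chart at `p`. -/
noncomputable def boxMap (X : C1VectorField n M) (p : M)
    (ℒ : (ℝ × F) ≃L[ℝ] EuclideanSpace ℝ (Fin n)) (x : ℝ × F) : EuclideanSpace ℝ (Fin n) :=
  extChartAt (𝓡 n) p (flow X x.1 (affineSection p ℒ x.2))

theorem hasFDerivAt_affine (z : EuclideanSpace ℝ (Fin n))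
    (ℒ : (ℝ × F) ≃L[ℝ] EuclideanSpace ℝ (Fin n)) :
    HasFDerivAt (fun y : F => z + ℒ (0, y))
      ((ℒ : (ℝ × F) →L[ℝ] EuclideanSpace ℝ (Fin n)).comp (ContinuousLinearMap.inr ℝ ℝ F)) 0 := by
  let A : F →L[ℝ] EuclideanSpace ℝ (Fin n) :=
    (ℒ : (ℝ × F) →L[ℝ] EuclideanSpace ℝ (Fin n)).comp (ContinuousLinearMap.inr ℝ ℝ F)
  exact A.hasFDerivAt.const_add z

theorem affineSection_zero (p : M) (ℒ : (ℝ × F) ≃L[ℝ] EuclideanSpace ℝ (Fin n)) :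
    affineSection p ℒ 0 = p := by
  rw [affineSection, show ((0 : ℝ), (0 : F)) = 0 from rfl, map_zero, add_zero, extChartAt_to_inv]

/-- The properties of a box `(-ε, ε) × B(0, ρ)` on which the flow box map is a `C¹`
diffeomorphism `e`. -/
structure IsFlowBox (X : C1VectorField n M) (p : M)
    (ℒ : (ℝ × F) ≃L[ℝ] EuclideanSpace ℝ (Fin n)) (ε ρ : ℝ)
    (e : OpenPartialHomeomorph (ℝ × F) (EuclideanSpace ℝ (Fin n))) : Prop where
  time_pos : 0 < ε
  radius_pos : 0 < ρ
  source_eq : e.source = Ioo (-ε) ε ×ˢ Metric.ball 0 ρ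
  coe_eq : ∀ x, e x = boxMap X p ℒ x
  contDiffOn : ContDiffOn ℝ 1 (boxMap X p ℒ) (Ioo (-ε) ε ×ˢ Metric.ball 0 ρ)
  contDiffOn_symm : ContDiffOn ℝ 1 e.symm e.target
  hasFDerivAt : HasFDerivAt (boxMap X p ℒ) (ℒ : (ℝ × F) →L[ℝ] EuclideanSpace ℝ (Fin n)) 0
  mem_target : ∀ y ∈ Metric.ball (0 : F) ρ,
    extChartAt (𝓡 n) p p + ℒ (0, y) ∈ (extChartAt (𝓡 n) p).target
  mem_source : ∀ x ∈ Ioo (-ε) ε ×ˢ Metric.ball (0 : F) ρ,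
    flow X x.1 (affineSection p ℒ x.2) ∈ (extChartAt (𝓡 n) p).source
  hasDerivAt : ∀ x ∈ Ioo (-ε) ε ×ˢ Metric.ball (0 : F) ρ,
    HasDerivAt (fun s => boxMap X p ℒ (s, x.2)) (localRep X p (boxMap X p ℒ x)) x.1

variable [T2Space M] [CompactSpace M] {X : C1VectorField n M} {p : M}
  {ℒ : (ℝ × F) ≃L[ℝ] EuclideanSpace ℝ (Fin n)}

/-- By the inverse function theorem, a section transverse to the field has a flow box. -/
theorem exists_isFlowBox [FiniteDimensional ℝ F] (hℒ : ℒ (1, 0) = fieldAt X p) :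
    ∃ ε ρ e, IsFlowBox X p ℒ ε ρ e := by
  set z₀ := extChartAt (𝓡 n) p p with hz₀
  obtain ⟨ε₀, hε₀, ρ₀, hρ₀, hbt, hfl, hC, -⟩ :=
    exists_chartFlow X (mem_extChartAt_target (I := 𝓡 n) p)
  have hc0 : Tendsto (fun y : F => z₀ + ℒ (0, y)) (𝓝 0) (𝓝 z₀) := by
    have : Continuous fun y : F => z₀ + ℒ (0, y) := by fun_prop
    have h := this.tendsto 0
    rwa [show ((0 : ℝ), (0 : F)) = 0 from rfl, map_zero, add_zero] at h
  obtain ⟨ρ₁, hρ₁, hball⟩ := Metric.eventually_nhds_iff_ball.1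
    (hc0.eventually_mem (Metric.ball_mem_nhds z₀ hρ₀))
  set Q : Set (ℝ × F) := Ioo (-ε₀) ε₀ ×ˢ Metric.ball 0 ρ₁ with hQ
  have hQo : IsOpen Q := isOpen_Ioo.prod Metric.isOpen_ball
  have h0Q : (0 : ℝ × F) ∈ Q := ⟨⟨by simpa using hε₀, by simpa using hε₀⟩, by simpa using hρ₁⟩
  have hΘC : ContDiffOn ℝ 1 (boxMap X p ℒ) Q :=
    hC.comp (g := fun q : ℝ × EuclideanSpace ℝ (Fin n) => chartFlow X p q.1 q.2)
      (f := fun x : ℝ × F => (x.1, z₀ + ℒ (0, x.2))) (by fun_prop)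
      fun x hx => ⟨hx.1, hball _ hx.2⟩
  have hΘd : ∀ x ∈ Q, HasDerivAt (fun s => boxMap X p ℒ (s, x.2))
      (localRep X p (boxMap X p ℒ x)) x.1 := fun x hx => (hfl _ (hball _ hx.2) _ hx.1).2
  have hΘ0 : ∀ y ∈ Metric.ball (0 : F) ρ₁, boxMap X p ℒ (0, y) = z₀ + ℒ (0, y) := fun y hy => by
    rw [boxMap, flow_zero]
    exact (extChartAt (𝓡 n) p).right_inv (hbt (hball y hy))
  have hder : HasFDerivAt (boxMap X p ℒ) (ℒ : (ℝ × F) →L[ℝ] EuclideanSpace ℝ (Fin n)) 0 := by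
    set D := fderiv ℝ (boxMap X p ℒ) 0 with hD
    have hDd : HasFDerivAt (boxMap X p ℒ) D (0, 0) :=
      ((hΘC.differentiableOn one_ne_zero).differentiableAt (hQo.mem_nhds h0Q)).hasFDerivAt
    have e1 : D (1, 0) = ℒ (1, 0) := by
      have h1 : HasDerivAt (fun s : ℝ => boxMap X p ℒ (s, 0)) (D (1, 0)) 0 :=
        hDd.comp_hasDerivAt (f := fun s : ℝ => (s, (0 : F))) 0
          ((hasDerivAt_id 0).prodMk (hasDerivAt_const _ _))
      have h2 := h1.unique (hΘd 0 h0Q)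
      have h3 : boxMap X p ℒ 0 = z₀ := by
        rw [boxMap, Prod.snd_zero, affineSection_zero, Prod.fst_zero, flow_zero]
      rw [h2, h3, hℒ, localRep_base]
    have e2 : ∀ y, D (0, y) = ℒ (0, y) := by
      have h1 : HasFDerivAt (fun y : F => boxMap X p ℒ (0, y))
          (D.comp (ContinuousLinearMap.inr ℝ ℝ F)) 0 :=
        hDd.comp (f := fun y : F => ((0 : ℝ), y)) 0 (ContinuousLinearMap.inr ℝ ℝ F).hasFDerivAt
      have h2 : HasFDerivAt (fun y : F => z₀ + ℒ (0, y))
          ((ℒ : (ℝ × F) →L[ℝ] _).comp (ContinuousLinearMap.inr ℝ ℝ F)) 0 :=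
        hasFDerivAt_affine z₀ ℒ
      have h3 := h1.unique (h2.congr_of_eventuallyEq (by
        filter_upwards [Metric.ball_mem_nhds (0 : F) hρ₁] with y hy
        exact hΘ0 y hy))
      intro y
      exact DFunLike.congr_fun h3 y
    have e3 : D = (ℒ : (ℝ × F) →L[ℝ] EuclideanSpace ℝ (Fin n)) := by
      refine ContinuousLinearMap.ext fun x => ?_
      have hx : x = x.1 • ((1 : ℝ), (0 : F)) + (0, x.2) := by ext <;> simp
      rw [hx, map_add, map_add, map_smul, map_smul, e1, e2]
      rfl
    rw [← e3]
    exact hDd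
  have hpos : 0 < ‖(ℒ.symm : EuclideanSpace ℝ (Fin n) →L[ℝ] ℝ × F)‖₊ := by
    have : Nontrivial (EuclideanSpace ℝ (Fin n)) := ℒ.symm.toEquiv.nontrivial
    exact ℒ.nnnorm_symm_pos
  set c : NNReal := ‖(ℒ.symm : EuclideanSpace ℝ (Fin n) →L[ℝ] ℝ × F)‖₊⁻¹ / 2 with hc
  have hc0 : 0 < c := half_pos (inv_pos.2 hpos)
  have hcN : c < ‖(ℒ.symm : EuclideanSpace ℝ (Fin n) →L[ℝ] ℝ × F)‖₊⁻¹ :=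
    half_lt_self (inv_pos.2 hpos)
  have h1 : HasStrictFDerivAt (boxMap X p ℒ) (ℒ : (ℝ × F) →L[ℝ] EuclideanSpace ℝ (Fin n)) 0 :=
    (hΘC.contDiffAt (hQo.mem_nhds h0Q)).hasStrictFDerivAt' hder one_ne_zero
  obtain ⟨s, hs, happ⟩ := h1.approximates_deriv_on_nhds (Or.inr hc0)
  obtain ⟨r, hr, hrs⟩ := Metric.mem_nhds_iff.1 (inter_mem hs (hQo.mem_nhds h0Q))
  set B : Set (ℝ × F) := Ioo (-r) r ×ˢ Metric.ball 0 r with hB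
  have hBr : B ⊆ Metric.ball 0 r := by
    rintro ⟨t, y⟩ ⟨ht, hy⟩
    rw [mem_ball_zero_iff, Prod.norm_def]
    exact max_lt (by rw [Real.norm_eq_abs]; exact abs_lt.2 ht) (mem_ball_zero_iff.1 hy)
  have hBo : IsOpen B := isOpen_Ioo.prod Metric.isOpen_ball
  have hBQ : B ⊆ Q := (hBr.trans hrs).trans inter_subset_right
  have hA : ApproximatesLinearOn (boxMap X p ℒ) (ℒ : (ℝ × F) →L[ℝ] EuclideanSpace ℝ (Fin n)) B c :=
    happ.mono_set ((hBr.trans hrs).trans inter_subset_left)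
  have : CompleteSpace (ℝ × F) := FiniteDimensional.complete ℝ _
  have hBmem : ∀ y ∈ Metric.ball (0 : F) r, y ∈ Metric.ball (0 : F) ρ₁ := fun y hy =>
    (hBQ (show ((0 : ℝ), y) ∈ B from ⟨⟨by linarith, hr⟩, hy⟩)).2
  set e := hA.toOpenPartialHomeomorph (boxMap X p ℒ) B (Or.inr hcN) hBo with he
  have hes : e.source = B := rfl
  refine ⟨r, r, e, hr, hr, rfl, fun x => rfl, hΘC.mono hBQ, fun z hz => ?_, hder,
    fun y hy => hbt (hball y (hBmem y hy)), fun x hx => (hfl _ (hball _ (hBQ hx).2) _ (hBQ hx).1).1,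
    fun x hx => hΘd x (hBQ hx)⟩
  have hzB : e.symm z ∈ B := e.map_target hz
  obtain ⟨D, hD⟩ := exists_hasFDerivAt_equiv hBo (hΘC.mono hBQ) hA hcN hzB
  exact (e.contDiffAt_symm hz hD ((hΘC.mono hBQ).contDiffAt (hBo.mem_nhds hzB))).contDiffWithinAt

namespace IsFlowBox

variable {ε ρ : ℝ} {e : OpenPartialHomeomorph (ℝ × F) (EuclideanSpace ℝ (Fin n))}

theorem zero_mem (h : IsFlowBox X p ℒ ε ρ e) : (0 : ℝ × F) ∈ Ioo (-ε) ε ×ˢ Metric.ball (0 : F) ρ :=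
  ⟨⟨by simpa using h.time_pos, by simpa using h.time_pos⟩, by simpa using h.radius_pos⟩

theorem boxMap_zero : boxMap X p ℒ 0 = extChartAt (𝓡 n) p p := by
  rw [boxMap, Prod.snd_zero, affineSection_zero, Prod.fst_zero, flow_zero]

theorem symm_base (h : IsFlowBox X p ℒ ε ρ e) : e.symm (extChartAt (𝓡 n) p p) = 0 := by
  have := e.left_inv (x := 0) (by rw [h.source_eq]; exact h.zero_mem)
  rwa [h.coe_eq, boxMap_zero] at this

theorem base_mem_target (h : IsFlowBox X p ℒ ε ρ e) : extChartAt (𝓡 n) p p ∈ e.target := by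
  have := e.map_source (x := 0) (by rw [h.source_eq]; exact h.zero_mem)
  rwa [h.coe_eq, boxMap_zero] at this

theorem flow_eq_symm (h : IsFlowBox X p ℒ ε ρ e) {x : ℝ × F}
    (hx : x ∈ Ioo (-ε) ε ×ˢ Metric.ball (0 : F) ρ) :
    flow X x.1 (affineSection p ℒ x.2) = (extChartAt (𝓡 n) p).symm (boxMap X p ℒ x) :=
  ((extChartAt (𝓡 n) p).left_inv (h.mem_source x hx)).symm

/-- The return map `f₁` of a closed orbit to an affine section is a local diffeomorphism with
linear part `L`. The map `G = f₁⁻¹ ∘ L` is therefore tangent to the identity, and precomposition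
with it makes the return map linear. -/
theorem exists_returnMap [FiniteDimensional ℝ F] (h : IsFlowBox X p ℒ ε ρ e)
    (hℒ : ℒ (1, 0) = fieldAt X p) {T : ℝ} (hT : flow X T p = p) :
    ∃ L : F ≃L[ℝ] F, (∀ v, (ℒ.symm (tangentFlow X T p v)).2 = L (ℒ.symm v).2) ∧
      ∃ G : F → F, ∃ R > 0, ContDiffOn ℝ 1 G (Metric.ball 0 R) ∧ G 0 = 0 ∧
        HasFDerivAt G (ContinuousLinearMap.id ℝ F) 0 ∧
        ∃ τ : F → ℝ, Tendsto τ (𝓝 0) (𝓝 0) ∧ ∀ᶠ y in 𝓝 0,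
          flow X T (affineSection p ℒ (G y)) = flow X (τ y) (affineSection p ℒ (L y)) := by
  set z₀ := extChartAt (𝓡 n) p p with hz₀
  set D := tangentFlow X T p with hD
  have : CompleteSpace F := FiniteDimensional.complete ℝ F
  have hDe : D (ℒ (1, 0)) = ℒ (1, 0) := by rw [hℒ, hD, tangentFlow_fieldAt, hT]
  have hDsymm : ∀ s : ℝ, D (ℒ (s, 0)) = ℒ (s, 0) := fun s => by
    have : ((s, 0) : ℝ × F) = s • (1, 0) := by ext <;> simp
    rw [this, map_smul, map_smul, hDe]
  -- the linear part of the return map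
  let L₀ : F →L[ℝ] F := (ContinuousLinearMap.snd ℝ ℝ F).comp
    ((ℒ.symm : EuclideanSpace ℝ (Fin n) →L[ℝ] ℝ × F).comp
      (D.comp ((ℒ : (ℝ × F) →L[ℝ] EuclideanSpace ℝ (Fin n)).comp (ContinuousLinearMap.inr ℝ ℝ F))))
  have hL₀ : ∀ y, L₀ y = (ℒ.symm (D (ℒ (0, y)))).2 := fun y => rfl
  have hPD : ∀ v, (ℒ.symm (D v)).2 = L₀ (ℒ.symm v).2 := by
    intro v
    obtain ⟨⟨s, y⟩, rfl⟩ := ℒ.surjective v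
    have h1 : ((s, y) : ℝ × F) = (s, 0) + (0, y) := by simp
    rw [ℒ.symm_apply_apply, hL₀, h1, map_add, map_add, hDsymm, map_add, ℒ.symm_apply_apply]
    simp
  have hinj : Function.Injective L₀ := by
    rw [injective_iff_map_eq_zero]
    intro y hy
    rw [hL₀] at hy
    set s := (ℒ.symm (D (ℒ (0, y)))).1 with hs
    have h1 : ℒ.symm (D (ℒ (0, y))) = (s, 0) := Prod.ext rfl hy
    have h2 : D (ℒ (0, y)) = D (ℒ (s, 0)) := by
      rw [hDsymm, ← h1, ℒ.apply_symm_apply]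
    have hDinj : Function.Injective D := (tangentFlowEquiv X T p).injective
    have h3 := ℒ.injective (hDinj h2)
    exact (Prod.ext_iff.1 h3).2
  let L : F ≃L[ℝ] F := (LinearEquiv.ofInjectiveEndo L₀.toLinearMap hinj).toContinuousLinearEquiv
  have hL : (L : F →L[ℝ] F) = L₀ := by ext; rfl
  refine ⟨L, fun v => hPD v, ?_⟩
  -- the time and the place of the first return
  let R : F → EuclideanSpace ℝ (Fin n) := fun y => chartFlow X p T (z₀ + ℒ (0, y))
  let g : F → ℝ × F := fun y => e.symm (R y)
  let f₁ : F → F := fun y => (g y).2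
  have hz0 : z₀ + ℒ (0, (0 : F)) = z₀ := by
    rw [show ((0 : ℝ), (0 : F)) = 0 from rfl, map_zero, add_zero]
  have hR0 : R 0 = z₀ := by
    change chartFlow X p T (z₀ + ℒ (0, 0)) = z₀
    rw [hz0, chartFlow, extChartAt_to_inv, hT]
  have hg0 : g 0 = 0 := by
    change e.symm (R 0) = 0
    rw [hR0]
    exact h.symm_base
  have hRC : ContDiffAt ℝ 1 R 0 := by
    refine ContDiffAt.comp (g := chartFlow X p T) (f := fun y : F => z₀ + ℒ (0, y)) 0 ?_
      (by fun_prop)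
    rw [hz0]
    exact contDiffAt_chartFlow hT
  have hRD : HasFDerivAt R (D.comp ((ℒ : (ℝ × F) →L[ℝ] EuclideanSpace ℝ (Fin n)).comp
      (ContinuousLinearMap.inr ℝ ℝ F))) 0 := by
    refine HasFDerivAt.comp (g := chartFlow X p T) (f := fun y : F => z₀ + ℒ (0, y)) 0 ?_
      (hasFDerivAt_affine z₀ ℒ)
    rw [hz0]
    exact hasFDerivAt_chartFlow hT
  have hsC : ContDiffAt ℝ 1 e.symm z₀ :=
    h.contDiffOn_symm.contDiffAt (e.open_target.mem_nhds h.base_mem_target)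
  have hsD : HasFDerivAt e.symm (ℒ.symm : EuclideanSpace ℝ (Fin n) →L[ℝ] ℝ × F) z₀ := by
    refine e.hasFDerivAt_symm h.base_mem_target ?_
    rw [h.symm_base]
    exact h.hasFDerivAt.congr_of_eventuallyEq (Eventually.of_forall h.coe_eq)
  have hgC : ContDiffAt ℝ 1 g 0 := by
    refine ContDiffAt.comp (g := e.symm) 0 ?_ hRC
    rw [hR0]
    exact hsC
  have hgD : HasFDerivAt g ((ℒ.symm : EuclideanSpace ℝ (Fin n) →L[ℝ] ℝ × F).comp
      (D.comp ((ℒ : (ℝ × F) →L[ℝ] EuclideanSpace ℝ (Fin n)).comp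
      (ContinuousLinearMap.inr ℝ ℝ F)))) 0 := by
    refine HasFDerivAt.comp (g := e.symm) 0 ?_ hRD
    rw [hR0]
    exact hsD
  have hf₁C : ContDiffAt ℝ 1 f₁ 0 := contDiff_snd.contDiffAt.comp 0 hgC
  have hf₁D : HasFDerivAt f₁ (L : F →L[ℝ] F) 0 := by
    rw [hL]
    exact (ContinuousLinearMap.snd ℝ ℝ F).hasFDerivAt.comp 0 hgD
  have hf₁0 : f₁ 0 = 0 := by change (g 0).2 = 0; rw [hg0]; rfl
  have hst : HasStrictFDerivAt f₁ (L : F →L[ℝ] F) 0 := hf₁C.hasStrictFDerivAt' hf₁D one_ne_zero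
  set k := hst.localInverse f₁ L 0 with hk
  have hk0 : k 0 = 0 := by
    have := hst.localInverse_apply_image
    rwa [hf₁0] at this
  have hkC : ContDiffAt ℝ 1 k 0 := by
    have := hf₁C.to_localInverse hf₁D one_ne_zero
    rwa [hf₁0] at this
  have hkD : HasFDerivAt k (L.symm : F →L[ℝ] F) 0 := by
    have := hst.to_localInverse.hasFDerivAt
    rwa [hf₁0] at this
  have hkr : ∀ᶠ y in 𝓝 0, f₁ (k y) = y := by
    have := hst.eventually_right_inverse
    rwa [hf₁0] at this
  let G : F → F := fun y => k (L y)
  have hL0 : L 0 = 0 := map_zero L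
  have hGC : ContDiffAt ℝ 1 G 0 := by
    refine ContDiffAt.comp (g := k) (f := fun y => L y) 0 ?_ L.contDiff.contDiffAt
    rw [hL0]
    exact hkC
  have hGD : HasFDerivAt G (ContinuousLinearMap.id ℝ F) 0 := by
    have h1 : HasFDerivAt G ((L.symm : F →L[ℝ] F).comp (L : F →L[ℝ] F)) 0 := by
      refine HasFDerivAt.comp (g := k) (f := fun y => L y) 0 ?_ L.hasFDerivAt
      rw [hL0]
      exact hkD
    rwa [ContinuousLinearEquiv.coe_symm_comp_coe] at h1
  have hG0 : G 0 = 0 := by change k (L 0) = 0; rw [hL0, hk0]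
  obtain ⟨u, hu, huC⟩ := hGC.contDiffOn (m := 1) le_rfl (by simp)
  obtain ⟨R', hR', hR'u⟩ := Metric.mem_nhds_iff.1 hu
  have hG0t : Tendsto G (𝓝 0) (𝓝 0) := by
    have := hGC.continuousAt.tendsto
    rwa [hG0] at this
  refine ⟨G, R', hR', huC.mono hR'u, hG0, hGD, fun y => (g (G y)).1, ?_, ?_⟩
  · have h1 : Tendsto g (𝓝 0) (𝓝 0) := by
      have := hgC.continuousAt.tendsto
      rwa [hg0] at this
    exact ((continuous_fst.tendsto 0).comp h1).comp hG0t
  · have e1 : ∀ᶠ y in 𝓝 0, f₁ (G y) = L y := by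
      have : Tendsto (fun y => L y) (𝓝 0) (𝓝 0) := by
        have := L.continuous.tendsto 0
        rwa [hL0] at this
      exact this.eventually hkr
    have hRt : Tendsto (fun y => R (G y)) (𝓝 0) (𝓝 z₀) := by
      have := hRC.continuousAt.tendsto
      rw [hR0] at this
      exact this.comp hG0t
    have hflt : Tendsto (fun y => flow X T (affineSection p ℒ (G y))) (𝓝 0) (𝓝 p) := by
      have h1 : ContinuousAt (fun y : F => affineSection p ℒ y) 0 := by
        refine ContinuousAt.comp (g := (extChartAt (𝓡 n) p).symm)
          (f := fun y : F => z₀ + ℒ (0, y)) ?_ (by fun_prop)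
        rw [hz0]
        exact continuousAt_extChartAt_symm p
      have h2 := ((continuous_flow_time X T).continuousAt.comp h1).tendsto
      rw [Function.comp_apply, affineSection_zero, hT] at h2
      exact h2.comp hG0t
    filter_upwards [e1, hRt.eventually_mem (e.open_target.mem_nhds h.base_mem_target),
      hflt.eventually_mem (extChartAt_source_mem_nhds (I := 𝓡 n) p)] with y hy1 hy2 hy3
    have h1 : boxMap X p ℒ (g (G y)) = R (G y) := by
      rw [← h.coe_eq]
      exact e.right_inv hy2
    have hmem : g (G y) ∈ Ioo (-ε) ε ×ˢ Metric.ball (0 : F) ρ := by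
      rw [← h.source_eq]
      exact e.map_target hy2
    have h2 := h.flow_eq_symm hmem
    rw [h1] at h2
    have h3 : (extChartAt (𝓡 n) p).symm (R (G y)) = flow X T (affineSection p ℒ (G y)) :=
      (extChartAt (𝓡 n) p).left_inv hy3
    rw [← h3, ← h2]
    change _ = flow X (g (G y)).1 (affineSection p ℒ (L y))
    rw [← hy1]

end IsFlowBox

end Section

/-! ### Hyperbolicity of periodic orbits -/

section PeriodicOrbit

variable {n : ℕ} {M : Type*} [EMetricSpace M] [ChartedSpace (EuclideanSpace ℝ (Fin n)) M]
  [IsManifold (𝓡 n) ∞ M] [CompactSpace M]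

/-- The flows of two vector fields agree along an orbit segment on which the fields agree. -/
theorem flow_eq_flow_of_eqOn {X Z : C1VectorField n M} {x : M} {a b : ℝ} (h0 : (0 : ℝ) ∈ Ioo a b)
    (h : ∀ s ∈ Ioo a b, Z (flow X s x) = X (flow X s x)) {t : ℝ} (ht : t ∈ Ioo a b) :
    flow Z t x = flow X t x := by
  have h1 : IsMIntegralCurveOn (I := 𝓡 n) (fun t => flow X t x) (fun p => Z p) (Ioo a b) := by
    intro s hs
    have := (isMIntegralCurve_flow X x s).hasMFDerivWithinAt (s := Ioo a b)
    rw [show (fun p => X p) ((fun t => flow X t x) s) = (fun p => Z p) ((fun t => flow X t x) s) from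
      (h s hs).symm] at this
    exact this
  have := flow_eqOn_Ioo Z h0 h1 ht
  rwa [flow_zero] at this

variable {F : Type*} [NormedAddCommGroup F] [NormedSpace ℝ F] [FiniteDimensional ℝ F]
  {X : C1VectorField n M} {p : M} {ℒ : (ℝ × F) ≃L[ℝ] EuclideanSpace ℝ (Fin n)}
  {ε ρ : ℝ} {e : OpenPartialHomeomorph (ℝ × F) (EuclideanSpace ℝ (Fin n))}

/-- A closed orbit whose return map, precomposed with a map `G` tangent to the identity, is the
linear map `L`, becomes a closed orbit with return map `L` after an arbitrarily small perturbation
of the vector field in a flow box. -/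
theorem IsFlowBox.exists_isLinearSection (h : IsFlowBox X p ℒ ε ρ e) {T : ℝ}
    (hT : IsLeastPeriod X p T) {L : F ≃L[ℝ] F} {G : F → F} {R : ℝ} (hR : 0 < R)
    (hGC : ContDiffOn ℝ 1 G (Metric.ball 0 R)) (hG0 : G 0 = 0)
    (hGD : HasFDerivAt G (ContinuousLinearMap.id ℝ F) 0) {τ : F → ℝ}
    (hτ : Tendsto τ (𝓝 0) (𝓝 0))
    (hret : ∀ᶠ y in 𝓝 0, flow X T (affineSection p ℒ (G y)) = flow X (τ y) (affineSection p ℒ (L y)))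
    {𝒱 : Set (C1VectorField n M)} (h𝒱 : 𝒱 ∈ 𝓝 X) :
    ∃ Z ∈ 𝒱, orbit Z p ⊆ orbit X p ∧ ∃ b > 0,
      IsLinearSection Z (affineSection p ℒ) L (fun y => T - τ y) b (T / 2) (T + T / 2) ∧
      ∃ N : Set M, IsOpen N ∧ (∀ w, ‖w‖ ≤ b → affineSection p ℒ w ∈ N) ∧ ∃ Pr : M → F,
        ContinuousOn Pr N ∧ (∀ w, ‖w‖ ≤ b → Pr (affineSection p ℒ w) = w) ∧
        ∀ x ∈ N, ∃ s, flow Z s x = affineSection p ℒ (Pr x) := by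
  have hT0 := hT.1
  have hε := h.time_pos
  have hρ := h.radius_pos
  have hq0 := affineSection_zero p ℒ
  set q : F → M := affineSection p ℒ with hq
  set Θ := boxMap X p ℒ with hΘ
  obtain ⟨a₁, ha₁, ρ₁, hρ₁, hFB⟩ := exists_flowBox_perturbation (isOpen_extChartAt_target p)
    (contDiffOn_localRep X p) hε hρ h.contDiffOn
    (fun x hx => ⟨(extChartAt (𝓡 n) p).map_source (h.mem_source x hx), h.hasDerivAt x hx⟩)
    h.hasFDerivAt hR hGC hG0 hGD
  set a := min a₁ (min (ε / 2) (T / 2)) with ha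
  have ha0 : 0 < a := by positivity
  have haa₁ : a ≤ a₁ := min_le_left _ _
  have haε : a < ε := by
    have : a ≤ ε / 2 := (min_le_right _ _).trans (min_le_left _ _)
    linarith
  have haT : a ≤ T / 2 := (min_le_right _ _).trans (min_le_right _ _)
  -- the piece of orbit where the field is perturbed, and the piece where it is not
  obtain ⟨O₁, O₂, hO₁, hO₂, hA₁, hA₂, hO⟩ :
      SeparatedNhds ((fun s => flow X s p) '' Icc (a / 3) (2 * a / 3))
        ((fun s => flow X s p) '' Icc (3 * a / 4) (T + a / 6)) := by
    refine SeparatedNhds.of_isCompact_isCompact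
      (isCompact_Icc.image (continuous_flow_orbit X p))
      (isCompact_Icc.image (continuous_flow_orbit X p)) (disjoint_left.2 ?_)
    rintro _ ⟨s, hs, rfl⟩ ⟨t, ht, hst⟩
    exact hT.flow_ne (t := t) (s := s) (by linarith [hs.2, ht.1]) (by linarith [hs.1, ht.2]) hst
  have hbox0 : ∀ s ∈ Ioo (-ε) ε, (s, (0 : F)) ∈ Ioo (-ε) ε ×ˢ Metric.ball (0 : F) ρ :=
    fun s hs => ⟨hs, by simpa using hρ⟩
  obtain ⟨K₀, hK₀, hsegK₀, hK₀Ω⟩ : ∃ K₀, IsCompact K₀ ∧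
      (fun s : ℝ => Θ (s, 0)) '' Icc (a / 3) (2 * a / 3) ⊆ interior K₀ ∧
      K₀ ⊆ (extChartAt (𝓡 n) p).target ∩ (extChartAt (𝓡 n) p).symm ⁻¹' O₁ := by
    have hmem : ∀ s ∈ Icc (a / 3) (2 * a / 3), s ∈ Ioo (-ε) ε := fun s hs =>
      ⟨by linarith [hs.1], by linarith [hs.2]⟩
    refine exists_compact_between (isCompact_Icc.image_of_continuousOn ?_)
      ((continuousOn_extChartAt_symm p).isOpen_inter_preimage (isOpen_extChartAt_target p) hO₁) ?_
    · exact h.contDiffOn.continuousOn.comp (f := fun s : ℝ => (s, (0 : F))) (by fun_prop)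
        fun s hs => hbox0 s (hmem s hs)
    · rintro _ ⟨s, hs, rfl⟩
      have hsb := hbox0 s (hmem s hs)
      refine ⟨(extChartAt (𝓡 n) p).map_source (h.mem_source _ hsb), ?_⟩
      rw [mem_preimage, ← h.flow_eq_symm hsb]
      refine hA₁ ⟨s, hs, ?_⟩
      change flow X s p = flow X s (q 0)
      rw [hq0]
  have hK₀t : K₀ ⊆ (extChartAt (𝓡 n) p).target := hK₀Ω.trans inter_subset_left
  obtain ⟨η, hη, hpert⟩ := exists_add_pushField_mem X h𝒱 hK₀ hK₀t
  obtain ⟨W, hW, hWs, hWη, r, hr, Θ', hΘ'⟩ := hFB a ⟨ha0, haa₁⟩ (interior K₀) isOpen_interior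
    (fun s hs => hsegK₀ ⟨s, hs, rfl⟩) η hη
  have hWK : tsupport W ⊆ K₀ := hWs.trans interior_subset
  have hWc : HasCompactSupport W := hK₀.of_isClosed_subset (isClosed_tsupport _) hWK
  have hWt := hWK.trans hK₀t
  set Z := X + pushField p W hW hWc hWt with hZ
  have hZoff : ∀ x, x ∉ O₁ → Z x = X x := fun x hx => by
    have h1 : x ∉ chartSet p (tsupport W) := by
      rintro ⟨z, hz, rfl⟩
      exact hx (hK₀Ω (hWK hz)).2
    rw [hZ, ContMDiffSection.coe_add, Pi.add_apply, pushField_of_not_mem h1, add_zero]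
  have hZrep : ∀ z ∈ (extChartAt (𝓡 n) p).target,
      localRep Z p z = localRep X p z + W z := fun z hz => by
    rw [hZ, localRep_add, localRep_pushField_self hz]
  set ρ₂ := min ρ ρ₁ with hρ₂
  have hρ₂0 : 0 < ρ₂ := lt_min hρ hρ₁
  have hyρ : ∀ {y : F}, ‖y‖ < ρ₂ → y ∈ Metric.ball (0 : F) ρ := fun hy =>
    mem_ball_zero_iff.2 (hy.trans_le (min_le_left _ _))
  have hyρ₁ : ∀ {y : F}, ‖y‖ < ρ₂ → y ∈ Metric.ball (0 : F) ρ₁ := fun hy =>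
    mem_ball_zero_iff.2 (hy.trans_le (min_le_right _ _))
  have h0a : (0 : ℝ) ∈ Ioo (-a) a := ⟨by linarith, ha0⟩
  have haIoo : ∀ {s : ℝ}, s ∈ Ioo (-a) a → s ∈ Ioo (-ε) ε := fun hs =>
    ⟨by linarith [hs.1], by linarith [hs.2]⟩
  -- the perturbed flow in the box
  have hZbox : ∀ {y : F}, ‖y‖ < ρ₂ → ∀ {s : ℝ}, s ∈ Ioo (-a) a →
      flow Z s (q y) = (extChartAt (𝓡 n) p).symm (Θ' (s, y)) := by
    intro y hy s hs
    have h1 := flow_eq_chart_symm Z (c := p) (ζ := fun s => Θ' (s, y)) h0a (fun t ht => by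
      obtain ⟨e1, e2, -⟩ := hΘ' (t, y) ⟨ht, hyρ₁ hy⟩
      refine ⟨e1, ?_⟩
      rw [hZrep _ e1]
      exact e2) hs
    have h2 := (hΘ' (0, y) ⟨h0a, hyρ₁ hy⟩).2.2.1 (by change (0 : ℝ) ≤ a / 3; positivity)
    have h3 := h.flow_eq_symm (x := (0, y)) ⟨haIoo h0a, hyρ hy⟩
    rw [flow_zero] at h3
    change flow Z s ((extChartAt (𝓡 n) p).symm (Θ' (0, y))) = _ at h1
    rw [h2, ← h3] at h1
    exact h1
  -- the perturbed flow after the box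
  have hZexit : ∀ {y : F}, ‖y‖ < ρ₂ → ‖y‖ ≤ r → G y ∈ Metric.ball (0 : F) ρ →
      (∀ s ∈ Icc (3 * a / 4) (T + a / 6), flow X s (q (G y)) ∈ O₂) →
      ∀ s ∈ Ioo (3 * a / 4) (T + a / 6), flow Z s (q y) = flow X s (q (G y)) := by
    intro y hy hyr hGy hO₂y s hs
    have hm : 5 * a / 6 ∈ Ioo (-a) a := ⟨by linarith, by linarith⟩
    have h1 := hZbox hy hm
    rw [(hΘ' (5 * a / 6, y) ⟨hm, hyρ₁ hy⟩).2.2.2.2 hyr (by change _ ≤ 5 * a / 6; linarith)] at h1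
    have h2 := h.flow_eq_symm (x := (5 * a / 6, G y)) ⟨haIoo hm, hGy⟩
    change flow X (5 * a / 6) (q (G y)) = _ at h2
    have h3 : flow Z (5 * a / 6) (q y) = flow X (5 * a / 6) (q (G y)) := h1.trans h2.symm
    have h4 := flow_eq_flow_of_eqOn (X := X) (Z := Z) (x := flow X (5 * a / 6) (q (G y)))
      (a := 3 * a / 4 - 5 * a / 6) (b := T + a / 6 - 5 * a / 6)
      ⟨by linarith, by linarith⟩ (fun u hu => by
        refine hZoff _ fun hmem => disjoint_left.1 hO hmem ?_
        rw [← flow_add]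
        exact hO₂y _ ⟨by linarith [hu.1], by linarith [hu.2]⟩)
      (t := s - 5 * a / 6) ⟨by linarith [hs.1], by linarith [hs.2]⟩
    rw [← h3, ← flow_add, h3, ← flow_add, sub_add_cancel] at h4
    exact h4
  have hZ0 : ∀ s ∈ Icc 0 T, flow Z s p = flow X s p := by
    intro s hs
    have h0ρ : ‖(0 : F)‖ < ρ₂ := by rwa [norm_zero]
    rcases lt_or_ge s a with hsa | hsa
    · have hsI : s ∈ Ioo (-a) a := ⟨by linarith [hs.1], hsa⟩
      have h1 := hZbox h0ρ hsI
      rw [(hΘ' (s, 0) ⟨hsI, hyρ₁ h0ρ⟩).2.2.2.1 rfl,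
        ← h.flow_eq_symm (hbox0 s (haIoo hsI))] at h1
      change flow Z s (q 0) = flow X s (q 0) at h1
      rwa [hq0] at h1
    · have h1 := hZexit h0ρ (by rw [norm_zero]; exact hr.le) (by rw [hG0]; simpa using hρ)
        (fun u hu => hA₂ ⟨u, hu, by rw [hG0, hq0]⟩) s ⟨by linarith, by linarith [hs.2]⟩
      rwa [hG0, hq0] at h1
  have hZT : flow Z T p = p := by rw [hZ0 T ⟨hT0.le, le_rfl⟩, hT.2.1]
  have horb : orbit Z p ⊆ orbit X p := by
    intro x hx
    obtain ⟨s, hs, rfl⟩ := orbit_subset_image_Icc hT0 hZT hx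
    exact ⟨s, (hZ0 s hs).symm⟩
  -- the points at which the return to the section is controlled
  have hqt : Tendsto q (𝓝 0) (𝓝 p) := by
    have h1 : ContinuousAt q 0 := by
      refine ContinuousAt.comp (g := (extChartAt (𝓡 n) p).symm)
        (f := fun y : F => extChartAt (𝓡 n) p p + ℒ (0, y)) ?_ (by fun_prop)
      rw [show ((0 : ℝ), (0 : F)) = 0 from rfl, map_zero, add_zero]
      exact continuousAt_extChartAt_symm p
    have h2 := h1.tendsto
    rwa [hq0] at h2
  have hGt : Tendsto G (𝓝 0) (𝓝 0) := by
    have := hGD.continuousAt.tendsto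
    rwa [hG0] at this
  have hev₁ : ∀ᶠ y in 𝓝 (0 : F), ∀ s ∈ Icc (3 * a / 4) (T + a / 6), flow X s (q (G y)) ∈ O₂ := by
    refine isCompact_Icc.eventually_forall_of_forall_eventually fun s hs => ?_
    have h1 : Tendsto (fun x : F × ℝ => flow X x.2 (q (G x.1))) (𝓝 (0, s)) (𝓝 (flow X s p)) := by
      have h2 : Tendsto (fun x : F × ℝ => (x.2, q (G x.1))) (𝓝 (0, s)) (𝓝 (s, p)) := by
        rw [nhds_prod_eq, nhds_prod_eq]
        exact tendsto_snd.prodMk ((hqt.comp hGt).comp tendsto_fst)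
      exact ((continuous_flow X).tendsto (s, p)).comp h2
    exact h1.eventually_mem (hO₂.mem_nhds (hA₂ ⟨s, hs, rfl⟩))
  have hev₂ : ∀ᶠ y in 𝓝 (0 : F), ‖y‖ < ρ₂ → q y ∈ orbit X p → y = 0 := by
    filter_upwards [hqt.eventually (hT.eventually_exists_time hε)] with y hy hyρ' hyo
    obtain ⟨s, hs, hsy⟩ := hy hyo
    have hsI : s ∈ Ioo (-ε) ε := abs_lt.1 hs
    have h1 : e (s, 0) = e (0, y) := by
      rw [h.coe_eq, h.coe_eq]
      change extChartAt (𝓡 n) p (flow X s (q 0)) = extChartAt (𝓡 n) p (flow X 0 (q y))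
      rw [hq0, hsy, flow_zero]
    have h2 := e.injOn (by rw [h.source_eq]; exact hbox0 s hsI)
      (by rw [h.source_eq]; exact ⟨haIoo h0a, hyρ hyρ'⟩) h1
    exact (Prod.ext_iff.1 h2).2.symm
  obtain ⟨b, hb, hbP⟩ := Metric.nhds_basis_closedBall.eventually_iff.1
    (((eventually_mem_set (s := Metric.ball (0 : F) (min ρ₂ r))).2
      (Metric.ball_mem_nhds (0 : F) (lt_min hρ₂0 hr))).and
    ((hGt.eventually_mem (Metric.ball_mem_nhds (0 : F) hρ)).and
    ((hτ.eventually_mem (Ioo_mem_nhds (show -(a / 6) < 0 by linarith)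
      (show 0 < a / 6 by linarith))).and (hret.and (hev₁.and hev₂)))))
  replace hbP : ∀ y : F, ‖y‖ ≤ b → ‖y‖ < ρ₂ ∧ ‖y‖ ≤ r ∧ G y ∈ Metric.ball (0 : F) ρ ∧
      τ y ∈ Ioo (-(a / 6)) (a / 6) ∧ flow X T (q (G y)) = flow X (τ y) (q (L y)) ∧
      (∀ s ∈ Icc (3 * a / 4) (T + a / 6), flow X s (q (G y)) ∈ O₂) ∧
      (q y ∈ orbit X p → y = 0) := fun y hy => by
    obtain ⟨h1, h2, h3, h4, h5, h6⟩ := hbP (mem_closedBall_zero_iff.2 hy)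
    have h1' : ‖y‖ < min ρ₂ r := mem_ball_zero_iff.1 h1
    have h1'' := h1'.trans_le (min_le_left _ _)
    exact ⟨h1'', (h1'.trans_le (min_le_right _ _)).le, h2, h3, h4, h5, h6 h1''⟩
  refine ⟨Z, hpert W hW hWc hWt hWK hWη, horb, b, hb, ⟨hb, by linarith, ?_, fun w hw => ?_,
    fun w hw => ?_, fun w hw => ?_, fun w hw hwo => ?_⟩, ?_⟩
  · refine (continuousOn_extChartAt_symm p).comp (f := fun y : F => extChartAt (𝓡 n) p p + ℒ (0, y))
      (by fun_prop) fun w hw => ?_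
    exact h.mem_target w (hyρ (hbP w (mem_closedBall_zero_iff.1 hw)).1)
  · obtain ⟨h1, h2, h3, h4, h5, h6, -⟩ := hbP w hw
    rw [hZexit h1 h2 h3 h6 _ ⟨by linarith [h4.2], by linarith [h4.1]⟩, sub_eq_neg_add, flow_add, h5,
      flow_neg_flow]
  · obtain ⟨-, -, -, h4, -⟩ := hbP w hw
    linarith [h4.2]
  · obtain ⟨-, -, -, h4, -⟩ := hbP w hw
    linarith [h4.1]
  · rw [hq0] at hwo
    exact (hbP w hw).2.2.2.2.2.2 (horb hwo)
  · set B' : Set (ℝ × F) := Ioo (-(a / 3)) (a / 3) ×ˢ Metric.ball 0 ρ₂ with hB'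
    have hB'o : IsOpen B' := isOpen_Ioo.prod Metric.isOpen_ball
    have hφq : ∀ w, ‖w‖ ≤ b → q w ∈ (extChartAt (𝓡 n) p).source ∧
        extChartAt (𝓡 n) p (q w) = e (0, w) := fun w hw => by
      have hw' : ((0 : ℝ), w) ∈ Ioo (-ε) ε ×ˢ Metric.ball (0 : F) ρ :=
        ⟨haIoo h0a, hyρ (hbP w hw).1⟩
      have h1 := h.mem_source _ hw'
      rw [flow_zero] at h1
      refine ⟨h1, ?_⟩
      rw [h.coe_eq]
      change _ = extChartAt (𝓡 n) p (flow X 0 (q w))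
      rw [flow_zero]
    have hsrc : ∀ w, ‖w‖ ≤ b → ((0 : ℝ), w) ∈ e.source := fun w hw => by
      rw [h.source_eq]
      exact ⟨haIoo h0a, hyρ (hbP w hw).1⟩
    refine ⟨(extChartAt (𝓡 n) p).source ∩ extChartAt (𝓡 n) p ⁻¹' (e.target ∩ e.symm ⁻¹' B'),
      (continuousOn_extChartAt p).isOpen_inter_preimage (isOpen_extChartAt_source p)
        (e.symm.isOpen_inter_preimage hB'o), fun w hw => ?_,
      fun x => (e.symm (extChartAt (𝓡 n) p x)).2, ?_, fun w hw => ?_, ?_⟩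
    · obtain ⟨h1, h2⟩ := hφq w hw
      refine ⟨h1, ?_⟩
      rw [mem_preimage, h2]
      refine ⟨e.map_source (hsrc w hw), ?_⟩
      rw [mem_preimage, e.left_inv (hsrc w hw)]
      exact ⟨⟨by linarith, by linarith⟩, mem_ball_zero_iff.2 (hbP w hw).1⟩
    · refine continuous_snd.comp_continuousOn (e.symm.continuousOn.comp
        ((continuousOn_extChartAt p).mono inter_subset_left) fun x hx => hx.2.1)
    · change (e.symm (extChartAt (𝓡 n) p (q w))).2 = w
      rw [(hφq w hw).2, e.left_inv (hsrc w hw)]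
    · rintro x ⟨hxs, hxt, hxB⟩
      set u := e.symm (extChartAt (𝓡 n) p x) with hu
      have huB : u ∈ B' := hxB
      have hus : u.1 ∈ Ioo (-a) a := ⟨by linarith [huB.1.1], by linarith [huB.1.2]⟩
      have huρ : ‖u.2‖ < ρ₂ := mem_ball_zero_iff.1 huB.2
      have h1 := hZbox huρ hus
      have h2 : Θ' (u.1, u.2) = extChartAt (𝓡 n) p x := by
        rw [(hΘ' (u.1, u.2) ⟨hus, hyρ₁ huρ⟩).2.2.1 huB.1.2.le, ← h.coe_eq]
        exact e.right_inv hxt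
      rw [h2, (extChartAt (𝓡 n) p).left_inv hxs] at h1
      exact ⟨-u.1, (congrArg (flow Z (-u.1)) h1).symm.trans (flow_neg_flow Z u.1 _)⟩

/-- A nonzero vector spans a factor of the space. -/
theorem exists_equiv_prod {v : EuclideanSpace ℝ (Fin n)} (hv : v ≠ 0) :
    ∃ (F : Submodule ℝ (EuclideanSpace ℝ (Fin n)))
      (ℒ : (ℝ × F) ≃L[ℝ] EuclideanSpace ℝ (Fin n)), ℒ (1, 0) = v := by
  let ℓ : (ℝ × (ℝ ∙ v)ᗮ) ≃ₗ[ℝ] EuclideanSpace ℝ (Fin n) :=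
    ((LinearEquiv.toSpanNonzeroSingleton ℝ _ v hv).prodCongr (LinearEquiv.refl ℝ _)).trans
      (Submodule.prodEquivOfIsCompl _ _ (ℝ ∙ v).isCompl_orthogonal)
  refine ⟨(ℝ ∙ v)ᗮ, ℓ.toContinuousLinearEquiv, ?_⟩
  change ℓ (1, 0) = v
  simp [ℓ]

/-- A periodic orbit in the interior of a block `U` is hyperbolic when the maximal invariant set
of every nearby vector field in `U` is shadowable. -/
theorem isHyperbolic_periodicOrbit [RiemannianBundle (fun x : M => TangentSpace (𝓡 n) x)]
    [IsContMDiffRiemannianBundle (𝓡 n) ∞ (EuclideanSpace ℝ (Fin n))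
      (fun x : M => TangentSpace (𝓡 n) x)]
    {U : Set M} {𝒱 : Set (C1VectorField n M)} (h𝒱 : 𝒱 ∈ 𝓝 X)
    (hsh : ∀ Z ∈ 𝒱, IsShadowable Z (continuation Z U)) {γ : Set M} (hγ : IsPeriodicOrbit X γ)
    (hγU : γ ⊆ interior U) : IsHyperbolic X γ := by
  obtain ⟨p, rfl, hp, T₀, hT₀, hTp⟩ := hγ
  obtain ⟨T, hT⟩ := exists_isLeastPeriod hp hT₀ hTp
  obtain ⟨F, ℒ, hℒ⟩ := exists_equiv_prod (v := fieldAt X p) hp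
  obtain ⟨ε, ρ, e, hbox⟩ := exists_isFlowBox hℒ
  obtain ⟨L, hL, G, R, hR, hGC, hG0, hGD, τ, hτ, hret⟩ := hbox.exists_returnMap hℒ hT.2.1
  refine isHyperbolic_orbit hT.1 hT.2.1 (fun x₀ hx₀ => hT.exists_continuous_time hx₀) L
    ((ContinuousLinearMap.snd ℝ ℝ _).comp (ℒ.symm : EuclideanSpace ℝ (Fin n) →L[ℝ] _))
    (fun y => ⟨ℒ (0, y), ?_⟩) (fun v => ?_) hL ?_
  · change (ℒ.symm (ℒ (0, y))).2 = y
    rw [ℒ.symm_apply_apply]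
  · change (ℒ.symm v).2 = 0 ↔ _
    rw [Submodule.mem_span_singleton]
    constructor
    · intro hv
      refine ⟨(ℒ.symm v).1, ?_⟩
      rw [← hℒ, ← map_smul, ← ℒ.apply_symm_apply v]
      congr 1
      rw [ℒ.symm_apply_apply]
      ext <;> simp [hv]
    · rintro ⟨s, rfl⟩
      rw [← hℒ, ← map_smul, ℒ.symm_apply_apply]
      simp
  · by_contra hLb
    obtain ⟨Z, hZ, horb, b, hb, hsec, N, hN, hNq, Pr, hPr, hPrq, hPrf⟩ :=
      hbox.exists_isLinearSection hT hR hGC hG0 hGD hτ hret h𝒱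
    refine hsec.not_isShadowable ?_ hN hNq hPr hPrq hPrf hLb (hsh Z hZ)
    rw [affineSection_zero]
    exact horb.trans hγU

end PeriodicOrbit

end RobustShadowing

theorem proposition3p2 {n : ℕ} {M : Type*} [EMetricSpace M] [CompactSpace M]
    [ChartedSpace (EuclideanSpace ℝ (Fin n)) M] [IsManifold (𝓡 n) ∞ M]
    [RiemannianBundle (fun x : M => TangentSpace (𝓡 n) x)]
    [IsContMDiffRiemannianBundle (𝓡 n) ∞ (EuclideanSpace ℝ (Fin n))
      (fun x : M => TangentSpace (𝓡 n) x)]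
    [IsRiemannianManifold (𝓡 n) M]
    (X : RobustShadowing.C1VectorField n M) (Λ U : Set M)
    (hΛ : RobustShadowing.IsRobustlyShadowable X Λ U) :
    ∃ 𝒰 ∈ 𝓝 X, ∀ Y ∈ 𝒰,
      (∀ σ ∈ RobustShadowing.continuation Y U, RobustShadowing.IsSingularity Y σ →
        RobustShadowing.IsHyperbolic Y {σ}) ∧
      (∀ γ ⊆ RobustShadowing.continuation Y U, RobustShadowing.IsPeriodicOrbit Y γ →
        RobustShadowing.IsHyperbolic Y γ) := by
  obtain ⟨-, -, ⟨hUΛ, hU, rfl⟩, 𝒰₀, h𝒰₀, hsh⟩ := hΛ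
  have hint : ∀ᶠ Y in 𝓝 X, RobustShadowing.continuation Y U ⊆ interior U := by
    rcases hU with hU | hU
    · refine Eventually.of_forall fun Y x hx => ?_
      have := RobustShadowing.mem_continuation.1 hx 0
      rw [RobustShadowing.flow_zero] at this
      rwa [hU.interior_eq]
    · exact RobustShadowing.eventually_continuation_subset_interior hU
        (subset_interior_iff_mem_nhdsSet.2 hUΛ)
  refine ⟨interior 𝒰₀ ∩ {Y | RobustShadowing.continuation Y U ⊆ interior U},
    inter_mem (interior_mem_nhds.2 h𝒰₀) hint, fun Y hY => ?_⟩
  have hY𝒰 : interior 𝒰₀ ∈ 𝓝 Y := isOpen_interior.mem_nhds hY.1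
  have hsh' : ∀ Z ∈ interior 𝒰₀, RobustShadowing.IsShadowable Z
      (RobustShadowing.continuation Z U) := fun Z hZ => hsh Z (interior_subset hZ)
  exact ⟨fun σ hσ hs => RobustShadowing.isHyperbolic_singleton hY𝒰 hsh' hs (hY.2 hσ),
    fun γ hγ hp => RobustShadowing.isHyperbolic_periodicOrbit hY𝒰 hsh' hp (hγ.trans hY.2)⟩
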